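/- Let $k$ be a field, $A$ a commutative $k$-algebra, $f=(f_1,\dots,f_n)$ a finite sequence of elements of $A$ and $d\ge 1$ an integer. Let $\mathfrak n$ be the Lie algebra over $k$ freely generated by $x_1,\dots,x_n$ subject to the relations that all expressions involving at least $d$ brackets vanish, let $U$ be its universal enveloping algebra, let ${}_Uk$ be the trivial left $U$-module $k$ (on which every $x_i$ acts as $0$), and regard $A$ as a right $U$-module through the $k$-algebra map $U\to A$, $x_i\mapsto f_i$. For a ring $B$ let $D(B)$ be the derived category of left $B$-modules; an object of $D(B)$ is perfect if it is isomorphic to a bounded complex of finitely generated projective modules. Let $K(f)$ be the Koszul complex of $f$, and let $X\in D(A)$ be the Chevalley–Eilenberg complex $A\otimes_k\Lambda^{*}\mathfrak n$ (with $A\otimes_k\Lambda^p\mathfrak n$ in homological degree $p$) with the $A$-linear differential $$\begin{aligned} d(a\otimes y_1\wedge\dots\wedge y_p)=&\sum_{i=1}^p(-1)^{i+1}ay_i\otimes y_1\wedge\dots\wedge\widehat{y_i}\wedge\dots\wedge y_p\\ &+\sum_{i<j}(-1)^{i+j}a\otimes[y_i,y_j]\wedge y_1\wedge\dots\wedge\widehat{y_i}\wedge\dots\wedge\widehat{y_j}\wedge\dots\wedge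 y_p.\end{aligned}$$ Then: 1. $X\cong A\otimes^L_U {}_Uk$ in $D(A)$, and $X$ is perfect. 2. $X$ and $K(f)$ generate the same thick subcategory of $D(A)$ (the smallest triangulated subcategory closed under direct summands containing the object), and the same localizing subcategory of $D(A)$ (the smallest triangulated subcategory closed under arbitrary direct sums containing the object). 3. For every finite dimensional commutative local $k$-algebra $(R,\mathfrak m)$ with $R/\mathfrak m=k$ and $\mathfrak m^d=0$, and every (possibly noncommutative) $R$-algebra $A'$ with an isomorphism of $k$-algebras $A'/\mathfrak mA'\cong A$, there is a perfect complex $X'\in D(A')$ with $A\otimes^L_{A'}X'\cong X$ in $D(A)$. -/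

import Mathlib

universe u

open CategoryTheory TensorProduct

attribute [local instance] HasDerivedCategory.standard
attribute [local instance 100] LieRing.ofAssociativeRing

noncomputable section

/-! ### Derived categories of modules: perfect objects, thick and localizing subcategories -/

/-- The unbounded derived category `D(B)` of left modules over a (possibly noncommutative) ring. -/
abbrev ModD (B : Type u) [Ring B] := DerivedCategory (ModuleCat.{u} B)

/-- An object of `D(B)` is perfect if it is isomorphic to a bounded complex of finitely generated
projective modules. -/
def IsPerfectObj {B : Type u} [Ring B] (X : ModD B) : Prop :=
  ∃ P : CochainComplex (ModuleCat.{u} B) ℤ,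
    (∀ i, Module.Finite B (P.X i) ∧ Module.Projective B (P.X i)) ∧
    (∃ a b : ℤ, ∀ i, i < a ∨ b < i → Limits.IsZero (P.X i)) ∧
    Nonempty (DerivedCategory.Q.obj P ≅ X)

/-- The smallest thick subcategory (triangulated and closed under direct summands)
containing `X`. -/
def thickSubcat {B : Type u} [Ring B] (X : ModD B) : ObjectProperty (ModD B) :=
  (ObjectProperty.singleton X).triangEnvelope

/-- The smallest localizing subcategory (strictly full, triangulated, and closed under arbitrary
small direct sums) containing `X`. -/
def localizingSubcat {B : Type u} [Ring B] (X : ModD B) : ObjectProperty (ModD B) :=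
  fun Y => ∀ P : ObjectProperty (ModD B), P.IsTriangulated → P.IsClosedUnderIsomorphisms →
    (∀ J : Type u, P.IsClosedUnderColimitsOfShape (Discrete J)) → P X → P Y

/-! ### Extension of scalars along a map of noncommutative rings, and its derived version -/

section ExtScal

variable {S B : Type u} [Ring S] [Ring B] (ψ : S →+* B)

/-- The relations `b ψ(s) ⊗ m = b ⊗ s m` that cut `B ⊗_S M` out of `B ⊗_ℤ M`. -/
def balRel (M : Type u) [AddCommGroup M] [Module S M] : Submodule B (B ⊗[ℤ] M) :=
  Submodule.span B {x | ∃ (b : B) (s : S) (m : M),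
    x = (b * ψ s) ⊗ₜ[ℤ] m - b ⊗ₜ[ℤ] (s • m)}

/-- `B ⊗_S M`, as a left `B`-module, for a left `S`-module `M` and a ring map `ψ : S → B`. -/
abbrev ExtScal (M : Type u) [AddCommGroup M] [Module S M] : Type u :=
  (B ⊗[ℤ] M) ⧸ balRel ψ M

/-- The map `B ⊗_S M → B ⊗_S N` induced by an `S`-linear map `M → N`. -/
def extScalMap {M N : Type u} [AddCommGroup M] [Module S M] [AddCommGroup N] [Module S N]
    (g : M →ₗ[S] N) : ExtScal ψ M →ₗ[B] ExtScal ψ N :=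
  Submodule.mapQ _ _ (TensorProduct.AlgebraTensorModule.map (LinearMap.id : B →ₗ[B] B)
    (g.toAddMonoidHom.toIntLinearMap)) (by
      rw [balRel, Submodule.span_le]
      rintro _ ⟨b, s, m, rfl⟩
      apply Submodule.subset_span
      exact ⟨b, s, g m, by simp⟩)

theorem extScal_ext {M : Type u} [AddCommGroup M] [Module S M] {N : Type u} [AddCommGroup N]
    [Module B N] {g h : ExtScal ψ M →ₗ[B] N}
    (H : ∀ b m, g (Submodule.Quotient.mk (b ⊗ₜ[ℤ] m)) = h (Submodule.Quotient.mk (b ⊗ₜ[ℤ] m))) :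
    g = h := by
  refine LinearMap.ext fun x => ?_
  obtain ⟨x, rfl⟩ := Submodule.Quotient.mk_surjective _ x
  induction x with
  | zero => simp
  | tmul b m => exact H b m
  | add x y hx hy => rw [Submodule.Quotient.mk_add, map_add, map_add, hx, hy]

/-- The functor `B ⊗_S -` from left `S`-modules to left `B`-modules. -/
def extScalFunctor : ModuleCat.{u} S ⥤ ModuleCat.{u} B where
  obj M := ModuleCat.of B (ExtScal ψ M)
  map g := ModuleCat.ofHom (extScalMap ψ g.hom)
  map_id M := ModuleCat.hom_ext (extScal_ext ψ fun b m => by simp [extScalMap])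
  map_comp g h := ModuleCat.hom_ext (extScal_ext ψ fun b m => by simp [extScalMap])

instance : (extScalFunctor ψ).Additive where
  map_add {M N f g} := ModuleCat.hom_ext (extScal_ext ψ fun b m => by
    change (balRel ψ N).mkQ (b ⊗ₜ[ℤ] (f.hom m + g.hom m)) =
      (balRel ψ N).mkQ (b ⊗ₜ[ℤ] f.hom m) + (balRel ψ N).mkQ (b ⊗ₜ[ℤ] g.hom m)
    rw [← map_add, TensorProduct.tmul_add])

/-- `Y` is (isomorphic to) the derived tensor product `B ⊗^L_S X`: it is computed by
`B ⊗_S P` for a K-projective resolution `P` of `X`. -/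
def IsDerivedExtScal (X : ModD S) (Y : ModD B) : Prop :=
  ∃ P : CochainComplex (ModuleCat.{u} S) ℤ, P.IsKProjective ∧
    Nonempty (DerivedCategory.Q.obj P ≅ X) ∧
    Nonempty (DerivedCategory.Q.obj
      (((extScalFunctor ψ).mapHomologicalComplex (ComplexShape.up ℤ)).obj P) ≅ Y)

end ExtScal

/-- The object of `D(B)` given by a complex `⋯ → K₂ → K₁ → K₀ → 0` (with `K_p` in cohomological
degree `-p`). -/
def chainToD {B : Type u} [Ring B] (K : ChainComplex (ModuleCat.{u} B) ℕ) : ModD B :=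
  DerivedCategory.Q.obj (K.extend ComplexShape.embeddingDownNat)

/-! ### Koszul complexes -/

section Koszul

variable {A : Type u} [CommRing A] {n : ℕ} (f : Fin n → A)

/-- The Koszul differential on the exterior algebra of `A^n`: the contraction with the linear form
`e_i ↦ f_i`, that is, the sum over `j` of `(-1)^(j+1) f_{i_j}` times
`e_{i_1} ∧ ⋯ ∧ e_{i_p}` with `e_{i_j}` omitted. -/
def koszulD : ExteriorAlgebra A (Fin n → A) →ₗ[A] ExteriorAlgebra A (Fin n → A) :=
  CliffordAlgebra.contractLeft (Fintype.linearCombination A f)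

theorem koszulD_ι_mul (v : Fin n → A) (x : ExteriorAlgebra A (Fin n → A)) :
    koszulD f (ExteriorAlgebra.ι A v * x) =
      (∑ i, v i * f i) • x - ExteriorAlgebra.ι A v * koszulD f x := by
  have h : Fintype.linearCombination A f v = ∑ i, v i * f i := by
    simp [Fintype.linearCombination_apply]
  rw [← h]
  exact CliffordAlgebra.contractLeft_ι_mul (Q := (0 : QuadraticForm A (Fin n → A))) _ v x

theorem koszulD_koszulD (x : ExteriorAlgebra A (Fin n → A)) : koszulD f (koszulD f x) = 0 :=
  CliffordAlgebra.contractLeft_contractLeft _ x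

theorem koszulD_mem (p : ℕ) : ∀ x ∈ ⋀[A]^(p + 1) (Fin n → A),
    koszulD f x ∈ ⋀[A]^p (Fin n → A) := by
  induction p with
  | zero =>
    intro x hx
    rw [ExteriorAlgebra.exteriorPower, zero_add, pow_one] at hx
    obtain ⟨v, rfl⟩ := hx
    have := koszulD_ι_mul f v 1
    rw [mul_one] at this
    rw [this, ExteriorAlgebra.exteriorPower, pow_zero]
    have h1 : koszulD f (1 : ExteriorAlgebra A (Fin n → A)) = 0 :=
      CliffordAlgebra.contractLeft_one (Q := (0 : QuadraticForm A (Fin n → A))) _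
    rw [h1, mul_zero, sub_zero]
    exact Submodule.smul_mem _ _ (Submodule.one_le.1 le_rfl)
  | succ p ih =>
    intro x hx
    rw [ExteriorAlgebra.exteriorPower, pow_succ'] at hx
    induction hx using Submodule.mul_induction_on' with
    | mem_mul_mem a ha b hb =>
      obtain ⟨v, rfl⟩ := ha
      rw [koszulD_ι_mul]
      refine Submodule.sub_mem _ (Submodule.smul_mem _ _ hb) ?_
      rw [ExteriorAlgebra.exteriorPower, pow_succ']
      exact Submodule.mul_mem_mul ⟨v, rfl⟩ (ih b hb)
    | add x _ y _ hx hy => rw [map_add]; exact Submodule.add_mem _ hx hy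

/-- The Koszul complex `K(f)` of a sequence `f = (f_1, …, f_n)`. -/
def koszulComplex : ChainComplex (ModuleCat.{u} A) ℕ :=
  ChainComplex.of (fun p => ModuleCat.of A (⋀[A]^p (Fin n → A)))
    (fun p => ModuleCat.ofHom ((koszulD f).restrict (koszulD_mem f p)))
    (fun p => by
      refine ModuleCat.hom_ext (LinearMap.ext fun x => ?_)
      exact Subtype.ext (koszulD_koszulD f x))

end Koszul

/-! ### Chevalley–Eilenberg complexes -/

section ChevalleyEilenberg

variable {k : Type u} [Field k] {L : Type u} [LieRing L] [LieAlgebra k L]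

/-- One step of the recursion that extends `ad y` to a derivation of the exterior algebra. -/
def lieAdAux (y : L) : L →ₗ[k] (ExteriorAlgebra k L × ExteriorAlgebra k L) →ₗ[k]
    (ExteriorAlgebra k L × ExteriorAlgebra k L) :=
  LinearMap.mk₂ k (fun z p => (ExteriorAlgebra.ι k z * p.1,
      ExteriorAlgebra.ι k ⁅y, z⁆ * p.1 + ExteriorAlgebra.ι k z * p.2))
    (fun z z' p => by
      refine Prod.ext (by simp [add_mul]) ?_
      simp only [lie_add, map_add, add_mul, Prod.snd_add]; abel)
    (fun c z p => by ext <;> simp)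
    (fun z p p' => by
      refine Prod.ext (by simp [mul_add]) ?_
      simp only [mul_add, Prod.fst_add, Prod.snd_add]; abel)
    (fun c z p => by ext <;> simp)

theorem ι_mul_ι_swap (y z : L) (x : ExteriorAlgebra k L) :
    ExteriorAlgebra.ι k y * (ExteriorAlgebra.ι k z * x) =
      -(ExteriorAlgebra.ι k z * (ExteriorAlgebra.ι k y * x)) := by
  rw [← mul_assoc, ← mul_assoc, ← neg_mul]
  congr 1
  exact eq_neg_of_add_eq_zero_left (ExteriorAlgebra.ι_add_mul_swap y z)

theorem ι_mul_ι_self (y : L) (x : ExteriorAlgebra k L) :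
    ExteriorAlgebra.ι k y * (ExteriorAlgebra.ι k y * x) = 0 := by
  rw [← mul_assoc, ExteriorAlgebra.ι_sq_zero, zero_mul]

theorem lieAdAux_sq (y z : L) (p) : lieAdAux (k := k) y z (lieAdAux y z p) =
    (0 : QuadraticForm k L) z • p := by
  ext
  · simp [lieAdAux, ι_mul_ι_self]
  · simp only [lieAdAux, LinearMap.mk₂_apply, mul_add, ι_mul_ι_self]
    rw [ι_mul_ι_swap]
    simp

/-- The derivation of the exterior algebra of a Lie algebra that extends `ad y`. -/
def lieAd (y : L) : ExteriorAlgebra k L →ₗ[k] ExteriorAlgebra k L :=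
  LinearMap.snd k _ _ ∘ₗ CliffordAlgebra.foldr 0 (lieAdAux y) (lieAdAux_sq y) (1, 0)

theorem lieAd_one (y : L) : lieAd (k := k) y 1 = 0 := by
  simp [lieAd]

theorem lieAd_foldr (y : L) (x : ExteriorAlgebra k L) :
    CliffordAlgebra.foldr 0 (lieAdAux (k := k) y) (lieAdAux_sq y) (1, 0) x = (x, lieAd y x) := by
  refine Prod.ext ?_ rfl
  induction x using CliffordAlgebra.left_induction with
  | algebraMap r => simp [Algebra.algebraMap_eq_smul_one]
  | add a b ha hb => rw [map_add, Prod.fst_add, ha, hb]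
  | ι_mul x m hx =>
    rw [CliffordAlgebra.foldr_mul, CliffordAlgebra.foldr_ι]
    change ExteriorAlgebra.ι k m * _ = _
    rw [hx]

theorem lieAd_ι_mul (y z : L) (x : ExteriorAlgebra k L) :
    lieAd y (ExteriorAlgebra.ι k z * x) =
      ExteriorAlgebra.ι k ⁅y, z⁆ * x + ExteriorAlgebra.ι k z * lieAd y x := by
  have : CliffordAlgebra.foldr 0 (lieAdAux (k := k) y) (lieAdAux_sq y) (1, 0)
      (ExteriorAlgebra.ι k z * x) = lieAdAux y z (x, lieAd y x) := by
    rw [← lieAd_foldr]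
    exact (CliffordAlgebra.foldr_mul _ _ _ _ _ _).trans (CliffordAlgebra.foldr_ι _ _ _ _ _)
  exact congrArg Prod.snd this

/-- Induction on the exterior algebra, from `1` by wedging vectors on the left. -/
theorem ext_induction {P : ExteriorAlgebra k L → Prop} (one : P 1)
    (smul : ∀ (c : k) x, P x → P (c • x)) (add : ∀ x y, P x → P y → P (x + y))
    (mul : ∀ z x, P x → P (ExteriorAlgebra.ι k z * x)) (x) : P x := by
  induction x using CliffordAlgebra.left_induction with
  | algebraMap r => rw [Algebra.algebraMap_eq_smul_one]; exact smul _ _ one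
  | add a b ha hb => exact add _ _ ha hb
  | ι_mul x m hx => exact mul _ _ hx

theorem lieAd_add (y y' : L) (x : ExteriorAlgebra k L) :
    lieAd (y + y') x = lieAd y x + lieAd y' x := by
  induction x using ext_induction with
  | one => simp [lieAd_one]
  | smul c x h => simp [h]
  | add a b ha hb => simp only [map_add, ha, hb]; abel
  | mul z x h => simp only [lieAd_ι_mul, h, add_lie, map_add, add_mul, mul_add]; abel

theorem lieAd_smul (c : k) (y : L) (x : ExteriorAlgebra k L) :
    lieAd (c • y) x = c • lieAd y x := by
  induction x using ext_induction with
  | one => simp [lieAd_one]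
  | smul c' x h => simp [h, smul_comm c c']
  | add a b ha hb => simp only [map_add, ha, hb, smul_add]
  | mul z x h => simp [lieAd_ι_mul, h]

theorem lieAd_lie (y z : L) (x : ExteriorAlgebra k L) :
    lieAd ⁅y, z⁆ x = lieAd y (lieAd z x) - lieAd z (lieAd y x) := by
  induction x using ext_induction with
  | one => simp [lieAd_one]
  | smul c' x h => simp [h, smul_sub]
  | add a b ha hb => simp only [map_add, ha, hb]; abel
  | mul w x h =>
    simp only [lieAd_ι_mul, h, map_add, mul_sub, lie_lie, map_sub, sub_mul]; abel

theorem lieAd_mem (y : L) (p : ℕ) : ∀ x ∈ ⋀[k]^p L, lieAd y x ∈ ⋀[k]^p L := by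
  induction p with
  | zero =>
    intro x hx
    rw [ExteriorAlgebra.exteriorPower, pow_zero] at hx
    obtain ⟨c, rfl⟩ := Submodule.mem_one.1 hx
    rw [Algebra.algebraMap_eq_smul_one, map_smul, lieAd_one, smul_zero]
    exact Submodule.zero_mem _
  | succ p ih =>
    intro x hx
    rw [ExteriorAlgebra.exteriorPower, pow_succ'] at hx ⊢
    induction hx using Submodule.mul_induction_on' with
    | mem_mul_mem a ha b hb =>
      obtain ⟨v, rfl⟩ := ha
      rw [lieAd_ι_mul]
      exact Submodule.add_mem _ (Submodule.mul_mem_mul ⟨_, rfl⟩ hb)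
        (Submodule.mul_mem_mul ⟨v, rfl⟩ (ih b hb))
    | add x _ y _ hx hy => rw [map_add]; exact Submodule.add_mem _ hx hy

variable {B : Type u} [Ring B] [Algebra k B] (ψ : UniversalEnvelopingAlgebra k L →ₐ[k] B)

/-- The image of `y ∈ L` in `B`. -/
def envMap (y : L) : B := ψ (UniversalEnvelopingAlgebra.ι k y)

/-- Left multiplication by `z` on the exterior factor of `B ⊗ Λ L`. -/
def ceE (B : Type u) [Ring B] [Algebra k B] (z : L) :
    B ⊗[k] ExteriorAlgebra k L →ₗ[B] B ⊗[k] ExteriorAlgebra k L :=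
  (LinearMap.mulLeft k (ExteriorAlgebra.ι k z)).baseChange B

/-- One step of the recursion that defines the Chevalley–Eilenberg differential. -/
def ceAux : L →ₗ[k] (ExteriorAlgebra k L × B ⊗[k] ExteriorAlgebra k L) →ₗ[k]
    (ExteriorAlgebra k L × B ⊗[k] ExteriorAlgebra k L) :=
  LinearMap.mk₂ k (fun z p => (ExteriorAlgebra.ι k z * p.1,
      envMap ψ z ⊗ₜ p.1 - 1 ⊗ₜ lieAd z p.1 - ceE B z p.2))
    (fun z z' p => by
      refine Prod.ext (by simp [add_mul]) ?_
      have : ceE B (z + z') p.2 = ceE B z p.2 + ceE B z' p.2 := by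
        have h : LinearMap.mulLeft k (ExteriorAlgebra.ι k (z + z')) =
          LinearMap.mulLeft k (ExteriorAlgebra.ι k z) +
          LinearMap.mulLeft k (ExteriorAlgebra.ι k z') := by ext; simp [add_mul]
        rw [ceE, h, LinearMap.baseChange_add]; rfl
      simp only [this, envMap, map_add, add_tmul, lieAd_add, tmul_add, Prod.snd_add]; abel)
    (fun c z p => by
      refine Prod.ext (by simp) ?_
      have : ceE B (c • z) p.2 = c • ceE B z p.2 := by
        have h : LinearMap.mulLeft k (ExteriorAlgebra.ι k (c • z)) =
          c • LinearMap.mulLeft k (ExteriorAlgebra.ι k z) := by ext; simp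
        rw [ceE, h, LinearMap.baseChange_smul]; rfl
      simp only [this, envMap, map_smul, lieAd_smul, tmul_smul, smul_tmul', Prod.smul_snd,
        smul_sub])
    (fun z p p' => by
      refine Prod.ext (by simp [mul_add]) ?_
      simp only [Prod.fst_add, Prod.snd_add, map_add, tmul_add]; abel)
    (fun c z p => by
      refine Prod.ext (by simp) ?_
      simp only [Prod.smul_fst, Prod.smul_snd, map_smul, tmul_smul, smul_sub,
        LinearMap.map_smul_of_tower])

theorem ceE_tmul (z : L) (b : B) (x : ExteriorAlgebra k L) :
    ceE B z (b ⊗ₜ x) = b ⊗ₜ (ExteriorAlgebra.ι k z * x) := by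
  simp [ceE]

theorem ceE_ceE (z : L) (m : B ⊗[k] ExteriorAlgebra k L) : ceE B z (ceE B z m) = 0 := by
  induction m with
  | zero => simp
  | tmul b x => rw [ceE_tmul, ceE_tmul, ι_mul_ι_self, tmul_zero]
  | add a b ha hb => rw [map_add, map_add, ha, hb, add_zero]

theorem ceAux_sq (z : L) (p) : ceAux ψ z (ceAux ψ z p) = (0 : QuadraticForm k L) z • p := by
  refine Prod.ext (by simp [ceAux, ι_mul_ι_self]) ?_
  simp only [ceAux, LinearMap.mk₂_apply, lieAd_ι_mul, lie_self, map_zero, zero_mul, zero_add,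
    map_sub, ceE_tmul, ceE_ceE]
  simp

/-- The restriction of the Chevalley–Eilenberg differential to `1 ⊗ Λ L`. -/
def ceOne : ExteriorAlgebra k L →ₗ[k] B ⊗[k] ExteriorAlgebra k L :=
  LinearMap.snd k _ _ ∘ₗ CliffordAlgebra.foldr 0 (ceAux ψ) (ceAux_sq ψ) (1, 0)

theorem ceOne_one : ceOne ψ 1 = 0 := by
  simp [ceOne]

theorem ceOne_foldr (x : ExteriorAlgebra k L) :
    CliffordAlgebra.foldr 0 (ceAux ψ) (ceAux_sq ψ) (1, 0) x = (x, ceOne ψ x) := by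
  refine Prod.ext ?_ rfl
  induction x using CliffordAlgebra.left_induction with
  | algebraMap r => simp [Algebra.algebraMap_eq_smul_one]
  | add a b ha hb => rw [map_add, Prod.fst_add, ha, hb]
  | ι_mul x m hx =>
    rw [CliffordAlgebra.foldr_mul, CliffordAlgebra.foldr_ι]
    change ExteriorAlgebra.ι k m * _ = _
    rw [hx]

theorem ceOne_ι_mul (z : L) (x : ExteriorAlgebra k L) :
    ceOne ψ (ExteriorAlgebra.ι k z * x) =
      envMap ψ z ⊗ₜ x - 1 ⊗ₜ lieAd z x - ceE B z (ceOne ψ x) := by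
  have : CliffordAlgebra.foldr 0 (ceAux ψ) (ceAux_sq ψ) (1, 0)
      (ExteriorAlgebra.ι k z * x) = ceAux ψ z (x, ceOne ψ x) := by
    rw [← ceOne_foldr]
    exact (CliffordAlgebra.foldr_mul _ _ _ _ _ _).trans (CliffordAlgebra.foldr_ι _ _ _ _ _)
  exact congrArg Prod.snd this

/-- The Chevalley–Eilenberg differential on `B ⊗_k Λ L`, where the right action of `L` on `B` is
right multiplication through `ψ : U(L) → B`. It is the `B`-linear map that sends `1 ⊗ 1` to `0` and
`1 ⊗ z ∧ x` to `ψ(z) ⊗ x - 1 ⊗ ad_z(x) - z ∧ d(1 ⊗ x)`; see `ceD_ιMulti` for the formula. -/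
def ceD : B ⊗[k] ExteriorAlgebra k L →ₗ[B] B ⊗[k] ExteriorAlgebra k L :=
  TensorProduct.AlgebraTensorModule.lift
    { toFun := fun b => b • ceOne ψ
      map_add' := fun b c => by ext x; simp [add_smul]
      map_smul' := fun b c => by ext x; simp [mul_smul] }

theorem ceD_tmul (b : B) (x : ExteriorAlgebra k L) : ceD ψ (b ⊗ₜ x) = b • ceOne ψ x := rfl

/-- The Lie derivative on `B ⊗ Λ L`. -/
def ceT (z : L) : B ⊗[k] ExteriorAlgebra k L →ₗ[B] B ⊗[k] ExteriorAlgebra k L :=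
  TensorProduct.AlgebraTensorModule.map (LinearMap.toSpanSingleton B B (envMap ψ z)) LinearMap.id -
    (lieAd z).baseChange B

theorem ceT_tmul (z : L) (b : B) (x : ExteriorAlgebra k L) :
    ceT ψ z (b ⊗ₜ x) = (b * envMap ψ z) ⊗ₜ x - b ⊗ₜ lieAd z x := by
  simp [ceT]

theorem ceD_ceE (z : L) (m) : ceD ψ (ceE B z m) = ceT ψ z m - ceE B z (ceD ψ m) := by
  induction m with
  | zero => simp
  | tmul b x =>
    rw [ceE_tmul, ceD_tmul, ceD_tmul, ceOne_ι_mul, ceT_tmul, map_smul, smul_sub, smul_sub,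
      smul_tmul', smul_tmul', smul_eq_mul, smul_eq_mul, mul_one]
  | add a b ha hb => simp only [map_add, ha, hb]; abel

theorem ceT_ceE (y z : L) (m : B ⊗[k] ExteriorAlgebra k L) :
    ceT ψ y (ceE B z m) = ceE B z (ceT ψ y m) - ceE B ⁅y, z⁆ m := by
  induction m with
  | zero => simp
  | tmul b x => simp only [ceE_tmul, ceT_tmul, lieAd_ι_mul, map_sub, tmul_add]; abel
  | add a b ha hb => simp only [map_add, ha, hb]; abel

theorem envMap_lie (y z : L) :
    envMap ψ ⁅y, z⁆ = envMap ψ y * envMap ψ z - envMap ψ z * envMap ψ y := by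
  simp only [envMap, LieHom.map_lie, LieRing.of_associative_ring_bracket, map_sub, map_mul]

theorem ceT_lie (y z : L) (m : B ⊗[k] ExteriorAlgebra k L) :
    ceT ψ y (ceT ψ z m) - ceT ψ z (ceT ψ y m) = - ceT ψ ⁅y, z⁆ m := by
  induction m with
  | zero => simp
  | tmul b x =>
    simp only [ceT_tmul, envMap_lie, lieAd_lie, map_sub, tmul_sub, mul_sub, sub_tmul, mul_assoc]
    abel
  | add a b ha hb =>
    simp only [map_add, neg_add, ← ha, ← hb]; abel

/-- To prove that two `B`-linear maps agree on `B ⊗ Λ L`. -/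
theorem ce_induction {P : B ⊗[k] ExteriorAlgebra k L → Prop} (one : P (1 ⊗ₜ 1)) (zero : P 0)
    (smul : ∀ (b : B) m, P m → P (b • m)) (add : ∀ x y, P x → P y → P (x + y))
    (mul : ∀ z m, P m → P (ceE B z m)) (m) : P m := by
  induction m with
  | zero => exact zero
  | add a b ha hb => exact add _ _ ha hb
  | tmul b x =>
    have : b ⊗ₜ[k] x = b • (1 : B) ⊗ₜ[k] x := by rw [smul_tmul', smul_eq_mul, mul_one]
    rw [this]
    refine smul _ _ ?_
    induction x using ext_induction with
    | one => exact one
    | smul c x h =>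
      have : (1 : B) ⊗ₜ[k] (c • x) = algebraMap k B c • (1 : B) ⊗ₜ[k] x := by
        rw [algebraMap_smul, tmul_smul]
      rw [this]; exact smul _ _ (h (by rw [smul_tmul', smul_eq_mul, mul_one]))
    | add a b ha hb =>
      rw [tmul_add]
      exact add _ _ (ha (by rw [smul_tmul', smul_eq_mul, mul_one]))
        (hb (by rw [smul_tmul', smul_eq_mul, mul_one]))
    | mul z x h =>
      rw [← ceE_tmul]; exact mul _ _ (h (by rw [smul_tmul', smul_eq_mul, mul_one]))

theorem ceD_ceT (y : L) (m : B ⊗[k] ExteriorAlgebra k L) :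
    ceD ψ (ceT ψ y m) = ceT ψ y (ceD ψ m) := by
  induction m using ce_induction with
  | one => simp [ceT_tmul, ceD_tmul, ceOne_one, lieAd_one]
  | zero => simp
  | smul b m h => simp only [map_smul, h]
  | add a b ha hb => simp only [map_add, ha, hb]
  | mul z m h =>
    have h2 := ceT_lie ψ y z m
    simp only [ceD_ceE, ceT_ceE, map_sub, h]
    rw [sub_eq_iff_eq_add] at h2
    rw [h2]; abel

theorem ceD_ceD (m : B ⊗[k] ExteriorAlgebra k L) : ceD ψ (ceD ψ m) = 0 := by
  induction m using ce_induction with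
  | one => simp [ceD_tmul, ceOne_one]
  | zero => simp
  | smul b m h => simp only [map_smul, h, smul_zero]
  | add a b ha hb => simp only [map_add, ha, hb, add_zero]
  | mul z m h => simp only [ceD_ceE, map_sub, ceD_ceT, h]; simp

theorem ceE_mem (z : L) (p : ℕ) : ∀ m ∈ (⋀[k]^p L).baseChange B,
    ceE B z m ∈ (⋀[k]^(p + 1) L).baseChange B := by
  intro m hm
  rw [Submodule.baseChange_eq_span] at hm
  induction hm using Submodule.span_induction with
  | mem m hm =>
    obtain ⟨x, hx, rfl⟩ := hm
    change ceE B z (1 ⊗ₜ x) ∈ _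
    rw [ceE_tmul]
    refine Submodule.tmul_mem_baseChange_of_mem _ ?_
    rw [ExteriorAlgebra.exteriorPower, pow_succ']
    exact Submodule.mul_mem_mul ⟨z, rfl⟩ hx
  | zero => simp
  | add a b _ _ ha hb => rw [map_add]; exact Submodule.add_mem _ ha hb
  | smul b m _ h => rw [map_smul]; exact Submodule.smul_mem _ _ h

theorem ceOne_mem (p : ℕ) : ∀ x ∈ ⋀[k]^(p + 1) L, ceOne ψ x ∈ (⋀[k]^p L).baseChange B := by
  induction p with
  | zero =>
    intro x hx
    rw [ExteriorAlgebra.exteriorPower, zero_add, pow_one] at hx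
    obtain ⟨v, rfl⟩ := hx
    have := ceOne_ι_mul ψ v 1
    rw [mul_one] at this
    rw [this, lieAd_one, ceOne_one, map_zero, tmul_zero, sub_zero, sub_zero]
    refine Submodule.tmul_mem_baseChange_of_mem _ ?_
    rw [ExteriorAlgebra.exteriorPower, pow_zero]
    exact Submodule.one_le.1 le_rfl
  | succ p ih =>
    intro x hx
    rw [ExteriorAlgebra.exteriorPower, pow_succ'] at hx
    induction hx using Submodule.mul_induction_on' with
    | mem_mul_mem a ha b hb =>
      obtain ⟨v, rfl⟩ := ha
      rw [ceOne_ι_mul]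
      exact Submodule.sub_mem _ (Submodule.sub_mem _ (Submodule.tmul_mem_baseChange_of_mem _ hb)
        (Submodule.tmul_mem_baseChange_of_mem _ (lieAd_mem _ _ _ hb))) (ceE_mem _ _ _ (ih b hb))
    | add x _ y _ hx hy => rw [map_add]; exact Submodule.add_mem _ hx hy

theorem ceD_mem (p : ℕ) : ∀ m ∈ (⋀[k]^(p + 1) L).baseChange B,
    ceD ψ m ∈ (⋀[k]^p L).baseChange B := by
  intro m hm
  rw [Submodule.baseChange_eq_span] at hm
  induction hm using Submodule.span_induction with
  | mem m hm =>
    obtain ⟨x, hx, rfl⟩ := hm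
    change ceD ψ (1 ⊗ₜ x) ∈ _
    rw [ceD_tmul, one_smul]
    exact ceOne_mem ψ p x hx
  | zero => simp
  | add a b _ _ ha hb => rw [map_add]; exact Submodule.add_mem _ ha hb
  | smul b m _ h => rw [map_smul]; exact Submodule.smul_mem _ _ h

/-- The Chevalley–Eilenberg complex `(B ⊗_k Λ L, d)`: its term in homological degree `p` is
`B ⊗_k Λ^p L`, realized inside `B ⊗_k Λ L`. -/
def ceComplex : ChainComplex (ModuleCat.{u} B) ℕ :=
  ChainComplex.of (fun p => ModuleCat.of B ((⋀[k]^p L).baseChange B))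
    (fun p => ModuleCat.ofHom ((ceD ψ).restrict (ceD_mem ψ p)))
    (fun p => by
      refine ModuleCat.hom_ext (LinearMap.ext fun x => ?_)
      exact Subtype.ext (ceD_ceD ψ x))

theorem removeNth_succ_zero {L : Type u} {p : ℕ} (t : Fin (p + 2) → L) (j : Fin (p + 1)) :
    Fin.removeNth (α := fun _ => L) j.succ t 0 = t 0 := by
  simp [Fin.removeNth]

theorem tail_removeNth_succ {L : Type u} {p : ℕ} (t : Fin (p + 2) → L) (j : Fin (p + 1)) :
    Matrix.vecTail (Fin.removeNth (α := fun _ => L) j.succ t) =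
      Fin.removeNth (α := fun _ => L) j (Matrix.vecTail t) := by
  ext l
  simp [Fin.removeNth, Matrix.vecTail]

theorem removeNth_zero_eq {L : Type u} {p : ℕ} (t : Fin (p + 1) → L) :
    Fin.removeNth (α := fun _ => L) 0 t = Matrix.vecTail t := by
  ext l
  simp [Fin.removeNth, Matrix.vecTail]

theorem lieAd_ιMulti (y : L) (p : ℕ) (t : Fin (p + 1) → L) :
    lieAd y (ExteriorAlgebra.ιMulti k (p + 1) t) =
      ∑ j : Fin (p + 1), (-1 : k) ^ (j : ℕ) •
        (ExteriorAlgebra.ι k ⁅y, t j⁆ * ExteriorAlgebra.ιMulti k p (j.removeNth t)) := by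
  induction p with
  | zero =>
    rw [ExteriorAlgebra.ιMulti_succ_apply, lieAd_ι_mul]
    simp [lieAd_one]
  | succ p ih =>
    rw [ExteriorAlgebra.ιMulti_succ_apply, lieAd_ι_mul, ih, Fin.sum_univ_succ (n := p + 1),
      removeNth_zero_eq, Finset.mul_sum]
    congr 1
    · simp
    · refine Finset.sum_congr rfl fun j _ => ?_
      rw [ExteriorAlgebra.ιMulti_succ_apply, removeNth_succ_zero, tail_removeNth_succ,
        mul_smul_comm, ι_mul_ι_swap, Fin.val_succ, pow_succ, mul_neg_one, neg_smul, smul_neg]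
      rfl

/-- The explicit formula for the Chevalley–Eilenberg differential. In the second sum, the pair
`(i, j)` with `i ≤ j` stands for the pair of positions `i < j + 1` of the family `y`. -/
theorem ceD_ιMulti (b : B) (p : ℕ) (y : Fin (p + 2) → L) :
    ceD ψ (b ⊗ₜ ExteriorAlgebra.ιMulti k (p + 2) y) =
      ∑ i : Fin (p + 2), (-1 : k) ^ (i : ℕ) •
        ((b * envMap ψ (y i)) ⊗ₜ[k] ExteriorAlgebra.ιMulti k (p + 1) (i.removeNth y)) +
      ∑ i : Fin (p + 2), ∑ j : Fin (p + 1), if (i : ℕ) ≤ (j : ℕ) then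
        (-1 : k) ^ ((i : ℕ) + (j : ℕ) + 1) • (b ⊗ₜ[k] (ExteriorAlgebra.ι k ⁅y i, y j.succ⁆ *
          ExteriorAlgebra.ιMulti k p (j.removeNth (i.removeNth y)))) else 0 := by
  have key : ∀ (p : ℕ) (y : Fin (p + 1) → L),
      ceD ψ (b ⊗ₜ ExteriorAlgebra.ιMulti k (p + 1) y) =
      (b * envMap ψ (y 0)) ⊗ₜ[k] ExteriorAlgebra.ιMulti k p (Matrix.vecTail y) -
      b ⊗ₜ[k] lieAd (y 0) (ExteriorAlgebra.ιMulti k p (Matrix.vecTail y)) -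
      ceE B (y 0) (ceD ψ (b ⊗ₜ ExteriorAlgebra.ιMulti k p (Matrix.vecTail y))) := by
    intro p y
    rw [ExteriorAlgebra.ιMulti_succ_apply, ← ceE_tmul, ceD_ceE, ceT_tmul]
  have s1 : ∀ (c : k) (z : L) (m : B ⊗[k] ExteriorAlgebra k L),
      ceE B z (c • m) = c • ceE B z m := fun c z m => LinearMap.map_smul_of_tower _ c m
  induction p with
  | zero =>
    have h0 : ceD ψ (b ⊗ₜ[k] (1 : ExteriorAlgebra k L)) = 0 := by
      rw [ceD_tmul, ceOne_one, smul_zero]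
    rw [key, key, lieAd_ιMulti]
    simp [ExteriorAlgebra.ιMulti_succ_apply, h0, Fin.sum_univ_succ, lieAd_one,
      ceE_tmul, Matrix.vecTail, Fin.removeNth]
    abel
  | succ p ih =>
    rw [key, ih, lieAd_ιMulti, Fin.sum_univ_succ (n := p + 2), Fin.sum_univ_succ (n := p + 2), map_add,
      map_sum, map_sum, tmul_sum]
    have e1 : ∀ i : Fin (p + 2), ceE B (y 0) ((-1 : k) ^ (i : ℕ) •
        ((b * envMap ψ (Matrix.vecTail y i)) ⊗ₜ[k]
          ExteriorAlgebra.ιMulti k (p + 1) (i.removeNth (Matrix.vecTail y)))) =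
        - ((-1 : k) ^ (i.succ : ℕ) • ((b * envMap ψ (y i.succ)) ⊗ₜ[k]
          ExteriorAlgebra.ιMulti k (p + 2) (i.succ.removeNth y))) := by
      intro i
      rw [s1, ceE_tmul, ExteriorAlgebra.ιMulti_succ_apply (n := p + 1), removeNth_succ_zero,
        tail_removeNth_succ, Fin.val_succ, pow_succ, mul_neg_one, neg_smul, neg_neg]
      rfl
    have e2 : ∀ i : Fin (p + 2), ceE B (y 0) (∑ j : Fin (p + 1), if (i : ℕ) ≤ (j : ℕ) then
        (-1 : k) ^ ((i : ℕ) + (j : ℕ) + 1) • (b ⊗ₜ[k]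
          (ExteriorAlgebra.ι k ⁅Matrix.vecTail y i, Matrix.vecTail y j.succ⁆ *
          ExteriorAlgebra.ιMulti k p (j.removeNth (i.removeNth (Matrix.vecTail y))))) else 0) =
        - ∑ j : Fin (p + 2), if (i.succ : ℕ) ≤ (j : ℕ) then
          (-1 : k) ^ ((i.succ : ℕ) + (j : ℕ) + 1) • (b ⊗ₜ[k]
          (ExteriorAlgebra.ι k ⁅y i.succ, y j.succ⁆ *
          ExteriorAlgebra.ιMulti k (p + 1) (j.removeNth (i.succ.removeNth y)))) else 0 := by
      intro i
      rw [Fin.sum_univ_succ (n := p + 1), if_neg (by simp), zero_add, map_sum,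
        ← Finset.sum_neg_distrib]
      refine Finset.sum_congr rfl fun j _ => ?_
      by_cases hij : (i : ℕ) ≤ (j : ℕ)
      · rw [if_pos hij, if_pos (by simpa using hij), s1, ceE_tmul, ι_mul_ι_swap,
          ExteriorAlgebra.ιMulti_succ_apply, removeNth_succ_zero, removeNth_succ_zero,
          tail_removeNth_succ, tail_removeNth_succ, tmul_neg, smul_neg]
        congr 2
        simp only [Fin.val_succ, pow_succ]; ring
      · rw [if_neg hij, if_neg (by simpa using hij), map_zero, neg_zero]
    have e3 : ∀ j : Fin (p + 2), b ⊗ₜ[k] ((-1 : k) ^ (j : ℕ) •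
        (ExteriorAlgebra.ι k ⁅y 0, Matrix.vecTail y j⁆ *
          ExteriorAlgebra.ιMulti k (p + 1) (j.removeNth (Matrix.vecTail y)))) =
        - (if ((0 : Fin (p + 3)) : ℕ) ≤ (j : ℕ) then
          (-1 : k) ^ (((0 : Fin (p + 3)) : ℕ) + (j : ℕ) + 1) • (b ⊗ₜ[k]
          (ExteriorAlgebra.ι k ⁅y 0, y j.succ⁆ *
          ExteriorAlgebra.ιMulti k (p + 1)
            (j.removeNth (Fin.removeNth (α := fun _ => L) 0 y)))) else 0) := by
      intro j
      rw [if_pos (by simp), removeNth_zero_eq, tmul_smul, Fin.val_zero, zero_add, pow_succ,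
        mul_neg_one, neg_smul, neg_neg]
      rfl
    simp only [e1, e2, e3, Finset.sum_neg_distrib, removeNth_zero_eq]
    simp only [Fin.val_zero, pow_zero, one_smul]
    abel

end ChevalleyEilenberg

/-! ### The nilpotent free Lie algebra and its action on a commutative algebra -/

section NilpotentFree

variable (k : Type u) [Field k] (n d : ℕ)

/-- The Lie algebra freely generated by `x_1, …, x_n` subject to the relations that all
expressions involving at least `d` brackets vanish. (These expressions span the `d`-th term of the
lower central series, where the `0`-th term is the whole Lie algebra.) -/
abbrev NilpFree : Type u :=
  FreeLieAlgebra k (Fin n) ⧸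
    LieModule.lowerCentralSeries k (FreeLieAlgebra k (Fin n)) (FreeLieAlgebra k (Fin n)) d

/-- Its universal enveloping algebra `U`. -/
abbrev NilpEnv : Type u := UniversalEnvelopingAlgebra k (NilpFree k n d)

/-- The augmentation `U → k`, `x_i ↦ 0`. -/
def nilpAug : NilpEnv k n d →ₐ[k] k := UniversalEnvelopingAlgebra.lift k 0

/-- The object `k` of `D(U)`: the trivial module, in degree `0`. -/
def trivialObj : ModD (NilpEnv k n d) :=
  (DerivedCategory.singleFunctor (ModuleCat.{u} (NilpEnv k n d)) 0).obj
    ((ModuleCat.restrictScalars (nilpAug k n d).toRingHom).obj (ModuleCat.of k k))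

variable {k n d} {A : Type u} [CommRing A] [Algebra k A] (f : Fin n → A)

theorem lcs_le_ker (hd : 1 ≤ d) :
    LieModule.lowerCentralSeries k (FreeLieAlgebra k (Fin n)) (FreeLieAlgebra k (Fin n)) d ≤
      (FreeLieAlgebra.lift k f).ker := by
  refine (LieModule.antitone_lowerCentralSeries k _ _ hd).trans ?_
  rw [LieModule.lowerCentralSeries_succ, LieSubmodule.lieIdeal_oper_eq_span,
    LieSubmodule.lieSpan_le]
  rintro _ ⟨x, y, rfl⟩
  simp [LieHom.mem_ker, LieRing.of_associative_ring_bracket, mul_comm]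

/-- The Lie algebra map to the commutative algebra `A` given by `x_i ↦ f_i`. -/
def nilpToLie (hd : 1 ≤ d) : NilpFree k n d →ₗ⁅k⁆ A :=
  { Submodule.liftQ
      (LieModule.lowerCentralSeries k (FreeLieAlgebra k (Fin n)) (FreeLieAlgebra k (Fin n))
        d).toSubmodule
      (FreeLieAlgebra.lift k f : FreeLieAlgebra k (Fin n) →ₗ[k] A)
      (fun _ hx => lcs_le_ker f hd hx) with
    map_lie' := by
      intro x y
      obtain ⟨x, rfl⟩ := LieSubmodule.Quotient.surjective_mk' _ x
      obtain ⟨y, rfl⟩ := LieSubmodule.Quotient.surjective_mk' _ y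
      exact (FreeLieAlgebra.lift k f).map_lie x y }

/-- The `k`-algebra map `U → A`, `x_i ↦ f_i`. -/
def nilpToAlg (hd : 1 ≤ d) : NilpEnv k n d →ₐ[k] A :=
  UniversalEnvelopingAlgebra.lift k (nilpToLie f hd)

theorem nilpToAlg_gen (hd : 1 ≤ d) (i : Fin n) :
    nilpToAlg f hd (UniversalEnvelopingAlgebra.ι k
      (LieSubmodule.Quotient.mk (FreeLieAlgebra.of k i))) = f i := by
  rw [nilpToAlg, UniversalEnvelopingAlgebra.lift_ι_apply]
  exact FreeLieAlgebra.lift_of_apply f i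

end NilpotentFree

end

/-! The object `X` is the Chevalley–Eilenberg complex over `A`. For any `ψ : U → B` the analogous
complex over `B` is a bounded complex of finite free modules, since `𝔫` is nilpotent with
finite-dimensional abelianization and hence finite-dimensional. It is therefore perfect and
K-projective, and its formation commutes with base change along `B → B'`.

Part 1. It remains to see that the complex over `U(L)` resolves `k` for `L` nilpotent of finite
dimension (`ceExact_of_isNilpotent`). Induct on the dimension: choose an ideal `L'` of codimension
one containing `[L, L]` and write `L = L' ⊕ k c`. Then `U(L) = ⊕ cⁱ U(L')` (`oreSum_bijective`, a
one-step Poincaré–Birkhoff–Witt theorem), so by induction `U(L) ⊗ Λ L'` has homology `k[c]`, in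
degree 0. The complex of `L` is the cone of the Lie derivative along `c` on it, which acts on `k[c]`
as multiplication by `c`: injective, with cokernel `k`.

Part 2. If `L` is not abelian, it has a central `c ≠ 0` in `[L, L]`. It acts as zero on the
commutative ring `A`, so with `K` the complex of `L/c` and `X` that of `L` there is an exact
sequence `0 → K[1] → X → K → 0`. Hence `X` lies in the thick subcategory of `K`. Conversely, the
connecting map `K → K[2]` has cone `X[1]`, so its composite powers `K → K[2N]` have cones built from
`X`. Such a power vanishes once `2N` exceeds the length of `K`, and then its cone is `K[2N] ⊕ K[1]`,
with `K[1]` as a summand (`prop_iff_of_shortExact`). Repeating this reaches the abelianization `kⁿ`,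
whose complex is the Koszul complex. A localizing subcategory is also closed under the summands
needed here, because a summand is the telescope of an idempotent
(`prop_of_retract_of_countable_coproduct`).

Part 3. Lift the `f_i` to `A'`. Since `A` is commutative and `R` is central in `A'`, each bracket
raises the `𝔪`-adic filtration by one (`lie_mem_map_pow_succ`). As `𝔪^d = 0`, the lifts define `U →
A'`, and the Chevalley–Eilenberg complex over `A'` is the required `X'`.

The structure `LineSplitting` serves both inductions: in Part 1 the section `s` is a Lie map, in
Part 2 the projection `r` is one. -/

noncomputable section

/-! ### Triangulated categories: summands as telescopes, powers of a map, cones of zero maps. -/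

section Triangulated

open Limits Pretriangulated

variable {C : Type*} [Category* C] [Preadditive C] [HasZeroObject C] [HasShift C ℤ]
  [∀ n : ℤ, (shiftFunctor C n).Additive] [Pretriangulated C]

/-- If a class of objects is triangulated and contains the coproduct `W` of countably many copies of
`E`, then it contains the retracts of `E`. -/
theorem prop_of_retract_of_countable_coproduct (P : ObjectProperty C) [P.IsTriangulated]
    [P.IsClosedUnderIsomorphisms] {R E W : C} (r : Retract R E) (ι : ℕ → (E ⟶ W))
    (desc : ∀ {T : C} (g : ℕ → (E ⟶ T)), ∃ f : W ⟶ T, ∀ j, ι j ≫ f = g j)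
    (ext : ∀ {T : C} {f g : W ⟶ T}, (∀ j, ι j ≫ f = ι j ≫ g) → f = g) (hP : P W) : P R := by
  obtain ⟨e, he⟩ : ∃ e : E ⟶ E, e = r.r ≫ r.i := ⟨_, rfl⟩
  have ee : e ≫ e = e := by simp [he]
  -- `a` is `1 - shift ∘ e`; its cone is the telescope of `E → E → ⋯` along the idempotent `e`,
  -- which should be `R`.
  obtain ⟨a, ha⟩ := desc fun j => ι j - e ≫ ι (j + 1)
  -- A left inverse of `a`: on the summand `1 - e` it is the identity, on the summand `e` it is
  -- minus the partial sum of the earlier copies, and the sums telescope.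
  obtain ⟨b, hb⟩ := desc fun j => ι j - e ≫ ι j - ∑ l ∈ Finset.range j, e ≫ ι l
  obtain ⟨π, hπ⟩ := desc fun _ => r.r
  have hab : a ≫ b = 𝟙 _ := ext fun j => by
    have hb' : ∀ j, e ≫ ι j ≫ b = - ∑ l ∈ Finset.range j, e ≫ ι l := fun j => by
      rw [hb]
      simp only [Preadditive.comp_sub, Preadditive.comp_sum, reassoc_of% ee, sub_self, zero_sub]
    rw [← Category.assoc, ha, Preadditive.sub_comp, Category.assoc, hb', hb,
      Finset.sum_range_succ, Category.comp_id]
    abel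
  obtain ⟨K, q, w, hT⟩ := distinguished_cocone_triangle a
  have hK : P K := P.ext_of_isTriangulatedClosed₃ _ hT hP hP
  -- As `a` is split mono, so is its shift; hence the connecting map vanishes and `K` is an honest
  -- cokernel of `a`. In it `e` acts as the identity and all copies of `E` are identified.
  have hw : w = 0 := by
    have h1 : w ≫ a⟦(1 : ℤ)⟧' = 0 := comp_distTriang_mor_zero₃₁ _ hT
    have h2 : a⟦(1 : ℤ)⟧' ≫ b⟦(1 : ℤ)⟧' = 𝟙 _ := by
      rw [← Functor.map_comp, hab, CategoryTheory.Functor.map_id]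
    rw [← Category.comp_id w, ← h2, reassoc_of% h1, zero_comp]
  have hq : Epi q := Triangle.epi₂ _ hT hw
  have haq : a ≫ q = 0 := comp_distTriang_mor_zero₁₂ _ hT
  have hpr : a ≫ π = 0 := ext fun j => by
    rw [← Category.assoc, ha, Preadditive.sub_comp, Category.assoc, hπ, hπ]
    simp [he]
  obtain ⟨p, hp⟩ : ∃ p : K ⟶ R, π = q ≫ p := Triangle.yoneda_exact₂ _ hT _ hpr
  have h1 : ∀ j, ι j ≫ q = e ≫ ι (j + 1) ≫ q := fun j => by
    have : ι j ≫ a ≫ q = 0 := by rw [haq, comp_zero]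
    rw [← Category.assoc, ha, Preadditive.sub_comp, sub_eq_zero] at this
    simpa using this
  have h2 : ∀ j, e ≫ ι j ≫ q = ι j ≫ q := fun j => by
    rw [h1 j, reassoc_of% ee]
  have h3 : ∀ j, ι j ≫ q = ι 0 ≫ q := fun j => by
    induction j with
    | zero => rfl
    | succ j ih => rw [← ih, h1 j, h2]
  refine P.prop_of_iso (Iso.mk p (r.i ≫ ι 0 ≫ q) ?_ ?_) hK
  · rw [← cancel_epi q, ← Category.assoc, ← hp]
    refine ext fun j => ?_
    rw [← Category.assoc, hπ, Category.comp_id, h3 j, ← h2 0]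
    simp [he]
  · rw [Category.assoc, Category.assoc, ← hp, hπ, r.retract]

/-- A morphism `Y ⟶ Y⟦2⟧` whose cone lies in a triangulated subcategory has "powers"
`Y ⟶ Y⟦2m⟧` with the same property. -/
theorem exists_trW_shift [IsTriangulated C] (P : ObjectProperty C) [P.IsTriangulated]
    {Y : C} (φ : Y ⟶ Y⟦(1 : ℤ)⟧⟦(1 : ℤ)⟧) (hφ : P.trW φ) (m : ℕ) :
    ∃ g : Y ⟶ Y⟦(2 * m : ℤ)⟧, P.trW g := by
  induction m with
  | zero =>
    refine ⟨((shiftFunctorZero' C (2 * (0 : ℕ) : ℤ) (by simp)).app Y).inv, P.trW_of_isIso _⟩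
  | succ m ih =>
    obtain ⟨g, hg⟩ := ih
    refine ⟨g ≫ φ⟦(2 * m : ℤ)⟧' ≫
      ((shiftFunctorAdd' C (1 : ℤ) (2 * m : ℤ) (2 * m + 1) (by ring)).app (Y⟦(1 : ℤ)⟧)).inv ≫
      ((shiftFunctorAdd' C (1 : ℤ) (2 * m + 1 : ℤ) (2 * (m + 1 : ℕ)) (by push_cast; ring)).app Y).inv,
      MorphismProperty.comp_mem _ _ _ hg (MorphismProperty.comp_mem _ _ _ (hφ.shift _)
        (P.trW_of_isIso _))⟩

/-- If the zero map `Y ⟶ Z` has its cone in `P`, then `P` contains an object `E ≅ Z ⊞ Y⟦1⟧`. -/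
theorem exists_iso_biprod_of_trW_zero (P : ObjectProperty C) {Y Z : C}
    (h : P.trW (0 : Y ⟶ Z)) : ∃ E, P E ∧ Nonempty (E ≅ Z ⊞ Y⟦(1 : ℤ)⟧) := by
  obtain ⟨E, g, w, hT, hE⟩ := P.trW_iff _ |>.1 h
  -- Rotating moves the zero map to the third position, where it makes the triangle split.
  obtain ⟨e, -⟩ := exists_iso_binaryBiproduct_of_distTriang _
    (rot_of_distTriang _ hT) (by
      change -((0 : Y ⟶ Z)⟦(1 : ℤ)⟧') = 0
      rw [Functor.map_zero, neg_zero])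
  exact ⟨E, hE, ⟨e⟩⟩

end Triangulated

/-! ### K-projective complexes, their coproducts, and the nilpotence argument for thick
subcategories. -/

section KProjective

open Limits Pretriangulated

theorem isKProjective_biprod {V : Type*} [Category* V] [Abelian V] (K L : CochainComplex V ℤ)
    [K.IsKProjective] [L.IsKProjective] : (K ⊞ L).IsKProjective where
  nonempty_homotopy_zero {T} f hT := by
    have h1 := CochainComplex.IsKProjective.homotopyZero (biprod.inl ≫ f) hT
    have h2 := CochainComplex.IsKProjective.homotopyZero (biprod.inr ≫ f) hT
    refine ⟨(Homotopy.ofEq ?_).trans (((h1.compLeft biprod.fst).add (h2.compLeft biprod.snd)).trans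
      (Homotopy.ofEq (by simp)))⟩
    rw [← Category.assoc, ← Category.assoc, ← Preadditive.add_comp, biprod.total, Category.id_comp]

/-- A morphism from a coproduct of complexes is homotopic to zero if all its components are. -/
theorem nonempty_homotopy_sigma_desc {V : Type*} [Category* V] [Preadditive V] {J : Type*}
    [HasCoproductsOfShape J V] (E : J → CochainComplex V ℤ) {T : CochainComplex V ℤ}
    (f : (∐ E) ⟶ T) (h : ∀ j, Homotopy (Sigma.ι E j ≫ f) 0) : Nonempty (Homotopy f 0) := by
  -- Coproducts of complexes are computed degreewise, so the components of the given homotopies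
  -- glue.
  have hc : ∀ i, Nonempty (IsColimit (Cofan.mk ((∐ E).X i) fun j => (Sigma.ι E j).f i)) := fun i =>
    ⟨(isColimitMapCoconeCofanMkEquiv (HomologicalComplex.eval V _ i) E _)
      (isColimitOfPreserves (HomologicalComplex.eval V _ i) (coproductIsCoproduct E))⟩
  let H : ∀ i i', (∐ E).X i ⟶ T.X i' := fun i i' =>
    Cofan.IsColimit.desc (hc i).some fun j => (h j).hom i i'
  have hH : ∀ i i' j, (Sigma.ι E j).f i ≫ H i i' = (h j).hom i i' := fun i i' j =>
    Cofan.IsColimit.fac (hc i).some _ j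
  refine ⟨{ hom := H, zero := fun i i' hi => ?_, comm := fun i => ?_ }⟩
  · refine Cofan.IsColimit.hom_ext (hc i).some _ _ fun j => ?_
    exact (hH i i' j).trans (((h j).zero i i' hi).trans comp_zero.symm)
  · refine Cofan.IsColimit.hom_ext (hc i).some _ _ fun j => ?_
    change (Sigma.ι E j).f i ≫ _ = (Sigma.ι E j).f i ≫ _
    have := (h j).comm i
    simp only [HomologicalComplex.comp_f] at this
    rw [this, HomologicalComplex.zero_f, HomologicalComplex.zero_f, add_zero, add_zero,
      Preadditive.comp_add, dNext_eq _ (i' := i + 1) rfl, dNext_eq _ (i' := i + 1) rfl,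
      prevD_eq _ (j' := i - 1) (by simp), prevD_eq _ (j' := i - 1) (by simp),
      ← hH, ← hH, Category.assoc, HomologicalComplex.Hom.comm_assoc]

theorem isKProjective_sigma {V : Type*} [Category* V] [Abelian V] {J : Type*}
    [HasCoproductsOfShape J V] (E : J → CochainComplex V ℤ) [∀ j, (E j).IsKProjective] :
    (∐ E).IsKProjective where
  nonempty_homotopy_zero f hT := nonempty_homotopy_sigma_desc E f fun _ =>
    CochainComplex.IsKProjective.homotopyZero _ hT

open DerivedCategory

variable {V : Type*} [Category* V] [Abelian V]

/-- From a K-projective source, homotopy classes of chain maps and morphisms of the derived category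
agree; this and the next lemma extract fullness and faithfulness up to homotopy. -/
theorem exists_Q_map_eq {K L : CochainComplex V ℤ} [K.IsKProjective] (f : Q.obj K ⟶ Q.obj L) :
    ∃ g : K ⟶ L, Q.map g = f := by
  obtain ⟨g, hg⟩ := (CochainComplex.IsKProjective.Qh_map_bijective K
    ((HomotopyCategory.quotient _ _).obj L)).surjective
    ((quotientCompQhIso V).hom.app K ≫ f ≫ (quotientCompQhIso V).inv.app L)
  obtain ⟨g, rfl⟩ := (HomotopyCategory.quotient _ _).map_surjective g
  refine ⟨g, ?_⟩
  rw [← cancel_epi ((quotientCompQhIso V).hom.app K), ← quotientCompQhIso_hom_naturality, hg]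
  simp

theorem nonempty_homotopy_of_Q_map_eq {K L : CochainComplex V ℤ} [K.IsKProjective] {f g : K ⟶ L}
    (h : Q.map f = Q.map g) : Nonempty (Homotopy f g) := by
  refine ⟨HomotopyCategory.homotopyOfEq _ _ ((CochainComplex.IsKProjective.Qh_map_bijective K
    ((HomotopyCategory.quotient _ _).obj L)).injective ?_)⟩
  rw [← cancel_mono ((quotientCompQhIso V).hom.app L), quotientCompQhIso_hom_naturality,
    quotientCompQhIso_hom_naturality, h]

/-- The morphism lifts to a chain map, and a chain map between complexes with disjoint supports
vanishes in every degree. -/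
theorem Q_hom_eq_zero {K L : CochainComplex V ℤ} [K.IsKProjective]
    (h : ∀ i, IsZero (K.X i) ∨ IsZero (L.X i)) (f : Q.obj K ⟶ Q.obj L) : f = 0 := by
  obtain ⟨g, rfl⟩ := exists_Q_map_eq f
  have : g = 0 := by
    ext i
    exact (h i).elim (fun h => h.eq_of_src _ _) (fun h => h.eq_of_tgt _ _)
  rw [this, Functor.map_zero]

/-- The coproduct of K-projective complexes is a coproduct in the derived category. -/
theorem nonempty_isColimit_Q_sigma {J : Type*} [HasCoproductsOfShape J V]
    (E : J → CochainComplex V ℤ) [∀ j, (E j).IsKProjective] :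
    Nonempty (IsColimit (Cofan.mk (Q.obj (∐ E)) fun j => Q.map (Sigma.ι E j))) := by
  have := isKProjective_sigma E
  have key : ∀ T : DerivedCategory V, ∃ L, Nonempty (Q.obj L ≅ T) := fun T =>
    ⟨Q.objPreimage T, ⟨Q.objObjPreimageIso T⟩⟩
  have desc : ∀ {T : DerivedCategory V} (g : ∀ j, Q.obj (E j) ⟶ T),
      ∃ f : Q.obj (∐ E) ⟶ T, ∀ j, Q.map (Sigma.ι E j) ≫ f = g j := by
    intro T g
    obtain ⟨L, ⟨e⟩⟩ := key T
    choose g' hg' using fun j => exists_Q_map_eq (g j ≫ e.inv)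
    refine ⟨Q.map (Sigma.desc g') ≫ e.hom, fun j => ?_⟩
    rw [← Functor.map_comp_assoc, Sigma.ι_desc, hg']
    simp
  have uniq : ∀ {T : DerivedCategory V} (x : Q.obj (∐ E) ⟶ T),
      (∀ j, Q.map (Sigma.ι E j) ≫ x = 0) → x = 0 := by
    intro T x hx
    obtain ⟨L, ⟨e⟩⟩ := key T
    rw [← cancel_mono e.inv, zero_comp]
    obtain ⟨y, hy⟩ := exists_Q_map_eq (x ≫ e.inv)
    have hy' : ∀ j, Nonempty (Homotopy (Sigma.ι E j ≫ y) 0) := fun j => by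
      apply nonempty_homotopy_of_Q_map_eq
      rw [Functor.map_comp, hy, reassoc_of% hx j, zero_comp, Functor.map_zero]
    obtain ⟨h⟩ := nonempty_homotopy_sigma_desc E y fun j => (hy' j).some
    rw [← hy, Q_map_eq_of_homotopy _ h, Functor.map_zero]
  refine ⟨Cofan.IsColimit.mk _ (fun s => (desc s.inj).choose)
    (fun s => (desc s.inj).choose_spec) fun s m hm => ?_⟩
  refine sub_eq_zero.1 (uniq (T := s.pt) _ fun j => ?_)
  rw [Preadditive.comp_sub, (desc s.inj).choose_spec, sub_eq_zero]
  exact hm j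

/-- A localizing subcategory contains the direct summands of its objects that are represented by
K-projective complexes. -/
theorem prop_of_retract_of_isKProjective (P : ObjectProperty (DerivedCategory V))
    [P.IsTriangulated] [P.IsClosedUnderIsomorphisms] {J : Type*} (σ : ℕ ≃ J)
    [HasCoproductsOfShape J V] [P.IsClosedUnderColimitsOfShape (Discrete J)]
    (E : CochainComplex V ℤ) [E.IsKProjective] {R : DerivedCategory V} (r : Retract R (Q.obj E))
    (hE : P (Q.obj E)) : P R := by
  obtain ⟨hc⟩ := nonempty_isColimit_Q_sigma fun _ : J => E
  refine prop_of_retract_of_countable_coproduct P r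
    (fun j => Q.map (Sigma.ι (fun _ : J => E) (σ j))) (fun g => ?_) (fun h => ?_)
    (P.prop_of_isColimit hc fun _ => hE)
  · refine ⟨Cofan.IsColimit.desc hc fun j => g (σ.symm j), fun j => ?_⟩
    exact (Cofan.IsColimit.fac hc _ (σ j)).trans (by simp)
  · exact Cofan.IsColimit.hom_ext hc _ _ fun j => by simpa using h (σ.symm j)

/-- For a short exact sequence `0 ⟶ K⟦1⟧ ⟶ X ⟶ K ⟶ 0` with `K` a bounded K-projective complex,
the objects `X` and `K` belong to the same thick (or localizing) subcategories. -/
theorem prop_iff_of_shortExact (P : ObjectProperty (DerivedCategory V))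
    [P.IsTriangulated] [P.IsClosedUnderIsomorphisms]
    (hP : ∀ (E : CochainComplex V ℤ) (R : DerivedCategory V), E.IsKProjective →
      Retract R (Q.obj E) → P (Q.obj E) → P R)
    (K X : CochainComplex V ℤ) [K.IsKProjective] (a b : ℤ)
    (hK : ∀ i, i < a ∨ b < i → IsZero (K.X i))
    (f : K⟦(1 : ℤ)⟧ ⟶ X) (g : X ⟶ K) (w : f ≫ g = 0)
    (hS : (ShortComplex.mk f g w).ShortExact) : P (Q.obj X) ↔ P (Q.obj K) := by
  have hT := triangleOfSES_distinguished hS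
  let e := (Q.commShiftIso (1 : ℤ)).app K
  have shift : ∀ {Y : DerivedCategory V}, P (Y⟦(1 : ℤ)⟧) → P Y := fun {Y} h =>
    P.prop_of_iso ((shiftFunctorCompIsoId _ (1 : ℤ) (-1) (by simp)).app Y)
      (P.le_shift (-1 : ℤ) _ h)
  constructor
  · intro hX
    -- Up to shift, `X` is the cone of the connecting map, so the latter is invertible modulo `P`.
    have h1 : P.trW (triangleOfSESδ hS) :=
      ObjectProperty.trW.mk' P (rot_of_distTriang _ hT) hX
    have h2 : P.trW (triangleOfSESδ hS ≫ e.hom⟦(1 : ℤ)⟧') :=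
      (P.trW.cancel_right_of_respectsIso _ _).2 h1
    -- `N` exceeds the length of the interval supporting `K`, so `K` and its shift by `2 * N` have
    -- disjoint supports.
    obtain ⟨N, hN⟩ : ∃ N : ℕ, b - a < N := ⟨(b - a + 1).toNat, by omega⟩
    obtain ⟨m, hm⟩ := exists_trW_shift P _ h2 N
    have h3 : m = 0 := by
      rw [← cancel_mono ((Q.commShiftIso (2 * N : ℤ)).app K).inv, zero_comp]
      refine Q_hom_eq_zero (fun i => ?_) _
      by_cases hi : i < a ∨ b < i
      · exact Or.inl (hK i hi)
      · exact Or.inr (hK (i + 2 * N) (Or.inr (by omega)))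
    rw [h3] at hm
    obtain ⟨E, hE, ⟨e'⟩⟩ := exists_iso_biprod_of_trW_zero P hm
    have := preservesBinaryBiproducts_of_preservesBiproducts (Q (C := V))
    let E' := (K⟦(2 * N : ℤ)⟧) ⊞ (K⟦(1 : ℤ)⟧)
    let e'' : Q.obj E' ≅ E := Q.mapBiprod _ _ ≪≫
      biprod.mapIso ((Q.commShiftIso (2 * N : ℤ)).app K) e ≪≫ e'.symm
    -- The cone of the zero map is represented by the K-projective complex `E'`, as `hP` requires,
    -- and `K⟦1⟧` is a summand of it.
    refine shift (hP E' _ (isKProjective_biprod _ _) ?_ (P.prop_of_iso e''.symm hE))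
    exact { i := e.inv ≫ Q.map biprod.inr, r := Q.map biprod.snd ≫ e.hom
            retract := by rw [Category.assoc, ← Functor.map_comp_assoc]; simp }
  · intro hK
    exact P.ext_of_isTriangulatedClosed₂ _ hT (P.prop_of_iso e.symm (P.le_shift (1 : ℤ) _ hK)) hK

end KProjective

/-! ### Complexes cut out of one ambient module by a grading and a differential. -/

section GradedComplex

open Limits

variable {B : Type u} [Ring B] {M N : Type u} [AddCommGroup M] [Module B M] [AddCommGroup N]
  [Module B N]

/-- The cochain complex given by a family of submodules `G i` and a differential `d` mapping `G i`
to `G (i + 1)`. -/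
def gradedCx (G : ℤ → Submodule B M) (d : M →ₗ[B] M) (hG : ∀ i, ∀ m ∈ G i, d m ∈ G (i + 1))
    (hd : ∀ m, d (d m) = 0) : CochainComplex (ModuleCat.{u} B) ℤ :=
  CochainComplex.of (fun i => ModuleCat.of B (G i)) (fun i => ModuleCat.ofHom (d.restrict (hG i)))
    (fun _ => ModuleCat.hom_ext (LinearMap.ext fun x => Subtype.ext (hd x)))

section

variable {G : ℤ → Submodule B M} {d : M →ₗ[B] M} {hG : ∀ i, ∀ m ∈ G i, d m ∈ G (i + 1)}
  {hd : ∀ m, d (d m) = 0} {G' : ℤ → Submodule B N} {d' : N →ₗ[B] N}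
  {hG' : ∀ i, ∀ m ∈ G' i, d' m ∈ G' (i + 1)} {hd' : ∀ m, d' (d' m) = 0}

theorem gradedCx_d (i : ℤ) : (gradedCx G d hG hd).d i (i + 1) =
    ModuleCat.ofHom (d.restrict (hG i)) :=
  CochainComplex.of_d (fun i => ModuleCat.of B (G i)) (fun i => ModuleCat.ofHom (d.restrict (hG i))) i

/-- The morphism of complexes induced by a linear map that respects the gradings and the
differentials. -/
def gradedCxHom (F : M →ₗ[B] N) (hF : ∀ i, ∀ m ∈ G i, F m ∈ G' i) (hFd : ∀ m, F (d m) = d' (F m)) :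
    gradedCx G d hG hd ⟶ gradedCx G' d' hG' hd' where
  f i := ModuleCat.ofHom (F.restrict (hF i))
  comm' i j hij := by
    obtain rfl : i + 1 = j := hij
    rw [gradedCx_d, gradedCx_d]
    exact ModuleCat.hom_ext (LinearMap.ext fun x => Subtype.ext (hFd (Subtype.val x)).symm)

/-- The isomorphism of complexes induced by a linear equivalence that respects the gradings and the
differentials. -/
def gradedCxIso (F : M ≃ₗ[B] N) (hF : ∀ i, ∀ m ∈ G i, F m ∈ G' i)
    (hF' : ∀ i, ∀ m ∈ G' i, F.symm m ∈ G i) (hFd : ∀ m, F (d m) = d' (F m)) :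
    gradedCx G d hG hd ≅ gradedCx G' d' hG' hd' where
  hom := gradedCxHom F.toLinearMap hF hFd
  inv := gradedCxHom F.symm.toLinearMap hF' fun m => by
    apply F.injective
    simp [hFd]
  hom_inv_id := by
    ext i : 1
    exact ModuleCat.hom_ext (LinearMap.ext fun x => Subtype.ext (F.symm_apply_apply _))
  inv_hom_id := by
    ext i : 1
    exact ModuleCat.hom_ext (LinearMap.ext fun x => Subtype.ext (F.apply_symm_apply _))

theorem isZero_gradedCx_X {i : ℤ} (h : G i = ⊥) : IsZero ((gradedCx G d hG hd).X i) := by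
  change IsZero (ModuleCat.of B (G i))
  rw [h]
  exact ModuleCat.isZero_of_subsingleton _

theorem gradedCx_isKProjective (hp : ∀ i, Module.Projective B (G i)) {b : ℤ}
    (hb : ∀ i, b < i → G i = ⊥) : (gradedCx G d hG hd).IsKProjective := by
  have : (gradedCx G d hG hd).IsStrictlyLE b := by
    rw [CochainComplex.isStrictlyLE_iff]
    exact fun i hi => isZero_gradedCx_X (hb i hi)
  have : ∀ i, Projective ((gradedCx G d hG hd).X i) := fun i => by
    have := hp i
    change Projective (ModuleCat.of B (G i))
    infer_instance
  exact CochainComplex.isKProjective_of_projective _ b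

theorem gradedCx_acyclic (h : ∀ i, ∀ m ∈ G i, d m = 0 → ∃ m' ∈ G (i - 1), d m' = m) :
    (gradedCx G d hG hd).Acyclic := by
  intro i
  obtain ⟨i, rfl⟩ : ∃ j, i = j + 1 := ⟨i - 1, by ring⟩
  rw [HomologicalComplex.exactAt_iff' _ i (i + 1) (i + 1 + 1) (by simp) (by simp),
    ShortComplex.moduleCat_exact_iff]
  intro x hx
  change ((gradedCx G d hG hd).d (i + 1) (i + 1 + 1)).hom x = 0 at hx
  rw [gradedCx_d] at hx
  obtain ⟨m', hm', e⟩ := h (i + 1) x.1 x.2 (congrArg Subtype.val hx)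
  rw [add_sub_cancel_right] at hm'
  refine ⟨(⟨m', hm'⟩ : G i), ?_⟩
  change ((gradedCx G d hG hd).d i (i + 1)).hom _ = _
  rw [gradedCx_d]
  exact Subtype.ext e

end

/-- The extension by zero of a grading by homological degree to a grading by cohomological
degree. -/
def zGrading (G : ℕ → Submodule B M) (i : ℤ) : Submodule B M := if i ≤ 0 then G (-i).toNat else ⊥

theorem zGrading_neg (G : ℕ → Submodule B M) (p : ℕ) : zGrading G (-p) = G p := by
  simp [zGrading]

theorem zGrading_pos (G : ℕ → Submodule B M) {i : ℤ} (hi : 0 < i) : zGrading G i = ⊥ :=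
  if_neg (by omega)

theorem zGrading_cases {i : ℤ} : (∃ p : ℕ, i = -p) ∨ 0 < i := by
  rcases le_or_gt i 0 with h | h
  · exact Or.inl ⟨(-i).toNat, by omega⟩
  · exact Or.inr h

theorem zGrading_map {G : ℕ → Submodule B M} {G' : ℕ → Submodule B N} {F : M →+ N}
    (hF : ∀ p, ∀ m ∈ G p, F m ∈ G' p) (i : ℤ) : ∀ m ∈ zGrading G i, F m ∈ zGrading G' i := by
  rcases zGrading_cases (i := i) with ⟨p, rfl⟩ | hi
  · rw [zGrading_neg, zGrading_neg]
    exact hF p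
  · rw [zGrading_pos _ hi, zGrading_pos _ hi]
    simp

theorem zGrading_d {G : ℕ → Submodule B M} {d : M →ₗ[B] M}
    (hG : ∀ p, ∀ m ∈ G (p + 1), d m ∈ G p) (h0 : ∀ m ∈ G 0, d m = 0) (i : ℤ) :
    ∀ m ∈ zGrading G i, d m ∈ zGrading G (i + 1) := by
  rcases zGrading_cases (i := i) with ⟨_ | p, rfl⟩ | hi
  · intro m hm
    rw [zGrading_neg] at hm
    rw [h0 m hm]
    exact Submodule.zero_mem _
  · rw [zGrading_neg, show (-((p + 1 : ℕ) : ℤ) + 1) = -p by push_cast; ring, zGrading_neg]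
    exact hG p
  · rw [zGrading_pos _ hi]
    simp

/-- The chain complex given by a family of submodules `G p` and a differential `d` mapping
`G (p + 1)` to `G p`. -/
abbrev gradedChain (G : ℕ → Submodule B M) (d : M →ₗ[B] M) (hG : ∀ p, ∀ m ∈ G (p + 1), d m ∈ G p)
    (hd : ∀ m, d (d m) = 0) : ChainComplex (ModuleCat.{u} B) ℕ :=
  ChainComplex.of (fun p => ModuleCat.of B (G p)) (fun p => ModuleCat.ofHom (d.restrict (hG p)))
    (fun _ => ModuleCat.hom_ext (LinearMap.ext fun x => Subtype.ext (hd x)))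

/-- The comparison of the two ways to regard a graded module with a differential of homological
degree `-1` as a cochain complex. -/
def gradedChainExtendIso (G : ℕ → Submodule B M) (d : M →ₗ[B] M)
    (hG : ∀ p, ∀ m ∈ G (p + 1), d m ∈ G p) (h0 : ∀ m ∈ G 0, d m = 0) (hd : ∀ m, d (d m) = 0) :
    (gradedChain G d hG hd).extend ComplexShape.embeddingDownNat ≅
      gradedCx (zGrading G) d (zGrading_d hG h0) hd := by
  let K := gradedChain G d hG hd
  let e := ComplexShape.embeddingDownNat
  have hf : ∀ {i : ℤ}, i ≤ 0 → e.f (-i).toNat = i := fun {i} hi => by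
    change -((-i).toNat : ℤ) = i
    omega
  have hz : ∀ {i : ℤ}, 0 < i → IsZero ((K.extend e).X i) := fun {i} hi =>
    K.isZero_extend_X e i fun p => by
      change -(p : ℤ) ≠ i
      omega
  let ι : ∀ i, (K.extend e).X i ≅ (gradedCx (zGrading G) d (zGrading_d hG h0) hd).X i := fun i =>
    if hi : i ≤ 0 then
      K.extendXIso e (hf hi) ≪≫ LinearEquiv.toModuleIso (LinearEquiv.ofEq _ _ (if_pos hi).symm)
    else (hz (not_le.1 hi)).iso (isZero_gradedCx_X (if_neg hi))
  -- The isomorphism does not move the underlying element of `M`, so compatibility with the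
  -- differentials can be checked in `M`, free of index transport.
  have hι : ∀ (p : ℕ) (i : ℤ) (h : e.f p = i) (x : (K.extend e).X i),
      Subtype.val (p := (· ∈ zGrading G i)) ((ι i).hom x) =
        Subtype.val (p := (· ∈ G p)) ((K.extendXIso e h).hom x) := by
    intro p i h x
    have hi : i ≤ 0 := by
      rw [← h]
      change -(p : ℤ) ≤ 0
      omega
    obtain rfl : (-i).toNat = p := by
      rw [← h]
      change (- -(p : ℤ)).toNat = p
      omega
    simp only [ι, dif_pos hi]
    rfl
  refine HomologicalComplex.Hom.isoOfComponents ι fun i j hij => ?_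
  obtain rfl : i + 1 = j := hij
  by_cases hi : i + 1 ≤ 0
  · obtain ⟨p, hp⟩ : ∃ p : ℕ, i = -(p + 1 : ℕ) := ⟨(-i - 1).toNat, by omega⟩
    have h1 : e.f (p + 1) = i := hp.symm
    have h2 : e.f p = i + 1 := by
      change -(p : ℤ) = _
      omega
    refine ModuleCat.hom_ext (LinearMap.ext fun x => Subtype.ext ?_)
    rw [gradedCx_d, K.extend_d_eq e h1 h2]
    change d (Subtype.val (p := (· ∈ zGrading G i)) ((ι i).hom x)) =
      Subtype.val (p := (· ∈ zGrading G (i + 1))) ((ι (i + 1)).hom _)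
    rw [hι (p + 1) i h1, hι p (i + 1) h2]
    have h3 : K.d (p + 1) p = ModuleCat.ofHom (d.restrict (hG p)) :=
      ChainComplex.of_d (fun p => ModuleCat.of B (G p))
        (fun p => ModuleCat.ofHom (d.restrict (hG p))) p
    rw [h3]
    exact (congrArg (Subtype.val (p := (· ∈ G p))) (Iso.inv_hom_id_apply (K.extendXIso e h2)
      (ConcreteCategory.hom (ModuleCat.ofHom (d.restrict (hG p))) ((K.extendXIso e h1).hom x)))).symm
  · exact (isZero_gradedCx_X (if_neg hi)).eq_of_tgt _ _

/-- Long exact homology sequence. -/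
theorem quasiIso_g_of_acyclic {V : Type*} [Category* V] [Abelian V]
    {S : ShortComplex (CochainComplex V ℤ)} (hS : S.ShortExact) (h : S.X₁.Acyclic) :
    QuasiIso S.g := by
  refine ⟨fun i => ?_⟩
  rw [quasiIsoAt_iff_isIso_homologyMap]
  have z : ∀ i, IsZero (S.X₁.homology i) := fun i => (h i).isZero_homology
  have : Mono (HomologicalComplex.homologyMap S.g i) :=
    (hS.homology_exact₂ i).mono_g ((z i).eq_of_src _ _)
  have : Epi (HomologicalComplex.homologyMap S.g i) :=
    (hS.homology_exact₃ i (i + 1) rfl).epi_f ((z (i + 1)).eq_of_tgt _ _)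
  exact isIso_of_mono_of_epi _

theorem shortExact_of_apply {K L T : CochainComplex (ModuleCat.{u} B) ℤ} (f : K ⟶ L) (g : L ⟶ T)
    (w : f ≫ g = 0) (inj : ∀ i, Function.Injective (f.f i))
    (surj : ∀ i, Function.Surjective (g.f i)) (ex : ∀ i x, g.f i x = 0 → ∃ y, f.f i y = x) :
    (ShortComplex.mk f g w).ShortExact := by
  refine HomologicalComplex.shortExact_of_degreewise_shortExact _ fun i => ?_
  exact { exact := (ShortComplex.moduleCat_exact_iff _).2 (ex i)
          mono_f := (ModuleCat.mono_iff_injective _).2 (inj i)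
          epi_g := (ModuleCat.epi_iff_surjective _).2 (surj i) }

end GradedComplex

/-! ### The Chevalley–Eilenberg complex as a perfect K-projective cochain complex. -/

section CEComplex

open Limits

theorem baseChange_induction {k : Type*} [CommRing k] {B : Type*} [Ring B] [Algebra k B]
    {V : Type*} [AddCommGroup V] [Module k V] {p : Submodule k V} {P : B ⊗[k] V → Prop}
    (zero : P 0) (add : ∀ x y, P x → P y → P (x + y)) (tmul : ∀ b, ∀ x ∈ p, P (b ⊗ₜ x)) :
    ∀ m ∈ p.baseChange B, P m := by
  rintro _ ⟨t, rfl⟩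
  induction t with
  | zero => rw [map_zero]; exact zero
  | tmul b x => exact tmul b x x.2
  | add x y hx hy => rw [map_add]; exact add _ _ hx hy

section

variable {k : Type u} [Field k]

/-- The grading of the exterior algebra, with `Λ^p` in cohomological degree `-p`. -/
def extZ (V : Type u) [AddCommGroup V] [Module k V] (i : ℤ) : Submodule k (ExteriorAlgebra k V) :=
  zGrading (fun p => ⋀[k]^p V) i

variable (V : Type u) [AddCommGroup V] [Module k V]

theorem extZ_pos {i : ℤ} (hi : 0 < i) : extZ (k := k) V i = ⊥ := zGrading_pos _ hi

theorem extZ_lt [Module.Finite k V] {i : ℤ} (hi : i < -(Module.finrank k V : ℤ)) :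
    extZ (k := k) V i = ⊥ := by
  obtain ⟨p, rfl⟩ : ∃ p : ℕ, i = -p := ⟨(-i).toNat, by omega⟩
  rw [extZ, zGrading_neg]
  have h := exteriorPower.finrank_eq k p (M := V)
  rw [Nat.choose_eq_zero_of_lt (by omega)] at h
  exact Submodule.finrank_eq_zero.1 h

instance [Module.Finite k V] (i : ℤ) : Module.Finite k (extZ (k := k) V i) := by
  rcases zGrading_cases (i := i) with ⟨p, rfl⟩ | hi
  · rw [extZ, zGrading_neg]
    infer_instance
  · rw [extZ_pos V hi]
    infer_instance

/-- Over a field, `B ⊗ p` embeds in `B ⊗ W`; so the submodule `p.baseChange B` is a copy of `B ⊗ p`,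
free on a `k`-basis of `p`. -/
instance baseChange_free {B : Type u} [Ring B] [Algebra k B] {W : Type u} [AddCommGroup W]
    [Module k W] (p : Submodule k W) : Module.Free B (p.baseChange B) :=
  Module.Free.of_equiv (Submodule.toBaseChange.toLinearEquiv B p)

instance baseChange_finite {B : Type u} [Ring B] [Algebra k B] {W : Type u} [AddCommGroup W]
    [Module k W] (p : Submodule k W) [Module.Finite k p] : Module.Finite B (p.baseChange B) :=
  Module.Finite.equiv (Submodule.toBaseChange.toLinearEquiv B p)

end

variable {k : Type u} [Field k] {L : Type u} [LieRing L] [LieAlgebra k L]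
  {B : Type u} [Ring B] [Algebra k B] (ψ : UniversalEnvelopingAlgebra k L →ₐ[k] B)

theorem ceD_zero : ∀ m ∈ (⋀[k]^0 L).baseChange B, ceD ψ m = 0 := by
  refine baseChange_induction (map_zero _) (fun x y hx hy => by rw [map_add, hx, hy, add_zero]) ?_
  intro b x hx
  rw [ExteriorAlgebra.exteriorPower, pow_zero] at hx
  obtain ⟨c, rfl⟩ := Submodule.mem_one.1 hx
  rw [Algebra.algebraMap_eq_smul_one, tmul_smul, LinearMap.map_smul_of_tower, ceD_tmul, ceOne_one,
    smul_zero, smul_zero]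

theorem zGrading_baseChange (V : Type u) [AddCommGroup V] [Module k V] (i : ℤ) :
    zGrading (fun p => (⋀[k]^p V).baseChange B) i = (extZ (k := k) V i).baseChange B := by
  unfold extZ zGrading
  split_ifs
  · rfl
  · rw [Submodule.baseChange_bot]

theorem ceD_extZ (i : ℤ) : ∀ m ∈ (extZ (k := k) L i).baseChange B,
    ceD ψ m ∈ (extZ (k := k) L (i + 1)).baseChange B := by
  rw [← zGrading_baseChange, ← zGrading_baseChange]
  exact zGrading_d (ceD_mem ψ) (ceD_zero ψ) i

/-- The Chevalley–Eilenberg complex as a cochain complex indexed by `ℤ`. -/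
def ceCochain : CochainComplex (ModuleCat.{u} B) ℤ :=
  gradedCx (fun i => (extZ (k := k) L i).baseChange B) (ceD ψ) (ceD_extZ ψ) (ceD_ceD ψ)

def chainToDIso : chainToD (ceComplex ψ) ≅ DerivedCategory.Q.obj (ceCochain ψ) :=
  DerivedCategory.Q.mapIso (gradedChainExtendIso _ _ (ceD_mem ψ) (ceD_zero ψ) (ceD_ceD ψ) ≪≫
    gradedCxIso (LinearEquiv.refl B _) (fun i _ hm => (zGrading_baseChange L i).le hm)
      (fun i _ hm => (zGrading_baseChange L i).ge hm) (fun _ => rfl))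

theorem isZero_ceCochain_X [Module.Finite k L] (i : ℤ)
    (hi : i < -(Module.finrank k L : ℤ) ∨ 0 < i) : IsZero ((ceCochain ψ).X i) := by
  refine isZero_gradedCx_X (G := fun i => (extZ (k := k) L i).baseChange B) ?_
  rcases hi with hi | hi
  · rw [extZ_lt L hi, Submodule.baseChange_bot]
  · rw [extZ_pos L hi, Submodule.baseChange_bot]

instance : (ceCochain ψ).IsKProjective :=
  gradedCx_isKProjective (fun _ => inferInstance) (b := 0) fun i hi => by
    rw [extZ_pos L hi, Submodule.baseChange_bot]

theorem isPerfectObj_ceCochain [Module.Finite k L] :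
    IsPerfectObj (DerivedCategory.Q.obj (ceCochain ψ)) := by
  refine ⟨ceCochain ψ, fun i => ?_, ⟨_, _, isZero_ceCochain_X ψ⟩, ⟨Iso.refl _⟩⟩
  change Module.Finite B ((extZ (k := k) L i).baseChange B) ∧
    Module.Projective B ((extZ (k := k) L i).baseChange B)
  exact ⟨inferInstance, inferInstance⟩

end CEComplex

/-! ### Extension of scalars: the universal property. -/

section ExtScalUniversal

variable {S B : Type u} [Ring S] [Ring B] (ψ : S →+* B) {M N : Type u} [AddCommGroup M] [Module S M]
  [AddCommGroup N] [Module B N]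

/-- The element `b ⊗ m` of `B ⊗_S M`. -/
def extScalMk (b : B) (m : M) : ExtScal ψ M := Submodule.Quotient.mk (b ⊗ₜ[ℤ] m)

theorem extScalMk_mul (b : B) (s : S) (m : M) :
    extScalMk ψ (b * ψ s) m = extScalMk ψ b (s • m) :=
  (Submodule.Quotient.eq _).2 (Submodule.subset_span ⟨b, s, m, rfl⟩)

theorem extScalMk_add (b : B) (m m' : M) :
    extScalMk ψ b (m + m') = extScalMk ψ b m + extScalMk ψ b m' := by
  rw [extScalMk, tmul_add, Submodule.Quotient.mk_add]
  rfl

theorem extScalMk_zero (b : B) : extScalMk ψ b (0 : M) = 0 := by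
  rw [extScalMk, tmul_zero]
  rfl

theorem add_extScalMk (b b' : B) (m : M) :
    extScalMk ψ (b + b') m = extScalMk ψ b m + extScalMk ψ b' m := by
  rw [extScalMk, add_tmul, Submodule.Quotient.mk_add]
  rfl

theorem extScal_induction {P : ExtScal ψ M → Prop} (zero : P 0)
    (add : ∀ x y, P x → P y → P (x + y)) (mk : ∀ b m, P (extScalMk ψ b m)) (x : ExtScal ψ M) :
    P x := by
  obtain ⟨x, rfl⟩ := Submodule.Quotient.mk_surjective _ x
  induction x with
  | zero => exact zero
  | add x y hx hy => exact add _ _ hx hy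
  | tmul b m => exact mk b m

/-- The universal property of `B ⊗_S M`. -/
def extScalLift (g : M →+ N) (hg : ∀ s m, g (s • m) = ψ s • g m) : ExtScal ψ M →ₗ[B] N :=
  Submodule.liftQ _ (TensorProduct.AlgebraTensorModule.lift (R := ℤ)
    { toFun := fun b => b • g.toIntLinearMap
      map_add' := fun b c => LinearMap.ext fun x => add_smul b c (g x)
      map_smul' := fun b c => LinearMap.ext fun x => mul_smul b c (g x) }) (by
    refine Submodule.span_le.2 ?_
    rintro _ ⟨b, s, m, rfl⟩
    refine (map_sub _ _ _).trans (sub_eq_zero.2 ?_)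
    change (b * ψ s) • g m = b • g (s • m)
    rw [hg, mul_smul])

end ExtScalUniversal

/-! ### Extension of scalars of the free modules `S ⊗ p`. -/

section ExtScalBaseChange

variable {k : Type u} [Field k] {S B : Type u} [Ring S] [Ring B] [Algebra k S] [Algebra k B]
  (σ : S →ₐ[k] B) {V : Type u} [AddCommGroup V] [Module k V]

theorem map_smul_tensor (s : S) (m : S ⊗[k] V) :
    TensorProduct.map σ.toLinearMap (LinearMap.id : V →ₗ[k] V) (s • m) =
      σ s • TensorProduct.map σ.toLinearMap LinearMap.id m := by
  induction m with
  | zero => simp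
  | tmul t v => simp [smul_tmul']
  | add x y hx hy => rw [smul_add, map_add, map_add, hx, hy, smul_add]

theorem map_mem_baseChange (p : Submodule k V) : ∀ m ∈ p.baseChange S,
    TensorProduct.map σ.toLinearMap (LinearMap.id : V →ₗ[k] V) m ∈ p.baseChange B :=
  baseChange_induction (by simp) (fun x y hx hy => by rw [map_add]; exact add_mem hx hy)
    fun s x hx => Submodule.tmul_mem_baseChange_of_mem _ hx

/-- The map `S ⊗_k p → B ⊗_k p` induced by `S → B`, as an additive map. -/
def baseChangePush (p : Submodule k V) : p.baseChange S →+ p.baseChange B :=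
  ((TensorProduct.map σ.toLinearMap (LinearMap.id : V →ₗ[k] V)).toAddMonoidHom.comp
    (p.baseChange S).subtype.toAddMonoidHom).codRestrict (p.baseChange B)
      fun m => map_mem_baseChange σ p m.1 m.2

theorem baseChangePush_smul (p : Submodule k V) (s : S) (m : p.baseChange S) :
    baseChangePush σ p (s • m) = σ s • baseChangePush σ p m :=
  Subtype.ext (map_smul_tensor σ s m.1)

/-- The map `B ⊗_S (S ⊗_k p) → B ⊗_k p`. -/
def extScalBaseChange (p : Submodule k V) :
    ExtScal σ.toRingHom (p.baseChange S) →ₗ[B] p.baseChange B :=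
  extScalLift σ.toRingHom (baseChangePush σ p) (baseChangePush_smul σ p)

/-- The map `B ⊗_k p → B ⊗_S (S ⊗_k p)`. -/
def extScalBaseChangeInv (p : Submodule k V) :
    B ⊗[k] p →ₗ[B] ExtScal σ.toRingHom (p.baseChange S) :=
  TensorProduct.AlgebraTensorModule.lift
    { toFun := fun b =>
        { toFun := fun x => extScalMk σ.toRingHom b (p.toBaseChange S (1 ⊗ₜ x))
          map_add' := fun x y => by
            rw [tmul_add, map_add, extScalMk_add]
          map_smul' := fun c x => by
            rw [tmul_smul, ← algebraMap_smul S c ((1 : S) ⊗ₜ[k] x), map_smul, ← extScalMk_mul]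
            change extScalMk _ (b * σ (algebraMap k S c)) _ = extScalMk _ (c • b) _
            rw [AlgHom.commutes, Algebra.smul_def, Algebra.commutes] }
      map_add' := fun b c => LinearMap.ext fun x => add_extScalMk _ _ _ _
      map_smul' := fun b c => LinearMap.ext fun x => rfl }

theorem extScalBaseChangeInv_tmul (p : Submodule k V) (b : B) (x : p) :
    extScalBaseChangeInv (S := S) σ p (b ⊗ₜ x) =
      extScalMk σ.toRingHom b (p.toBaseChange S (1 ⊗ₜ x)) := rfl

theorem extScalBaseChange_comp_inv (p : Submodule k V) (t : B ⊗[k] p) :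
    extScalBaseChange σ p (extScalBaseChangeInv (S := S) σ p t) = p.toBaseChange B t := by
  induction t with
  | zero => rw [map_zero, map_zero, map_zero]
  | tmul b x =>
    refine Subtype.ext ?_
    change b • (σ 1 ⊗ₜ[k] (x : V)) = b ⊗ₜ (x : V)
    rw [map_one, smul_tmul', smul_eq_mul, mul_one]
  | add x y hx hy => rw [map_add, map_add, map_add, hx, hy]

theorem extScalBaseChangeInv_surjective (p : Submodule k V) :
    Function.Surjective (extScalBaseChangeInv (S := S) σ p) := by
  intro y
  rw [← LinearMap.mem_range]
  induction y using extScal_induction with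
  | zero => exact zero_mem _
  | add x y hx hy => exact add_mem hx hy
  | mk b m =>
    obtain ⟨t, rfl⟩ := p.toBaseChange_surjective S m
    induction t with
    | zero => rw [map_zero, extScalMk_zero]; exact zero_mem _
    | add x y hx hy => rw [map_add, extScalMk_add]; exact add_mem hx hy
    | tmul s x =>
      refine ⟨(b * σ s) ⊗ₜ x, ?_⟩
      rw [extScalBaseChangeInv_tmul]
      refine (extScalMk_mul σ.toRingHom b s _).trans ?_
      rw [← map_smul, smul_tmul', smul_eq_mul, mul_one]

/-- The composite `B ⊗ p → B ⊗_S (S ⊗ p) → p.baseChange B` is the canonical isomorphism and its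
first map is surjective, so both maps are bijective. -/
theorem extScalBaseChange_bijective (p : Submodule k V) :
    Function.Bijective (extScalBaseChange (S := S) σ p) := by
  have h := (Submodule.toBaseChange.toLinearEquiv B p).bijective
  have e : ⇑(extScalBaseChange (S := S) σ p) ∘ ⇑(extScalBaseChangeInv σ p) =
      ⇑(Submodule.toBaseChange.toLinearEquiv B p) := funext (extScalBaseChange_comp_inv σ p)
  rw [← e] at h
  have hi : Function.Bijective (extScalBaseChangeInv (S := S) σ p) :=
    ⟨h.1.of_comp, extScalBaseChangeInv_surjective σ p⟩
  exact (Function.Bijective.of_comp_iff _ hi).1 h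

end ExtScalBaseChange

/-! ### Base change of Chevalley–Eilenberg complexes. -/

section CEBaseChange

variable {k : Type u} [Field k] {L : Type u} [LieRing L] [LieAlgebra k L]
  {S B : Type u} [Ring S] [Ring B] [Algebra k S] [Algebra k B]
  (ψ : UniversalEnvelopingAlgebra k L →ₐ[k] S) (σ : S →ₐ[k] B)

theorem map_ceE (z : L) (m : S ⊗[k] ExteriorAlgebra k L) :
    TensorProduct.map σ.toLinearMap LinearMap.id (ceE S z m) =
      ceE B z (TensorProduct.map σ.toLinearMap LinearMap.id m) := by
  induction m with
  | zero => simp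
  | tmul b x => simp [ceE_tmul]
  | add x y hx hy => simp only [map_add, hx, hy]

theorem map_ceT (z : L) (m : S ⊗[k] ExteriorAlgebra k L) :
    TensorProduct.map σ.toLinearMap LinearMap.id (ceT ψ z m) =
      ceT (σ.comp ψ) z (TensorProduct.map σ.toLinearMap LinearMap.id m) := by
  induction m with
  | zero => simp
  | tmul b x => simp [ceT_tmul, envMap]
  | add x y hx hy => simp only [map_add, hx, hy]

/-- Both sides are `σ`-semilinear, vanish on `1 ⊗ 1`, and obey the same recursion `ceD_ceE` under
wedging with a vector. -/
theorem map_ceD (m : S ⊗[k] ExteriorAlgebra k L) :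
    TensorProduct.map σ.toLinearMap LinearMap.id (ceD ψ m) =
      ceD (σ.comp ψ) (TensorProduct.map σ.toLinearMap LinearMap.id m) := by
  induction m using ce_induction with
  | zero => simp
  | one => simp [ceD_tmul, ceOne_one]
  | smul b m h => rw [map_smul, map_smul_tensor, map_smul_tensor, map_smul, h]
  | add x y hx hy => simp only [map_add, hx, hy]
  | mul z m h => rw [map_ceE, ceD_ceE, ceD_ceE, map_sub, map_ceT, map_ceE, h]

/-- `B ⊗_S -` transforms the Chevalley–Eilenberg complex over `S` into the one over `B`. -/
def extScalCeCochainIso :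
    ((extScalFunctor σ.toRingHom).mapHomologicalComplex (ComplexShape.up ℤ)).obj (ceCochain ψ) ≅
      ceCochain (σ.comp ψ) :=
  HomologicalComplex.Hom.isoOfComponents
    (fun i => (LinearEquiv.ofBijective _
      (extScalBaseChange_bijective σ (extZ (k := k) L i))).toModuleIso) (by
    intro i j hij
    obtain rfl : i + 1 = j := hij
    refine ModuleCat.hom_ext (extScal_ext _ fun b m => ?_)
    have h1 := gradedCx_d (G := fun i => (extZ (k := k) L i).baseChange S) (d := ceD ψ)
      (hG := ceD_extZ ψ) (hd := ceD_ceD ψ) i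
    have h2 := gradedCx_d (G := fun i => (extZ (k := k) L i).baseChange B) (d := ceD (σ.comp ψ))
      (hG := ceD_extZ _) (hd := ceD_ceD _) i
    change ((ceCochain (σ.comp ψ)).d i (i + 1)) (extScalBaseChange σ (extZ (k := k) L i)
      (extScalMk _ b m)) = extScalBaseChange σ (extZ (k := k) L (i + 1))
        (((extScalFunctor σ.toRingHom).map ((ceCochain ψ).d i (i + 1))) (extScalMk _ b m))
    unfold ceCochain
    rw [h1, h2]
    refine Subtype.ext ?_
    change ceD (σ.comp ψ) (b • TensorProduct.map σ.toLinearMap LinearMap.id m.1) =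
      b • TensorProduct.map σ.toLinearMap LinearMap.id (ceD ψ m.1)
    rw [map_smul, map_ceD])

/-- The derived base change of Chevalley–Eilenberg complexes. -/
theorem isDerivedExtScal_ceCochain {X : ModD S}
    (e : Nonempty (DerivedCategory.Q.obj (ceCochain ψ) ≅ X)) :
    IsDerivedExtScal σ.toRingHom X (DerivedCategory.Q.obj (ceCochain (σ.comp ψ))) :=
  ⟨ceCochain ψ, inferInstance, e, ⟨DerivedCategory.Q.mapIso (extScalCeCochainIso ψ σ)⟩⟩

end CEBaseChange

/-! ### Exterior algebras of a space split as a hyperplane plus a line. -/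

section Splitting

open CliffordAlgebra in
theorem contractLeft_mem_exteriorPower {k : Type*} [CommRing k] {V : Type*} [AddCommGroup V]
    [Module k V] (φ : Module.Dual k V) (p : ℕ) : ∀ x ∈ ⋀[k]^(p + 1) V,
    (contractLeft φ x : ExteriorAlgebra k V) ∈ ⋀[k]^p V := by
  have hι : ∀ (v : V) (x : ExteriorAlgebra k V), contractLeft φ (ExteriorAlgebra.ι k v * x) =
      φ v • x - ExteriorAlgebra.ι k v * contractLeft φ x := fun v x =>
    contractLeft_ι_mul (Q := (0 : QuadraticForm k V)) φ v x
  induction p with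
  | zero =>
    intro x hx
    rw [ExteriorAlgebra.exteriorPower, zero_add, pow_one] at hx
    obtain ⟨v, rfl⟩ := hx
    have := hι v 1
    rw [mul_one, contractLeft_one, mul_zero, sub_zero] at this
    rw [this, ExteriorAlgebra.exteriorPower, pow_zero]
    exact Submodule.smul_mem _ _ (Submodule.one_le.1 le_rfl)
  | succ p ih =>
    intro x hx
    rw [ExteriorAlgebra.exteriorPower, pow_succ'] at hx
    induction hx using Submodule.mul_induction_on' with
    | mem_mul_mem a ha b hb =>
      obtain ⟨v, rfl⟩ := ha
      rw [hι]
      refine Submodule.sub_mem _ (Submodule.smul_mem _ _ hb) ?_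
      rw [ExteriorAlgebra.exteriorPower, pow_succ']
      exact Submodule.mul_mem_mul ⟨v, rfl⟩ (ih b hb)
    | add x _ y _ hx hy => rw [map_add]; exact Submodule.add_mem _ hx hy

theorem algHom_mem_pow {k : Type*} [CommRing k] {V : Type*} [AddCommGroup V] [Module k V]
    {T : Type*} [Ring T] [Algebra k T] (F : ExteriorAlgebra k V →ₐ[k] T) (N : Submodule k T)
    (h : ∀ v, F (ExteriorAlgebra.ι k v) ∈ N) (p : ℕ) : ∀ x ∈ ⋀[k]^p V, F x ∈ N ^ p := by
  intro x hx
  have h1 : Submodule.map F.toLinearMap (⋀[k]^p V) ≤ N ^ p := by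
    rw [ExteriorAlgebra.exteriorPower, Submodule.map_pow]
    refine pow_le_pow_left' ?_ p
    rintro _ ⟨_, ⟨v, rfl⟩, rfl⟩
    exact h v
  exact h1 ⟨x, hx, rfl⟩

theorem map_mem_exteriorPower {k : Type*} [CommRing k] {V W : Type*} [AddCommGroup V] [Module k V]
    [AddCommGroup W] [Module k W] (g : V →ₗ[k] W) (p : ℕ) :
    ∀ x ∈ ⋀[k]^p V, ExteriorAlgebra.map g x ∈ ⋀[k]^p W :=
  algHom_mem_pow _ _ (fun v => by rw [ExteriorAlgebra.map_apply_ι]; exact ⟨_, rfl⟩) p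

theorem exists_algebraMap_eq_of_mem_exteriorPower_zero {k : Type*} [CommRing k] {V : Type*}
    [AddCommGroup V] [Module k V] {x : ExteriorAlgebra k V} (hx : x ∈ ⋀[k]^0 V) :
    ∃ c, algebraMap k _ c = x := by
  rw [ExteriorAlgebra.exteriorPower, pow_zero] at hx
  exact Submodule.mem_one.1 hx

/-- A decomposition `V = s W ⊕ k c`, with projections `r : V → W` and `φ : V → k`. -/
structure LineSplitting (k V W : Type*) [Field k] [AddCommGroup V] [Module k V] [AddCommGroup W]
    [Module k W] where
  s : W →ₗ[k] V
  r : V →ₗ[k] W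
  φ : V →ₗ[k] k
  c : V
  r_s : ∀ w, r (s w) = w
  φ_s : ∀ w, φ (s w) = 0
  r_c : r c = 0
  φ_c : φ c = 1
  decomp : ∀ v, s (r v) + φ v • c = v

section ExtB

variable {k : Type u} [Field k] {L L' : Type u} [LieRing L] [LieAlgebra k L] [LieRing L']
  [LieAlgebra k L'] (B : Type u) [Ring B] [Algebra k B]

/-- The map `B ⊗ Λ L → B ⊗ Λ L'` induced by a linear map `L → L'`. -/
def extB (g : L →ₗ[k] L') : B ⊗[k] ExteriorAlgebra k L →ₗ[B] B ⊗[k] ExteriorAlgebra k L' :=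
  (ExteriorAlgebra.map g).toLinearMap.baseChange B

variable {B} (g : L →ₗ[k] L')

theorem extB_tmul (b : B) (x) : extB B g (b ⊗ₜ x) = b ⊗ₜ ExteriorAlgebra.map g x := rfl

theorem extB_ceE (z : L) (m) : extB B g (ceE B z m) = ceE B (g z) (extB B g m) := by
  induction m with
  | zero => simp
  | tmul b x => simp [ceE_tmul, extB_tmul]
  | add x y hx hy => simp only [map_add, hx, hy]

theorem extB_mem (i : ℤ) : ∀ m ∈ (extZ (k := k) L i).baseChange B,
    extB B g m ∈ (extZ (k := k) L' i).baseChange B :=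
  baseChange_induction (by simp) (fun x y hx hy => by rw [map_add]; exact add_mem hx hy)
    fun b x hx => Submodule.tmul_mem_baseChange_of_mem _
      (zGrading_map (F := ((ExteriorAlgebra.map g).toLinearMap : _ →ₗ[k] _).toAddMonoidHom)
        (map_mem_exteriorPower g) i x hx)

variable {ψ : UniversalEnvelopingAlgebra k L →ₐ[k] B} {ψ' : UniversalEnvelopingAlgebra k L' →ₐ[k] B}
  {g}

theorem map_lieAd {y' : L'} {y : L} (hy : ∀ z, g ⁅y, z⁆ = ⁅y', g z⁆)
    (x : ExteriorAlgebra k L) :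
    ExteriorAlgebra.map g (lieAd y x) = lieAd y' (ExteriorAlgebra.map g x) := by
  induction x using ext_induction with
  | one => simp [lieAd_one]
  | smul c x h => simp only [map_smul, h]
  | add x y hx hy => simp only [map_add, hx, hy]
  | mul z x h =>
    rw [lieAd_ι_mul, map_add, map_mul, map_mul, map_mul, h, ExteriorAlgebra.map_apply_ι,
      ExteriorAlgebra.map_apply_ι, lieAd_ι_mul, hy]

theorem extB_ceT (hg : ∀ y z, g ⁅y, z⁆ = ⁅g y, g z⁆) (hψ : ∀ y, envMap ψ' (g y) = envMap ψ y)
    (z : L) (m) : extB B g (ceT ψ z m) = ceT ψ' (g z) (extB B g m) := by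
  induction m with
  | zero => simp
  | tmul b x => simp [ceT_tmul, extB_tmul, hψ, map_lieAd (hg z)]
  | add x y hx hy => simp only [map_add, hx, hy]

theorem extB_ceD (hg : ∀ y z, g ⁅y, z⁆ = ⁅g y, g z⁆) (hψ : ∀ y, envMap ψ' (g y) = envMap ψ y)
    (m) : extB B g (ceD ψ m) = ceD ψ' (extB B g m) := by
  induction m using ce_induction with
  | zero => simp
  | one => simp [ceD_tmul, ceOne_one, extB_tmul]
  | smul b m h => simp only [map_smul, h]
  | add x y hx hy => simp only [map_add, hx, hy]
  | mul z m h => rw [ceD_ceE, map_sub, extB_ceT hg hψ, extB_ceE, extB_ceE, ceD_ceE, h]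

end ExtB

variable {k : Type u} [Field k] {L L' : Type u} [LieRing L] [LieAlgebra k L] [LieRing L']
  [LieAlgebra k L'] (D : LineSplitting k L L') (B : Type u) [Ring B] [Algebra k B]

namespace LineSplitting

/-- The map `B ⊗ Λ W → B ⊗ Λ V` induced by `s`. -/
abbrev sB : B ⊗[k] ExteriorAlgebra k L' →ₗ[B] B ⊗[k] ExteriorAlgebra k L := extB B D.s

/-- The map `B ⊗ Λ V → B ⊗ Λ W` induced by `r`. -/
abbrev rB : B ⊗[k] ExteriorAlgebra k L →ₗ[B] B ⊗[k] ExteriorAlgebra k L' := extB B D.r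

/-- The contraction with `φ`. -/
def φB : B ⊗[k] ExteriorAlgebra k L →ₗ[B] B ⊗[k] ExteriorAlgebra k L :=
  LinearMap.baseChange B (CliffordAlgebra.contractLeft (Q := (0 : QuadraticForm k L)) D.φ)

variable {B}

theorem φB_ceE (z : L) (m) : D.φB B (ceE B z m) = D.φ z • m - ceE B z (D.φB B m) := by
  induction m with
  | zero => simp
  | tmul b x =>
    have h := CliffordAlgebra.contractLeft_ι_mul (Q := (0 : QuadraticForm k L)) D.φ z x
    rw [ceE_tmul]
    change b ⊗ₜ CliffordAlgebra.contractLeft D.φ (CliffordAlgebra.ι 0 z * x) = _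
    rw [h, tmul_sub, tmul_smul]
    rfl
  | add x y hx hy => simp only [map_add, smul_add, hx, hy]; abel

theorem φB_one : D.φB B (1 ⊗ₜ 1) = 0 := by
  have h := CliffordAlgebra.contractLeft_one (Q := (0 : QuadraticForm k L)) D.φ
  change (1 : B) ⊗ₜ CliffordAlgebra.contractLeft D.φ (1 : ExteriorAlgebra k L) = 0
  exact (congrArg _ h).trans (tmul_zero _ _)

theorem rB_sB (m) : D.rB B (D.sB B m) = m := by
  induction m using ce_induction with
  | one => simp [extB_tmul]
  | zero => simp
  | smul b m h => rw [map_smul, map_smul, h]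
  | add x y hx hy => rw [map_add, map_add, hx, hy]
  | mul z m h => rw [extB_ceE, extB_ceE, h, D.r_s]

theorem φB_sB (m) : D.φB B (D.sB B m) = 0 := by
  induction m using ce_induction with
  | one => simp only [extB_tmul, map_one, φB_one]
  | zero => simp
  | smul b m h => rw [map_smul, map_smul, h, smul_zero]
  | add x y hx hy => rw [map_add, map_add, hx, hy, add_zero]
  | mul z m h => rw [extB_ceE, φB_ceE, h, D.φ_s]; simp

theorem ceE_add_smul (z w : L) (a : k) (m : B ⊗[k] ExteriorAlgebra k L) :
    ceE B (z + a • w) m = ceE B z m + a • ceE B w m := by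
  induction m with
  | zero => simp
  | tmul b x => simp [ceE_tmul, add_mul, tmul_add]
  | add x y hx hy => simp only [map_add, smul_add, hx, hy]; abel

theorem ceE_zero (m : B ⊗[k] ExteriorAlgebra k L) : ceE B (0 : L) m = 0 := by
  induction m with
  | zero => simp
  | tmul b x => simp [ceE_tmul]
  | add x y hx hy => simp only [map_add, hx, hy, add_zero]

theorem ceE_swap (y z : L) (m : B ⊗[k] ExteriorAlgebra k L) :
    ceE B y (ceE B z m) = - ceE B z (ceE B y m) := by
  induction m with
  | zero => simp
  | tmul b x => rw [ceE_tmul, ceE_tmul, ι_mul_ι_swap, tmul_neg, ceE_tmul, ceE_tmul]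
  | add x y hx hy => simp only [map_add, hx, hy]; abel

theorem rB_ceE_c (m) : D.rB B (ceE B D.c m) = 0 := by
  rw [extB_ceE, D.r_c, ceE_zero]

/-- The exterior algebra of `s W ⊕ k c` is `Λ W ⊕ c ∧ Λ W`: `rB` kills `c` and reads off the first
component, while contraction with `φ` strips `c` from the second. Uniqueness is
`eq_zero_of_add_eq_zero`. -/
theorem decomp_tensor (m) :
    D.sB B (D.rB B m) + ceE B D.c (D.sB B (D.rB B (D.φB B m))) = m := by
  induction m using ce_induction with
  | one => rw [φB_one]; simp [extB_tmul]
  | zero => simp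
  | smul b m h => conv_rhs => rw [← h]
                  simp only [map_smul, smul_add]
  | add x y hx hy => conv_rhs => rw [← hx, ← hy]
                     simp only [map_add]; abel
  | mul z m h =>
    have e : ∀ m, ceE B z m = ceE B (D.s (D.r z)) m + D.φ z • ceE B D.c m := fun m => by
      rw [← ceE_add_smul, D.decomp]
    rw [φB_ceE, map_sub, map_sub, map_sub, extB_ceE, extB_ceE, extB_ceE, extB_ceE, ceE_swap D.c]
    conv_rhs => rw [e, ← h, map_add, map_add, ceE_ceE, add_zero]
    simp only [LinearMap.map_smul_of_tower]
    abel

theorem eq_zero_of_add_eq_zero {a b : B ⊗[k] ExteriorAlgebra k L'}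
    (h : D.sB B a + ceE B D.c (D.sB B b) = 0) : a = 0 ∧ b = 0 := by
  have ha := congrArg (D.rB B) h
  rw [map_add, rB_sB, rB_ceE_c, add_zero, map_zero] at ha
  have hb := congrArg (D.φB B) h
  rw [ha, map_zero, zero_add, φB_ceE, D.φ_c, φB_sB, map_zero, sub_zero, one_smul, map_zero] at hb
  exact ⟨ha, by rw [← D.rB_sB b, hb, map_zero]⟩

theorem φB_mem (i : ℤ) : ∀ m ∈ (extZ (k := k) L i).baseChange B,
    D.φB B m ∈ (extZ (k := k) L (i + 1)).baseChange B :=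
  baseChange_induction (by simp) (fun x y hx hy => by rw [map_add]; exact add_mem hx hy)
    fun b x hx => Submodule.tmul_mem_baseChange_of_mem _
      (zGrading_d (G := fun p => ⋀[k]^p L)
        (d := CliffordAlgebra.contractLeft (Q := (0 : QuadraticForm k L)) D.φ)
        (contractLeft_mem_exteriorPower D.φ) (fun m hm => by
          obtain ⟨c, rfl⟩ := exists_algebraMap_eq_of_mem_exteriorPower_zero hm
          exact CliffordAlgebra.contractLeft_algebraMap (Q := (0 : QuadraticForm k L)) D.φ c) i x hx)

end LineSplitting

theorem ceE_mem_extZ (z : L) (i : ℤ) : ∀ m ∈ (extZ (k := k) L (i + 1)).baseChange B,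
    ceE B z m ∈ (extZ (k := k) L i).baseChange B := by
  rcases zGrading_cases (i := i) with ⟨_ | p, rfl⟩ | hi
  · rw [extZ_pos L (by simp), Submodule.baseChange_bot]
    simp
  · rw [show (-((p + 1 : ℕ) : ℤ) + 1) = -p by push_cast; ring, extZ, extZ, zGrading_neg,
      zGrading_neg]
    exact ceE_mem z p
  · rw [extZ_pos L (by omega), Submodule.baseChange_bot]
    simp

end Splitting

/-! ### Central extensions and the exact sequence `0 → K[1] → X → K → 0`. -/

section CentralExtension

open Limits

variable {k : Type u} [Field k] {L L' : Type u} [LieRing L] [LieAlgebra k L] [LieRing L']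
  [LieAlgebra k L'] (D : LineSplitting k L L') {B : Type u} [Ring B] [Algebra k B]
  {ψ : UniversalEnvelopingAlgebra k L →ₐ[k] B} {ψ' : UniversalEnvelopingAlgebra k L' →ₐ[k] B}

namespace LineSplitting

section

theorem ceT_c (hc : ∀ y : L, ⁅D.c, y⁆ = 0) (hψc : envMap ψ D.c = 0)
    (m : B ⊗[k] ExteriorAlgebra k L) : ceT ψ D.c m = 0 := by
  have h : ∀ x : ExteriorAlgebra k L, lieAd D.c x = 0 := fun x => by
    induction x using ext_induction with
    | one => rw [lieAd_one]
    | smul c x h => rw [map_smul, h, smul_zero]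
    | add x y hx hy => rw [map_add, hx, hy, add_zero]
    | mul z x h => rw [lieAd_ι_mul, h, hc]; simp
  induction m with
  | zero => simp
  | tmul b x => rw [ceT_tmul, h, hψc]; simp
  | add x y hx hy => rw [map_add, hx, hy, add_zero]

/-- The kernel of `rB` consists of multiples of `c`, and `c ∧ c = 0`. -/
theorem ceE_c_eq_zero {m : B ⊗[k] ExteriorAlgebra k L} (h : D.rB B m = 0) :
    ceE B D.c m = 0 := by
  rw [← D.decomp_tensor m, h, map_zero, zero_add, ceE_ceE]

end

variable (hr : ∀ y z, D.r ⁅y, z⁆ = ⁅D.r y, D.r z⁆) (hψ : ∀ y, envMap ψ' (D.r y) = envMap ψ y)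
  (hc : ∀ y : L, ⁅D.c, y⁆ = 0)
include hr hψ hc

/-- The section `s` is only linear, so `sB` need not commute with the differentials. The discrepancy
dies under `rB`, hence under wedging with `c`. The Lie derivative along `c` vanishes, because `c` is
central and acts as zero on `B`. -/
theorem ceD_ceE_c_sB (m : B ⊗[k] ExteriorAlgebra k L') :
    ceD ψ (ceE B D.c (D.sB B m)) = - ceE B D.c (D.sB B (ceD ψ' m)) := by
  have h0 : envMap ψ D.c = 0 := by rw [← hψ, D.r_c]; simp [envMap]
  rw [ceD_ceE, D.ceT_c hc h0, zero_sub]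
  congr 1
  rw [← sub_eq_zero, ← map_sub]
  apply D.ceE_c_eq_zero
  rw [map_sub, extB_ceD hr hψ, rB_sB, rB_sB, sub_self]

/-- The class of the Chevalley–Eilenberg complex in a thick or localizing subcategory does not
change under a central extension. -/
theorem prop_ceCochain_iff [Module.Finite k L'] (P : ObjectProperty (ModD B)) [P.IsTriangulated]
    [P.IsClosedUnderIsomorphisms]
    (hP : ∀ (E : CochainComplex (ModuleCat.{u} B) ℤ) (R : ModD B), E.IsKProjective →
      Retract R (DerivedCategory.Q.obj E) → P (DerivedCategory.Q.obj E) → P R) :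
    P (DerivedCategory.Q.obj (ceCochain ψ)) ↔ P (DerivedCategory.Q.obj (ceCochain ψ')) := by
  let K := ceCochain ψ'
  have hd : ∀ i, (ceCochain ψ).d i (i + 1) = ModuleCat.ofHom ((ceD ψ).restrict (ceD_extZ ψ i)) :=
    fun i => gradedCx_d i
  have hd' : ∀ i, (ceCochain ψ').d i (i + 1) =
      ModuleCat.ofHom ((ceD ψ').restrict (ceD_extZ ψ' i)) := fun i => gradedCx_d i
  let F : B ⊗[k] ExteriorAlgebra k L' →ₗ[B] B ⊗[k] ExteriorAlgebra k L := ceE B D.c ∘ₗ D.sB B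
  have hF : ∀ i, ∀ m ∈ (extZ (k := k) L' (i + 1)).baseChange B,
      F m ∈ (extZ (k := k) L i).baseChange B := fun i m hm =>
    ceE_mem_extZ _ _ _ _ (extB_mem D.s _ m hm)
  let f : K⟦(1 : ℤ)⟧ ⟶ ceCochain ψ :=
    { f := fun i => ModuleCat.ofHom (F.restrict (hF i))
      comm' := fun i j hij => by
        obtain rfl : i + 1 = j := hij
        -- The sign in the differential of the shift matches the sign from moving the differential
        -- past `c`.
        have : (K⟦(1 : ℤ)⟧).d i (i + 1) = - ModuleCat.ofHom ((ceD ψ').restrict (ceD_extZ ψ' (i + 1))) := by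
          rw [← hd']
          simp [K]
          rfl
        rw [this, hd]
        refine ModuleCat.hom_ext (LinearMap.ext fun x => Subtype.ext ?_)
        change ceD ψ (F (Subtype.val x)) = F (- ceD ψ' (Subtype.val x))
        rw [map_neg]
        exact D.ceD_ceE_c_sB hr hψ hc _ }
  let g : ceCochain ψ ⟶ K := gradedCxHom (D.rB B) (extB_mem D.r) (extB_ceD hr hψ)
  refine prop_iff_of_shortExact P hP K _ _ _ (isZero_ceCochain_X ψ') f g ?_
    (shortExact_of_apply f g _ ?_ ?_ ?_)
  · ext i : 1
    exact ModuleCat.hom_ext (LinearMap.ext fun x => Subtype.ext (D.rB_ceE_c _))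
  · intro i x y hxy
    have h : ceE B D.c (D.sB B x.1) = ceE B D.c (D.sB B y.1) := congrArg Subtype.val hxy
    -- Uniqueness of the decomposition, with vanishing first component.
    refine Subtype.ext (sub_eq_zero.1 (D.eq_zero_of_add_eq_zero (a := 0) ?_).2)
    rw [map_sub, map_sub, h, sub_self, map_zero, zero_add]
  · intro i x
    exact ⟨⟨D.sB B x.1, extB_mem D.s _ _ x.2⟩, Subtype.ext (D.rB_sB _)⟩
  · intro i x hx
    have h : D.rB B x.1 = 0 := congrArg Subtype.val hx
    refine ⟨⟨D.rB B (D.φB B x.1), extB_mem D.r _ _ (D.φB_mem _ _ x.2)⟩, Subtype.ext ?_⟩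
    have := D.decomp_tensor x.1
    rwa [h, map_zero, zero_add] at this

end LineSplitting

end CentralExtension

/-! ### Induction and derivations on enveloping algebras. -/

section EnvelopingAlgebra

variable {k : Type u} [Field k] {L : Type u} [LieRing L] [LieAlgebra k L]

/-- The elements satisfying `P` form a subalgebra through which `L` maps; by the universal property
the identity factors through it. -/
theorem env_induction {P : UniversalEnvelopingAlgebra k L → Prop}
    (algebraMap : ∀ c, P (algebraMap k _ c))
    (ι : ∀ y, P (UniversalEnvelopingAlgebra.ι k y)) (add : ∀ x y, P x → P y → P (x + y))
    (mul : ∀ x y, P x → P y → P (x * y)) (x : UniversalEnvelopingAlgebra k L) : P x := by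
  let S : Subalgebra k (UniversalEnvelopingAlgebra k L) :=
    { carrier := {x | P x}
      mul_mem' := fun {x y} => mul x y
      add_mem' := fun {x y} => add x y
      algebraMap_mem' := algebraMap }
  let f : L →ₗ⁅k⁆ S :=
    { toFun := fun y => ⟨UniversalEnvelopingAlgebra.ι k y, ι y⟩
      map_add' := fun y z => Subtype.ext (map_add _ _ _)
      map_smul' := fun c z => Subtype.ext (map_smul _ _ _)
      map_lie' := fun {y z} => Subtype.ext (LieHom.map_lie _ _ _) }
  have h : S.val.comp (UniversalEnvelopingAlgebra.lift k f) = AlgHom.id k _ := by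
    ext y
    change (UniversalEnvelopingAlgebra.lift k f (UniversalEnvelopingAlgebra.ι k y)).1 = _
    rw [UniversalEnvelopingAlgebra.lift_ι_apply]
    rfl
  rw [← AlgHom.id_apply (R := k) x, ← h]
  exact (UniversalEnvelopingAlgebra.lift k f x).2

/-- The Lie algebra map to the dual numbers that determines the extension of a derivation of `L`
to `U(L)`. -/
def envDerLie (δ : L →ₗ[k] L) (hδ : ∀ y z, δ ⁅y, z⁆ = ⁅δ y, z⁆ + ⁅y, δ z⁆) :
    L →ₗ⁅k⁆ TrivSqZeroExt (UniversalEnvelopingAlgebra k L) (UniversalEnvelopingAlgebra k L) :=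
  { toFun := fun y => TrivSqZeroExt.inl (UniversalEnvelopingAlgebra.ι k y) +
      TrivSqZeroExt.inr (UniversalEnvelopingAlgebra.ι k (δ y))
    map_add' := fun y z => by
      refine TrivSqZeroExt.ext ?_ ?_ <;> simp only [map_add, TrivSqZeroExt.fst_add,
        TrivSqZeroExt.snd_add, TrivSqZeroExt.fst_inl, TrivSqZeroExt.snd_inl, TrivSqZeroExt.fst_inr,
        TrivSqZeroExt.snd_inr, add_zero, zero_add]
    map_smul' := fun c z => by
      refine TrivSqZeroExt.ext ?_ ?_ <;> simp only [map_smul, RingHom.id_apply,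
        TrivSqZeroExt.fst_add, TrivSqZeroExt.fst_smul, TrivSqZeroExt.snd_smul,
        TrivSqZeroExt.snd_add, TrivSqZeroExt.fst_inl, TrivSqZeroExt.snd_inl, TrivSqZeroExt.fst_inr,
        TrivSqZeroExt.snd_inr, add_zero, zero_add]
    map_lie' := fun {y z} => by
      refine TrivSqZeroExt.ext ?_ ?_
      · simp only [LieHom.map_lie, LieRing.of_associative_ring_bracket, TrivSqZeroExt.fst_add,
          TrivSqZeroExt.fst_inl, TrivSqZeroExt.fst_inr, TrivSqZeroExt.fst_sub,
          TrivSqZeroExt.fst_mul, add_zero]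
      · simp only [LieHom.map_lie, LieRing.of_associative_ring_bracket, TrivSqZeroExt.fst_add,
          TrivSqZeroExt.fst_inl, TrivSqZeroExt.fst_inr, TrivSqZeroExt.snd_sub,
          TrivSqZeroExt.snd_mul, add_zero, hδ, map_add, TrivSqZeroExt.snd_add,
          TrivSqZeroExt.snd_inl, TrivSqZeroExt.snd_inr, zero_add, smul_eq_mul,
          MulOpposite.smul_eq_mul_unop, MulOpposite.unop_op]
        abel }

theorem fst_envDerLie (δ : L →ₗ[k] L) (hδ : ∀ y z, δ ⁅y, z⁆ = ⁅δ y, z⁆ + ⁅y, δ z⁆) (y : L) :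
    (envDerLie δ hδ y).fst = UniversalEnvelopingAlgebra.ι k y :=
  add_zero _

theorem snd_envDerLie (δ : L →ₗ[k] L) (hδ : ∀ y z, δ ⁅y, z⁆ = ⁅δ y, z⁆ + ⁅y, δ z⁆) (y : L) :
    (envDerLie δ hδ y).snd = UniversalEnvelopingAlgebra.ι k (δ y) :=
  zero_add _

/-- The derivation of `U(L)` that extends a derivation of `L`. -/
def envDer (δ : L →ₗ[k] L) (hδ : ∀ y z, δ ⁅y, z⁆ = ⁅δ y, z⁆ + ⁅y, δ z⁆) :
    UniversalEnvelopingAlgebra k L →ₗ[k] UniversalEnvelopingAlgebra k L :=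
  (TrivSqZeroExt.sndHom (UniversalEnvelopingAlgebra k L)
    (UniversalEnvelopingAlgebra k L)).restrictScalars k ∘ₗ
    (UniversalEnvelopingAlgebra.lift k (envDerLie δ hδ)).toLinearMap

section

variable (δ : L →ₗ[k] L) (hδ : ∀ y z, δ ⁅y, z⁆ = ⁅δ y, z⁆ + ⁅y, δ z⁆)

theorem fst_lift_envDerLie (x : UniversalEnvelopingAlgebra k L) :
    (UniversalEnvelopingAlgebra.lift k (envDerLie δ hδ) x).fst = x := by
  have h : (TrivSqZeroExt.fstHom k (UniversalEnvelopingAlgebra k L) (UniversalEnvelopingAlgebra k L)).comp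
      (UniversalEnvelopingAlgebra.lift k (envDerLie δ hδ)) = AlgHom.id k _ := by
    ext y
    change (UniversalEnvelopingAlgebra.lift k (envDerLie δ hδ)
      (UniversalEnvelopingAlgebra.ι k y)).fst = _
    rw [UniversalEnvelopingAlgebra.lift_ι_apply, fst_envDerLie]
    rfl
  exact AlgHom.congr_fun h x

theorem envDer_mul (x y : UniversalEnvelopingAlgebra k L) :
    envDer δ hδ (x * y) = x * envDer δ hδ y + envDer δ hδ x * y := by
  have h := fst_lift_envDerLie δ hδ
  change (UniversalEnvelopingAlgebra.lift k (envDerLie δ hδ) (x * y)).snd = _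
  rw [map_mul, TrivSqZeroExt.snd_mul, h, h]
  rfl

theorem envDer_ι (y : L) : envDer δ hδ (UniversalEnvelopingAlgebra.ι k y) =
    UniversalEnvelopingAlgebra.ι k (δ y) := by
  change (UniversalEnvelopingAlgebra.lift k (envDerLie δ hδ)
    (UniversalEnvelopingAlgebra.ι k y)).snd = _
  rw [UniversalEnvelopingAlgebra.lift_ι_apply, snd_envDerLie]

theorem envDer_one : envDer δ hδ 1 = 0 := by
  have := envDer_mul δ hδ 1 1
  simpa using this

end

end EnvelopingAlgebra

/-! ### The enveloping algebra as an Ore extension by one generator. -/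

section OreExtension

variable {k : Type u} [Field k] {L L' : Type u} [LieRing L] [LieAlgebra k L] [LieRing L']
  [LieAlgebra k L'] (D : LineSplitting k L L') (sL : L' →ₗ⁅k⁆ L)

namespace LineSplitting

/-- The derivation of `L'` induced by the bracket with the generator `c` of the complement. -/
def der : L' →ₗ[k] L' where
  toFun y := D.r ⁅D.c, D.s y⁆
  map_add' y z := by rw [map_add, lie_add, map_add]
  map_smul' a y := by rw [map_smul, lie_smul, map_smul, RingHom.id_apply]

/-- The algebra map `U(L') → U(L)`. -/
def envIncl : UniversalEnvelopingAlgebra k L' →ₐ[k] UniversalEnvelopingAlgebra k L :=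
  UniversalEnvelopingAlgebra.lift k ((UniversalEnvelopingAlgebra.ι k).comp sL)

theorem envIncl_ι (y : L') : envIncl sL (UniversalEnvelopingAlgebra.ι k y) =
    UniversalEnvelopingAlgebra.ι k (sL y) := by
  rw [envIncl, UniversalEnvelopingAlgebra.lift_ι_apply]
  rfl

section

variable (hs : ∀ w, sL w = D.s w) (hφ : ∀ y z : L, D.φ ⁅y, z⁆ = 0)
include hφ

/-- Brackets lie in the kernel of `φ`, which is the image of `s`, so applying `r` loses nothing. -/
theorem s_der (y : L') : D.s (D.der y) = ⁅D.c, D.s y⁆ := by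
  have := D.decomp ⁅D.c, D.s y⁆
  rwa [hφ, zero_smul, add_zero] at this

include hs

theorem der_lie (y z : L') : D.der ⁅y, z⁆ = ⁅D.der y, z⁆ + ⁅y, D.der z⁆ := by
  have h : D.s (D.der ⁅y, z⁆) = D.s (⁅D.der y, z⁆ + ⁅y, D.der z⁆) := by
    rw [D.s_der hφ, map_add, ← hs, ← hs, ← hs, LieHom.map_lie, LieHom.map_lie, LieHom.map_lie,
      hs, hs, hs, hs, D.s_der hφ, D.s_der hφ, leibniz_lie]
  rw [← D.r_s (D.der ⁅y, z⁆), h, D.r_s]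

theorem r_lie (y z : L) : D.r ⁅y, z⁆ =
    ⁅D.r y, D.r z⁆ + D.φ y • D.der (D.r z) - D.φ z • D.der (D.r y) := by
  have h : ⁅y, z⁆ = D.s (⁅D.r y, D.r z⁆ + D.φ y • D.der (D.r z) - D.φ z • D.der (D.r y)) := by
    conv_lhs => rw [← D.decomp y, ← D.decomp z]
    rw [map_sub, map_add, map_smul, map_smul, D.s_der hφ, D.s_der hφ, ← hs, ← hs, ← hs,
      LieHom.map_lie]
    simp only [lie_add, add_lie, lie_smul, smul_lie, lie_self, smul_zero, add_zero]
    rw [← lie_skew D.c (sL (D.r y)), smul_neg]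
    abel
  rw [h, D.r_s]

end

/-- The right action of `y ∈ L` on `U(L')[t]`, where `t` stands for the generator `c`. -/
def oreAct (hδ : ∀ y z, D.der ⁅y, z⁆ = ⁅D.der y, z⁆ + ⁅y, D.der z⁆) (y : L) :
    (ℕ →₀ UniversalEnvelopingAlgebra k L') →ₗ[k] (ℕ →₀ UniversalEnvelopingAlgebra k L') :=
  Finsupp.mapRange.linearMap
      (LinearMap.mulRight k (UniversalEnvelopingAlgebra.ι k (D.r y))) +
    D.φ y • (Finsupp.lmapDomain _ k (· + 1) - Finsupp.mapRange.linearMap (envDer D.der hδ))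

/-- Read `single i u` as `cⁱ u`. As `u c = c u - δ(u)` in `U(L)`, right multiplication by `c` must
send `cⁱ u` to `cⁱ⁺¹ u - cⁱ δ(u)`. -/
theorem oreAct_single (hδ) (y : L) (i : ℕ) (u : UniversalEnvelopingAlgebra k L') :
    D.oreAct hδ y (Finsupp.single i u) =
      Finsupp.single i (u * UniversalEnvelopingAlgebra.ι k (D.r y)) +
      D.φ y • (Finsupp.single (i + 1) u - Finsupp.single i (envDer D.der hδ u)) := by
  simp [oreAct, Finsupp.mapDomain_single]

/-- The composites are in reverse order because the action is on the right; hence the opposite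
endomorphism algebra in `oreLie`. -/
theorem oreAct_lie (hδ) (hr : ∀ y z : L, D.r ⁅y, z⁆ =
      ⁅D.r y, D.r z⁆ + D.φ y • D.der (D.r z) - D.φ z • D.der (D.r y))
    (hφ : ∀ y z : L, D.φ ⁅y, z⁆ = 0) (y z : L) :
    D.oreAct hδ ⁅y, z⁆ = D.oreAct hδ z ∘ₗ D.oreAct hδ y - D.oreAct hδ y ∘ₗ D.oreAct hδ z := by
  refine Finsupp.lhom_ext fun i u => ?_
  simp only [LinearMap.sub_apply, LinearMap.comp_apply, oreAct_single, map_add, map_sub, map_smul,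
    hφ, zero_smul, hr, envDer_mul, envDer_ι, LieHom.map_lie,
    LieRing.of_associative_ring_bracket, mul_add, mul_sub, Finsupp.single_add, Finsupp.single_sub,
    smul_add, smul_sub, mul_assoc, ← Finsupp.smul_single, mul_smul_comm, smul_smul]
  rw [mul_comm (D.φ z)]
  abel

/-- The right module structure on `U(L')[t]`. -/
def oreLie (hδ : ∀ y z, D.der ⁅y, z⁆ = ⁅D.der y, z⁆ + ⁅y, D.der z⁆) (hr : ∀ y z : L, D.r ⁅y, z⁆ =
      ⁅D.r y, D.r z⁆ + D.φ y • D.der (D.r z) - D.φ z • D.der (D.r y))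
    (hφ : ∀ y z : L, D.φ ⁅y, z⁆ = 0) :
    L →ₗ⁅k⁆ (Module.End k (ℕ →₀ UniversalEnvelopingAlgebra k L'))ᵐᵒᵖ :=
  { toFun := fun y => MulOpposite.op (D.oreAct hδ y)
    map_add' := fun y z => MulOpposite.unop_injective (Finsupp.lhom_ext fun i u => by
      change D.oreAct hδ (y + z) _ = D.oreAct hδ y _ + D.oreAct hδ z _
      simp only [oreAct_single, map_add, mul_add, Finsupp.single_add, add_smul]
      abel)
    map_smul' := fun a y => MulOpposite.unop_injective (Finsupp.lhom_ext fun i u => by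
      change D.oreAct hδ (a • y) _ = a • D.oreAct hδ y _
      simp only [oreAct_single, map_smul, mul_smul_comm, ← Finsupp.smul_single, smul_add, smul_smul,
        smul_eq_mul])
    map_lie' := fun {y z} => MulOpposite.unop_injective (D.oreAct_lie hδ hr hφ y z) }

/-- The map `Σ tⁱ uᵢ ↦ Σ cⁱ uᵢ` from `U(L')[t]` to `U(L)`. -/
def oreSum : (ℕ →₀ UniversalEnvelopingAlgebra k L') →ₗ[k] UniversalEnvelopingAlgebra k L :=
  Finsupp.lsum k fun i => LinearMap.mulLeft k (UniversalEnvelopingAlgebra.ι k D.c ^ i) ∘ₗ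
    (envIncl sL).toLinearMap

theorem oreSum_single (i : ℕ) (u : UniversalEnvelopingAlgebra k L') :
    D.oreSum sL (Finsupp.single i u) = UniversalEnvelopingAlgebra.ι k D.c ^ i * envIncl sL u := by
  simp [oreSum]

section

variable (hs : ∀ w, sL w = D.s w) (hφ : ∀ y z : L, D.φ ⁅y, z⁆ = 0)
include hs hφ

/-- The right module `U(L')[t]` supplies a left inverse: acting on `1`, the element `cⁱ` gives `tⁱ`
since `δ(1) = 0`, and `u ∈ U(L')` then acts by right multiplication, giving `tⁱ u`. -/
theorem oreSum_injective : Function.Injective (D.oreSum sL) := by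
  have hδ := D.der_lie sL hs hφ
  let ρ := UniversalEnvelopingAlgebra.lift k (D.oreLie hδ (D.r_lie sL hs hφ) hφ)
  have hρ : ∀ y v, (ρ (UniversalEnvelopingAlgebra.ι k y)).unop v = D.oreAct hδ y v := fun y v => by
    rw [show ρ _ = _ from UniversalEnvelopingAlgebra.lift_ι_apply _ _ _]
    rfl
  have h1 : ∀ (v u : UniversalEnvelopingAlgebra k L') i,
      (ρ (envIncl sL v)).unop (Finsupp.single i u) = Finsupp.single i (u * v) := by
    intro v
    induction v using env_induction with
    | algebraMap c => intro u i; simp [Algebra.algebraMap_eq_smul_one]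
    | ι y => intro u i; rw [envIncl_ι, hρ, oreAct_single, hs, D.r_s, D.φ_s, zero_smul, add_zero]
    | add x y hx hy =>
      intro u i
      rw [map_add, map_add, MulOpposite.unop_add, LinearMap.add_apply, hx, hy, mul_add,
        Finsupp.single_add]
    | mul x y hx hy =>
      intro u i
      rw [map_mul, map_mul, MulOpposite.unop_mul, Module.End.mul_apply, hx, hy, mul_assoc]
  have h2 : ∀ i, (ρ (UniversalEnvelopingAlgebra.ι k D.c ^ i)).unop (Finsupp.single 0 1) =
      Finsupp.single i 1 := by
    intro i
    induction i with
    | zero => simp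
    | succ i ih =>
      rw [pow_succ, map_mul, MulOpposite.unop_mul, Module.End.mul_apply, ih, hρ, oreAct_single,
        D.r_c, D.φ_c, envDer_one]
      simp
  have h3 : ∀ a, (ρ (D.oreSum sL a)).unop (Finsupp.single 0 1) = a := by
    intro a
    induction a using Finsupp.induction_linear with
    | zero => simp
    | add a b ha hb =>
      rw [map_add, map_add, MulOpposite.unop_add, LinearMap.add_apply, ha, hb]
    | single i u =>
      rw [oreSum_single, map_mul, MulOpposite.unop_mul, Module.End.mul_apply, h2, h1, one_mul]
  intro a b hab
  rw [← h3 a, hab, h3]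

/-- The range contains `1` and is a left ideal. Stability under `c` is clear; for `w ∈ L'` one moves
`w` past the powers of `c` by `w cⁱ⁺¹ = c w cⁱ - δ(w) cⁱ`. -/
theorem oreSum_surjective : Function.Surjective (D.oreSum sL) := by
  let R := LinearMap.range (D.oreSum sL)
  have hR : ∀ (f : Module.End k (UniversalEnvelopingAlgebra k L)),
      (∀ i u, f (UniversalEnvelopingAlgebra.ι k D.c ^ i * envIncl sL u) ∈ R) →
        ∀ x ∈ R, f x ∈ R := by
    rintro f hf _ ⟨a, rfl⟩
    induction a using Finsupp.induction_linear with
    | zero => simp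
    | add a b ha hb => rw [map_add, map_add]; exact add_mem ha hb
    | single i u => rw [oreSum_single]; exact hf i u
  have hm : ∀ i u, UniversalEnvelopingAlgebra.ι k D.c ^ i * envIncl sL u ∈ R := fun i u =>
    ⟨Finsupp.single i u, D.oreSum_single sL i u⟩
  have hc : ∀ x ∈ R, UniversalEnvelopingAlgebra.ι k D.c * x ∈ R :=
    hR (LinearMap.mulLeft k _) fun i u => by
      rw [LinearMap.mulLeft_apply, ← mul_assoc, ← pow_succ']
      exact hm _ _
  have h1 : ∀ i w u, UniversalEnvelopingAlgebra.ι k (sL w) *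
      (UniversalEnvelopingAlgebra.ι k D.c ^ i * envIncl sL u) ∈ R := by
    intro i
    induction i with
    | zero =>
      intro w u
      rw [pow_zero, one_mul, ← envIncl_ι, ← map_mul]
      simpa using hm 0 (UniversalEnvelopingAlgebra.ι k w * u)
    | succ i ih =>
      intro w u
      have e : UniversalEnvelopingAlgebra.ι k (sL (D.der w)) =
          UniversalEnvelopingAlgebra.ι k D.c * UniversalEnvelopingAlgebra.ι k (sL w) -
          UniversalEnvelopingAlgebra.ι k (sL w) * UniversalEnvelopingAlgebra.ι k D.c := by
        rw [hs, D.s_der hφ, LieHom.map_lie, LieRing.of_associative_ring_bracket, hs]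
      have e2 : UniversalEnvelopingAlgebra.ι k (sL w) *
          (UniversalEnvelopingAlgebra.ι k D.c ^ (i + 1) * envIncl sL u) =
          UniversalEnvelopingAlgebra.ι k D.c * (UniversalEnvelopingAlgebra.ι k (sL w) *
            (UniversalEnvelopingAlgebra.ι k D.c ^ i * envIncl sL u)) -
          UniversalEnvelopingAlgebra.ι k (sL (D.der w)) *
            (UniversalEnvelopingAlgebra.ι k D.c ^ i * envIncl sL u) := by
        rw [e, pow_succ']
        noncomm_ring
      rw [e2]
      exact sub_mem (hc _ (ih w u)) (ih _ u)
  have h2 : ∀ v, ∀ x ∈ R, v * x ∈ R := by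
    intro v
    induction v using env_induction with
    | algebraMap c =>
      intro x hx
      rw [← Algebra.smul_def]
      exact R.smul_mem _ hx
    | ι y =>
      intro x hx
      rw [← D.decomp y, map_add, map_smul, add_mul, smul_mul_assoc, ← hs]
      exact add_mem (hR (LinearMap.mulLeft k _) (fun i u => h1 i _ u) x hx)
        (R.smul_mem _ (hc x hx))
    | add x y hx hy => intro z hz; rw [add_mul]; exact add_mem (hx z hz) (hy z hz)
    | mul x y hx hy => intro z hz; rw [mul_assoc]; exact hx _ (hy z hz)
  intro v
  have h1R : (1 : UniversalEnvelopingAlgebra k L) ∈ R := by simpa using hm 0 1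
  exact mul_one v ▸ h2 v 1 h1R

theorem oreSum_bijective : Function.Bijective (D.oreSum sL) :=
  ⟨D.oreSum_injective sL hs hφ, D.oreSum_surjective sL hs hφ⟩

end

variable (hs : ∀ w, sL w = D.s w) (hφ : ∀ y z : L, D.φ ⁅y, z⁆ = 0)

/-- `U(L) ⊗ Λ L'` is the direct sum of the `cⁱ (U(L') ⊗ Λ L')`. -/
def oreTensor : (ℕ →₀ UniversalEnvelopingAlgebra k L' ⊗[k] ExteriorAlgebra k L') ≃ₗ[k]
    UniversalEnvelopingAlgebra k L ⊗[k] ExteriorAlgebra k L' :=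
  (TensorProduct.finsuppLeft k k _ _ _).symm ≪≫ₗ
    TensorProduct.congr (LinearEquiv.ofBijective (D.oreSum sL)
      (D.oreSum_bijective sL hs hφ)) (LinearEquiv.refl k _)

theorem oreTensor_single (i : ℕ) (m : UniversalEnvelopingAlgebra k L' ⊗[k] ExteriorAlgebra k L') :
    D.oreTensor sL hs hφ (Finsupp.single i m) = UniversalEnvelopingAlgebra.ι k D.c ^ i •
      TensorProduct.map (envIncl sL).toLinearMap LinearMap.id m := by
  induction m with
  | zero => simp
  | add x y hx hy => rw [Finsupp.single_add, map_add, map_add, smul_add, hx, hy]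
  | tmul u x =>
    rw [oreTensor, LinearEquiv.trans_apply, TensorProduct.finsuppLeft_symm_apply_single,
      TensorProduct.congr_tmul]
    change D.oreSum sL (Finsupp.single i u) ⊗ₜ x = _
    rw [oreSum_single]
    rfl

/-- The differential is left `U(L)`-linear, so it respects the factors `cⁱ` and the complex is a
direct sum of copies of the one for `L'`. -/
theorem ceD_oreTensor (a : ℕ →₀ UniversalEnvelopingAlgebra k L' ⊗[k] ExteriorAlgebra k L') :
    ceD (envIncl sL) (D.oreTensor sL hs hφ a) = D.oreTensor sL hs hφ
      (a.mapRange (ceD (AlgHom.id k _)) (map_zero _)) := by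
  induction a using Finsupp.induction_linear with
  | zero => simp
  | add a b ha hb =>
    rw [map_add, map_add, ha, hb, Finsupp.mapRange_add (fun x y => map_add _ x y), map_add]
  | single i m =>
    rw [Finsupp.mapRange_single, oreTensor_single, oreTensor_single, map_smul, map_ceD]
    rfl

end LineSplitting

end OreExtension

/-! ### Exactness passes from an ideal of codimension one to the Lie algebra. -/

section Exactness

variable {k : Type u} [Field k] {L : Type u} [LieRing L] [LieAlgebra k L]

section

variable {B : Type u} [Ring B] [Algebra k B]

/-- The augmentation of `B ⊗ Λ L` that is induced by an augmentation of `B`. -/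
def ceAug (ε : B →ₐ[k] k) : B ⊗[k] ExteriorAlgebra k L →ₗ[k] k :=
  LinearMap.mul' k k ∘ₗ TensorProduct.map ε.toLinearMap
    (ExteriorAlgebra.algebraMapInv (R := k) (M := L)).toLinearMap

variable (ε : B →ₐ[k] k)

theorem ceAug_tmul (b : B) (x : ExteriorAlgebra k L) :
    ceAug ε (b ⊗ₜ x) = ε b * ExteriorAlgebra.algebraMapInv x := by
  simp [ceAug]

theorem ceAug_smul (b : B) (m : B ⊗[k] ExteriorAlgebra k L) :
    ceAug ε (b • m) = ε b * ceAug ε m := by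
  induction m with
  | zero => simp
  | tmul c x => rw [smul_tmul', ceAug_tmul, ceAug_tmul, smul_eq_mul, map_mul, mul_assoc]
  | add x y hx hy => rw [smul_add, map_add, map_add, mul_add, hx, hy]

theorem ceAug_ceE (z : L) (m : B ⊗[k] ExteriorAlgebra k L) : ceAug ε (ceE B z m) = 0 := by
  induction m with
  | zero => simp
  | tmul c x => simp [ceE_tmul, ceAug_tmul, ExteriorAlgebra.algebraMapInv]
  | add x y hx hy => rw [map_add, map_add, hx, hy, add_zero]

theorem algebraMapInv_lieAd (z : L) (x : ExteriorAlgebra k L) :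
    ExteriorAlgebra.algebraMapInv (lieAd z x) = 0 := by
  induction x using ext_induction with
  | one => rw [lieAd_one, map_zero]
  | smul c x h => rw [map_smul, map_smul, h, smul_zero]
  | add x y hx hy => rw [map_add, map_add, hx, hy, add_zero]
  | mul z x h => simp [lieAd_ι_mul, ExteriorAlgebra.algebraMapInv]

theorem ceAug_ceD (ψ : UniversalEnvelopingAlgebra k L →ₐ[k] B) (h : ∀ y, ε (envMap ψ y) = 0)
    (m : B ⊗[k] ExteriorAlgebra k L) : ceAug ε (ceD ψ m) = 0 := by
  induction m using ce_induction with
  | one => simp [ceD_tmul, ceOne_one]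
  | zero => simp
  | smul b m h => rw [map_smul, ceAug_smul, h, mul_zero]
  | add x y hx hy => rw [map_add, map_add, hx, hy, add_zero]
  | mul z m h' =>
    rw [ceD_ceE, map_sub, ceAug_ceE, sub_zero]
    clear h'
    induction m with
    | zero => simp
    | tmul b x => simp [ceT_tmul, ceAug_tmul, h, algebraMapInv_lieAd]
    | add x y hx hy => rw [map_add, map_add, hx, hy, add_zero]

end

variable (k L) in
/-- The augmentation of the enveloping algebra. -/
abbrev envAug : UniversalEnvelopingAlgebra k L →ₐ[k] k := UniversalEnvelopingAlgebra.lift k 0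

theorem envAug_ι (y : L) : envAug k L (UniversalEnvelopingAlgebra.ι k y) = 0 := by
  rw [UniversalEnvelopingAlgebra.lift_ι_apply]
  rfl

theorem ceAug_ceD_id (m : UniversalEnvelopingAlgebra k L ⊗[k] ExteriorAlgebra k L) :
    ceAug (envAug k L) (ceD (AlgHom.id k _) m) = 0 :=
  ceAug_ceD _ _ (fun y => envAug_ι y) m

variable (k L) in
/-- The complex `U(L) ⊗ Λ L` is a resolution of the trivial module. -/
def CeExact : Prop :=
  ∀ m : UniversalEnvelopingAlgebra k L ⊗[k] ExteriorAlgebra k L, ceD (AlgHom.id k _) m = 0 →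
    ∃ (m' : UniversalEnvelopingAlgebra k L ⊗[k] ExteriorAlgebra k L) (c : k),
      m = ceD (AlgHom.id k _) m' + c • (1 ⊗ₜ 1)

theorem ceExact_of_subsingleton [Subsingleton L] : CeExact k L := by
  have hU : ∀ u : UniversalEnvelopingAlgebra k L, ∃ c, algebraMap k _ c = u := fun u => by
    induction u using env_induction with
    | algebraMap c => exact ⟨c, rfl⟩
    | ι y => exact ⟨0, by rw [Subsingleton.elim y 0, map_zero, map_zero]⟩
    | add x y hx hy =>
      obtain ⟨a, rfl⟩ := hx
      obtain ⟨b, rfl⟩ := hy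
      exact ⟨a + b, map_add _ _ _⟩
    | mul x y hx hy =>
      obtain ⟨a, rfl⟩ := hx
      obtain ⟨b, rfl⟩ := hy
      exact ⟨a * b, map_mul _ _ _⟩
  have h : ∀ m : UniversalEnvelopingAlgebra k L ⊗[k] ExteriorAlgebra k L,
      ∃ c : k, m = c • (1 ⊗ₜ 1) := fun m => by
    induction m using ce_induction with
    | one => exact ⟨1, (one_smul _ _).symm⟩
    | zero => exact ⟨0, (zero_smul _ _).symm⟩
    | smul b m h =>
      obtain ⟨c, rfl⟩ := h
      obtain ⟨a, rfl⟩ := hU b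
      exact ⟨a * c, by rw [algebraMap_smul, smul_smul]⟩
    | add x y hx hy =>
      obtain ⟨a, rfl⟩ := hx
      obtain ⟨b, rfl⟩ := hy
      exact ⟨a + b, (add_smul _ _ _).symm⟩
    | mul z m _ =>
      exact ⟨0, by rw [Subsingleton.elim z 0, LineSplitting.ceE_zero, zero_smul]⟩
  intro m _
  obtain ⟨c, hc⟩ := h m
  exact ⟨0, c, by rw [map_zero, zero_add, hc]⟩

variable {L' : Type u} [LieRing L'] [LieAlgebra k L'] (D : LineSplitting k L L')
  (sL : L' →ₗ⁅k⁆ L)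

namespace LineSplitting

/-- `T_c` preserves `U(L) ⊗ Λ L'`. -/
theorem exists_ceT_c_sB (hφ : ∀ y z : L, D.φ ⁅y, z⁆ = 0)
    (b : UniversalEnvelopingAlgebra k L ⊗[k] ExteriorAlgebra k L') :
    ∃ b', ceT (AlgHom.id k _) D.c (D.sB _ b) = D.sB _ b' := by
  have h : ∀ x, ∃ x', lieAd D.c (ExteriorAlgebra.map D.s x) = ExteriorAlgebra.map D.s x' := by
    intro x
    induction x using ext_induction with
    | one => exact ⟨0, by rw [map_one, lieAd_one, map_zero]⟩
    | smul c x h =>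
      obtain ⟨x', h⟩ := h
      exact ⟨c • x', by rw [map_smul, map_smul, map_smul, h]⟩
    | add x y hx hy =>
      obtain ⟨x', hx⟩ := hx
      obtain ⟨y', hy⟩ := hy
      exact ⟨x' + y', by rw [map_add, map_add, map_add, hx, hy]⟩
    | mul z x h =>
      obtain ⟨x', h⟩ := h
      refine ⟨ExteriorAlgebra.ι k (D.der z) * x + ExteriorAlgebra.ι k z * x', ?_⟩
      rw [map_mul, ExteriorAlgebra.map_apply_ι, lieAd_ι_mul, h, ← D.s_der hφ]
      simp
  induction b with
  | zero => exact ⟨0, by simp⟩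
  | tmul u x =>
    obtain ⟨x', h⟩ := h x
    exact ⟨(u * envMap (AlgHom.id k _) D.c) ⊗ₜ x - u ⊗ₜ x', by
      rw [extB_tmul, ceT_tmul, h, map_sub, extB_tmul, extB_tmul]⟩
  | add x y hx hy =>
    obtain ⟨x', hx⟩ := hx
    obtain ⟨y', hy⟩ := hy
    exact ⟨x' + y', by rw [map_add, map_add, map_add, hx, hy]⟩

variable (hs : ∀ w, sL w = D.s w) (hφ : ∀ y z : L, D.φ ⁅y, z⁆ = 0)
include hs hφ

/-- Each copy `cⁱ (U(L') ⊗ Λ L')` contributes `k cⁱ` to the homology. With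
`eq_zero_of_aeval_tmul_eq_ceD` this says that the homology of `U(L) ⊗ Λ L'` is `k[c]`. -/
theorem exists_of_ceD_envIncl_eq_zero (h : CeExact k L')
    (m : UniversalEnvelopingAlgebra k L ⊗[k] ExteriorAlgebra k L')
    (hm : ceD (envIncl sL) m = 0) : ∃ (m' : _) (P : Polynomial k), m = ceD (envIncl sL) m' +
      (Polynomial.aeval (UniversalEnvelopingAlgebra.ι k D.c) P) ⊗ₜ 1 := by
  obtain ⟨a, rfl⟩ := (D.oreTensor sL hs hφ).surjective m
  rw [ceD_oreTensor, LinearEquiv.map_eq_zero_iff] at hm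
  have ha : ∀ i, ceD (AlgHom.id k _) (a i) = 0 := fun i => DFunLike.congr_fun hm i
  choose m' c h' using fun i => h (a i) (ha i)
  refine ⟨∑ i ∈ a.support, D.oreTensor sL hs hφ (Finsupp.single i (m' i)),
    ∑ i ∈ a.support, Polynomial.monomial i (c i), ?_⟩
  rw [map_sum, map_sum, sum_tmul, ← Finset.sum_add_distrib]
  conv_lhs => rw [← a.sum_single, Finsupp.sum, map_sum]
  refine Finset.sum_congr rfl fun i _ => ?_
  rw [ceD_oreTensor, Finsupp.mapRange_single, Polynomial.aeval_monomial]
  conv_lhs => rw [h' i, Finsupp.single_add, map_add]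
  congr 1
  rw [oreTensor_single, map_smul, TensorProduct.map_tmul, AlgHom.toLinearMap_apply, map_one,
    smul_comm, smul_tmul', smul_eq_mul, mul_one, LinearMap.id_apply, smul_tmul', Algebra.smul_def]

theorem eq_zero_of_aeval_tmul_eq_ceD
    (m : UniversalEnvelopingAlgebra k L ⊗[k] ExteriorAlgebra k L') (P : Polynomial k)
    (hm : (Polynomial.aeval (UniversalEnvelopingAlgebra.ι k D.c) P) ⊗ₜ 1 = ceD (envIncl sL) m) :
    P = 0 := by
  obtain ⟨a, rfl⟩ := (D.oreTensor sL hs hφ).surjective m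
  let b : ℕ →₀ UniversalEnvelopingAlgebra k L' ⊗[k] ExteriorAlgebra k L' :=
    ∑ i ∈ P.support, Finsupp.single i (P.coeff i • (1 ⊗ₜ 1))
  have hb : D.oreTensor sL hs hφ b =
      (Polynomial.aeval (UniversalEnvelopingAlgebra.ι k D.c) P) ⊗ₜ 1 := by
    conv_rhs => rw [P.as_sum_support, map_sum, sum_tmul]
    rw [map_sum]
    refine Finset.sum_congr rfl fun i _ => ?_
    rw [Polynomial.aeval_monomial, oreTensor_single, map_smul, TensorProduct.map_tmul,
      AlgHom.toLinearMap_apply, map_one,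
      smul_comm, smul_tmul', smul_eq_mul, mul_one, LinearMap.id_apply, smul_tmul',
      Algebra.smul_def]
  rw [← hb, ceD_oreTensor, EmbeddingLike.apply_eq_iff_eq] at hm
  ext j
  have h1 : b j = P.coeff j • (1 ⊗ₜ 1) := by
    rw [Finsupp.finsetSum_apply]
    simp only [Finsupp.single_apply]
    rw [Finset.sum_ite_eq' P.support j]
    split_ifs with h
    · rfl
    · rw [Polynomial.notMem_support_iff.1 h, zero_smul]
  -- The augmentation of `U(L')` kills boundaries and reads off the coefficient of `cʲ`.
  have h2 := congrArg (ceAug (envAug k L')) (DFunLike.congr_fun hm j)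
  rw [Finsupp.mapRange_apply, ceAug_ceD_id, h1, map_smul, ceAug_tmul] at h2
  simpa using h2

/-- Exactness for an ideal of codimension one implies exactness for the whole Lie algebra. -/
theorem ceExact (h : CeExact k L') : CeExact k L := by
  set d := ceD (AlgHom.id k (UniversalEnvelopingAlgebra k L)) with hd
  set d' := ceD (envIncl sL) with hd'
  set x := UniversalEnvelopingAlgebra.ι k D.c with hx
  have hsd : ∀ m, D.sB _ (d' m) = d (D.sB _ m) :=
    extB_ceD (fun y z => by rw [← hs, ← hs, ← hs, LieHom.map_lie])
      (fun y => by rw [envMap, envMap, envIncl_ι, hs, AlgHom.id_apply])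
  have hEd : ∀ m, d (ceE _ D.c (D.sB _ m)) =
      ceT (AlgHom.id k _) D.c (D.sB _ m) - ceE _ D.c (D.sB _ (d' m)) := fun m => by
    rw [hsd]; exact ceD_ceE _ _ _
  have hx1 : ∀ u : UniversalEnvelopingAlgebra k L, D.sB _ (u ⊗ₜ[k] 1) = u ⊗ₜ 1 := fun u => by
    rw [extB_tmul, map_one]
  have hT : ∀ u : UniversalEnvelopingAlgebra k L,
      ceT (AlgHom.id k _) D.c (u ⊗ₜ[k] 1) = (u * x) ⊗ₜ 1 := fun u => by
    rw [ceT_tmul, lieAd_one, tmul_zero, sub_zero]; rfl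
  have hd1 : ∀ u : UniversalEnvelopingAlgebra k L, d' (u ⊗ₜ[k] 1) = 0 := fun u => by
    rw [hd', ceD_tmul, ceOne_one, smul_zero]
  have hinj : ∀ m m', D.sB (UniversalEnvelopingAlgebra k L) m = D.sB _ m' → m = m' :=
    fun m m' e => by rw [← D.rB_sB m, e, rB_sB]
  intro m hm
  obtain ⟨a, b, rfl⟩ : ∃ a b, m = D.sB _ a + ceE _ D.c (D.sB _ b) :=
    ⟨_, _, (D.decomp_tensor m).symm⟩
  obtain ⟨b', hb'⟩ := D.exists_ceT_c_sB hφ b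
  -- The cone structure: `m = a + c ∧ b` is a cycle exactly when `d' b = 0` and `d' a + T_c b = 0`.
  have h0 : D.sB _ (d' a + b') + ceE _ D.c (D.sB _ (- d' b)) = 0 := by
    rw [← hm, map_add, map_add d, hEd, hb', hsd, map_neg, map_neg]
    abel
  obtain ⟨h1, h2⟩ := D.eq_zero_of_add_eq_zero h0
  obtain ⟨β, P, hβ⟩ := D.exists_of_ceD_envIncl_eq_zero sL hs hφ h b (neg_eq_zero.1 h2)
  obtain ⟨β', hβ'⟩ := D.exists_ceT_c_sB hφ β
  -- The Lie derivative along `c` commutes with the differential and is right multiplication by `c`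
  -- in degree zero.
  have h3 : b' = d' β' + Polynomial.aeval x (P * Polynomial.X) ⊗ₜ 1 := by
    apply hinj
    rw [← hb', hβ, map_add, map_add, hsd, map_add, hsd, hx1, hx1, hT, map_mul, Polynomial.aeval_X,
      ← hβ']
    congr 1
    exact (ceD_ceT _ _ _).symm
  -- Multiplication by `c` is injective on the homology `k[c]`: here `P(c) c` is a boundary.
  have hP : P = 0 := by
    have := D.eq_zero_of_aeval_tmul_eq_ceD sL hs hφ (- a - β') (P * Polynomial.X) (by
      rw [map_sub, map_neg, ← hd', ← hx, eq_sub_iff_add_eq, eq_neg_iff_add_eq_zero, ← h1, h3]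
      abel)
    simpa using this
  rw [hP, map_zero, zero_tmul, add_zero] at hβ
  -- Now `b` is the boundary of `β`, so the part of the cycle involving `c` can be removed up to a
  -- boundary.
  have h4 : D.sB _ a + ceE _ D.c (D.sB _ b) = D.sB _ (a + β') - d (ceE _ D.c (D.sB _ β)) := by
    rw [hEd, hβ', hβ, map_add]
    abel
  have h5 : d' (a + β') = 0 := by
    rw [map_add, ← h1, h3, hP, zero_mul, map_zero, zero_tmul, add_zero]
  obtain ⟨α, Q, hα⟩ := D.exists_of_ceD_envIncl_eq_zero sL hs hφ h _ h5
  refine ⟨D.sB _ α - ceE _ D.c (D.sB _ β) +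
    ceE _ D.c (D.sB _ (Polynomial.aeval x Q.divX ⊗ₜ 1)), Q.coeff 0, ?_⟩
  -- The cokernel of multiplication by `c` on `k[c]` is `k`: the multiple of `c` is the boundary of
  -- `c ∧ Q.divX(c)`.
  have h6 : (Polynomial.aeval x Q) ⊗ₜ[k] (1 : ExteriorAlgebra k L) =
      (Polynomial.aeval x Q.divX * x) ⊗ₜ 1 + Q.coeff 0 • (1 ⊗ₜ 1) := by
    conv_lhs => rw [← Q.divX_mul_X_add]
    rw [map_add, map_mul, Polynomial.aeval_X, Polynomial.aeval_C, add_tmul,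
      Algebra.algebraMap_eq_smul_one, smul_tmul']
  rw [h4, hα, map_add, map_add, map_sub, hEd (Polynomial.aeval x Q.divX ⊗ₜ 1), hd1, hx1, hx1, hT,
    map_zero, map_zero, sub_zero, hsd, h6]
  abel

end LineSplitting

end Exactness

/-! ### The Chevalley–Eilenberg resolution of the trivial module. -/

section Resolution

open Limits

variable {k : Type u} [Field k] {L : Type u} [LieRing L] [LieAlgebra k L]

/-- The derived algebra is proper, so a nonzero linear form kills it; its kernel is an ideal of
codimension one. -/
theorem exists_linearMap_of_isSolvable [Nontrivial L] [LieAlgebra.IsSolvable L] :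
    ∃ (φ : L →ₗ[k] k) (c : L), φ c = 1 ∧ ∀ y z : L, φ ⁅y, z⁆ = 0 := by
  have h := LieAlgebra.derivedSeries_lt_top_of_solvable (R := k) (L := L)
  have h' : (LieAlgebra.derivedSeries k L 1).toSubmodule ≠ ⊤ := fun e =>
    h.ne (LieSubmodule.toSubmodule_injective e)
  obtain ⟨φ, hφ, h0⟩ := Submodule.exists_le_ker_of_lt_top _ h'.lt_top
  obtain ⟨c, hc⟩ : ∃ c, φ c ≠ 0 := by
    by_contra! hc
    exact hφ (LinearMap.ext hc)
  refine ⟨(φ c)⁻¹ • φ, c, by simp [hc], fun y z => ?_⟩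
  have : φ ⁅y, z⁆ = 0 :=
    h0 (LieSubmodule.lie_mem_lie (LieSubmodule.mem_top y) (LieSubmodule.mem_top z))
  simp [this]

/-- The splitting given by the kernel of a linear form. -/
def LineSplitting.ofKer {V : Type*} [AddCommGroup V] [Module k V] (φ : V →ₗ[k] k) (c : V)
    (hc : φ c = 1) (W : Submodule k V) (hW : ∀ v, v ∈ W ↔ φ v = 0) : LineSplitting k V W where
  s := W.subtype
  r := LinearMap.codRestrict W (LinearMap.id - φ.smulRight c) fun v => by simp [hW, hc]
  φ := φ
  c := c
  r_s w := Subtype.ext (by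
    change w.1 - φ w.1 • c = w.1
    rw [(hW w).1 w.2, zero_smul, sub_zero])
  φ_s w := (hW w).1 w.2
  r_c := Subtype.ext (by
    change c - φ c • c = 0
    rw [hc, one_smul, sub_self])
  φ_c := hc
  decomp v := by
    change v - φ v • c + φ v • c = v
    rw [sub_add_cancel]

theorem ceExact_of_isNilpotent (n : ℕ) : ∀ (L : Type u) [LieRing L] [LieAlgebra k L]
    [LieRing.IsNilpotent L] [Module.Finite k L], Module.finrank k L = n → CeExact k L := by
  induction n with
  | zero =>
    intro L _ _ _ _ h
    have := Module.finrank_zero_iff.1 h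
    exact ceExact_of_subsingleton
  | succ n ih =>
    intro L _ _ _ _ h
    have : Nontrivial L := Module.nontrivial_of_finrank_pos (R := k) (by omega)
    obtain ⟨φ, c, hc, hφ⟩ := exists_linearMap_of_isSolvable (k := k) (L := L)
    let I : LieSubalgebra k L :=
      { LinearMap.ker φ with lie_mem' := fun {y z} _ _ => hφ y z }
    let D : LineSplitting k L I := LineSplitting.ofKer φ c hc I.toSubmodule fun v => Iff.rfl
    have : LieRing.IsNilpotent I :=
      Function.Injective.lieAlgebra_isNilpotent (R := k) (f := I.incl) Subtype.val_injective
    have hI : Module.finrank k I = n := by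
      have h1 := LinearMap.finrank_range_add_finrank_ker φ
      have h2 : LinearMap.range φ = ⊤ := LinearMap.range_eq_top.2 fun a => ⟨a • c, by simp [hc]⟩
      rw [h2, finrank_top, Module.finrank_self, h] at h1
      change Module.finrank k (LinearMap.ker φ) = n
      omega
    exact D.ceExact I.incl (fun _ => rfl) hφ (ih I hI)

section

variable {B : Type u} [Ring B] [Algebra k B]

/-- The projection of `B ⊗ Λ L` onto the component of degree `p`. -/
def ceProj (p : ℕ) : B ⊗[k] ExteriorAlgebra k L →ₗ[B] B ⊗[k] ExteriorAlgebra k L :=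
  LinearMap.baseChange B (GradedAlgebra.proj (fun i : ℕ => ⋀[k]^i L) p)

theorem ceProj_tmul (p : ℕ) (b : B) (x : ExteriorAlgebra k L) : ceProj p (b ⊗ₜ[k] x) =
    b ⊗ₜ GradedAlgebra.proj (fun i : ℕ => ⋀[k]^i L) p x := rfl

theorem ceProj_mem (p : ℕ) (m : B ⊗[k] ExteriorAlgebra k L) :
    ceProj p m ∈ (⋀[k]^p L).baseChange B := by
  induction m with
  | zero => simp
  | tmul b x =>
    rw [ceProj_tmul, GradedAlgebra.proj_apply]
    exact Submodule.tmul_mem_baseChange_of_mem _ (SetLike.coe_mem _)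
  | add x y hx hy => rw [map_add]; exact add_mem hx hy

theorem ceProj_of_mem (p : ℕ) : ∀ m ∈ (⋀[k]^p L).baseChange B, ceProj p m = m :=
  baseChange_induction (map_zero _) (fun x y hx hy => by rw [map_add, hx, hy]) fun b x hx => by
    rw [ceProj_tmul, GradedAlgebra.proj_apply,
      DirectSum.decompose_of_mem_same (fun i : ℕ => ⋀[k]^i L) hx]

theorem ceProj_of_mem_ne {p q : ℕ} (h : q ≠ p) : ∀ m ∈ (⋀[k]^q L).baseChange B,
    ceProj p m = 0 :=
  baseChange_induction (map_zero _) (fun x y hx hy => by rw [map_add, hx, hy, add_zero])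
    fun b x hx => by
      rw [ceProj_tmul, GradedAlgebra.proj_apply,
        DirectSum.decompose_of_mem_ne (fun i : ℕ => ⋀[k]^i L) hx h, tmul_zero]

/-- `CeExact` ignores the grading; projecting a preimage to one degree makes it homogeneous. -/
theorem ceD_ceProj (ψ : UniversalEnvelopingAlgebra k L →ₐ[k] B) (p : ℕ)
    (m : B ⊗[k] ExteriorAlgebra k L) : ceD ψ (ceProj (p + 1) m) = ceProj p (ceD ψ m) := by
  induction m with
  | zero => simp
  | add x y hx hy => simp only [map_add, hx, hy]
  | tmul b x =>
    induction x using DirectSum.Decomposition.inductionOn (fun i : ℕ => ⋀[k]^i L) with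
    | zero => simp
    | add x y hx hy => rw [tmul_add]; simp only [map_add, hx, hy]
    | @homogeneous q x =>
      have hx : b ⊗ₜ[k] x.1 ∈ (⋀[k]^q L).baseChange B :=
        Submodule.tmul_mem_baseChange_of_mem _ x.2
      rcases eq_or_ne q (p + 1) with rfl | hq
      · rw [ceProj_of_mem _ _ hx, ceProj_of_mem _ _ (ceD_mem ψ p _ hx)]
      · rw [ceProj_of_mem_ne hq _ hx, map_zero]
        rcases q with _ | q
        · rw [ceD_zero ψ _ hx, map_zero]
        · rw [ceProj_of_mem_ne (by omega) _ (ceD_mem ψ q _ hx)]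

theorem ceAug_of_mem (ε : B →ₐ[k] k) (p : ℕ) : ∀ m ∈ (⋀[k]^(p + 1) L).baseChange B,
    ceAug ε m = 0 :=
  baseChange_induction (map_zero _) (fun x y hx hy => by rw [map_add, hx, hy, add_zero])
    fun b x hx => by
      have := algHom_mem_pow (ExteriorAlgebra.algebraMapInv (R := k) (M := L)) ⊥
        (fun v => by simp [ExteriorAlgebra.algebraMapInv]) (p + 1) x hx
      rw [pow_succ, Submodule.mul_bot, Submodule.mem_bot] at this
      rw [ceAug_tmul, this, mul_zero]

theorem ceAug_of_mem_extZ (ε : B →ₐ[k] k) {i : ℤ} (hi : i ≠ 0) :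
    ∀ m ∈ (extZ (k := k) L i).baseChange B, ceAug ε m = 0 := by
  rcases zGrading_cases (i := i) with ⟨_ | p, rfl⟩ | hi
  · simp at hi
  · rw [extZ, zGrading_neg]
    exact ceAug_of_mem ε p
  · rw [extZ_pos L hi, Submodule.baseChange_bot]
    simp

/-- The kernel of the augmentation. -/
def ceAugKer (ε : B →ₐ[k] k) : Submodule B (B ⊗[k] ExteriorAlgebra k L) where
  carrier := {m | ceAug ε m = 0}
  zero_mem' := map_zero _
  add_mem' {x y} (hx : _ = 0) (hy : _ = 0) := by
    change ceAug ε (x + y) = 0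
    rw [map_add, hx, hy, add_zero]
  smul_mem' b m (hm : _ = 0) := by
    change ceAug ε (b • m) = 0
    rw [ceAug_smul, hm, mul_zero]

end

variable (k L) in
/-- The trivial module over the enveloping algebra. -/
def trivMod : ModuleCat.{u} (UniversalEnvelopingAlgebra k L) :=
  (ModuleCat.restrictScalars (envAug k L).toRingHom).obj (ModuleCat.of k k)

/-- The Chevalley–Eilenberg complex of a finite-dimensional nilpotent Lie algebra is a resolution
of the trivial module. -/
theorem nonempty_ceCochain_iso_single [Module.Finite k L] [LieRing.IsNilpotent L] :
    Nonempty (DerivedCategory.Q.obj (ceCochain (AlgHom.id k (UniversalEnvelopingAlgebra k L))) ≅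
      (DerivedCategory.singleFunctor (ModuleCat.{u} (UniversalEnvelopingAlgebra k L)) 0).obj
        (trivMod k L)) := by
  let S := UniversalEnvelopingAlgebra k L
  let ψ := AlgHom.id k S
  let ε := envAug k L
  let G : ℤ → Submodule S (S ⊗[k] ExteriorAlgebra k L) := fun i => (extZ L i).baseChange S
  -- The kernel of the augmentation to `k`; outside degree 0 the augmentation vanishes and `H i = G
  -- i`. Once this subcomplex is acyclic, the augmentation is a quasi-isomorphism.
  let H : ℤ → Submodule S (S ⊗[k] ExteriorAlgebra k L) := fun i => G i ⊓ ceAugKer ε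
  have hH : ∀ i, ∀ m ∈ H i, ceD ψ m ∈ H (i + 1) := fun i m hm =>
    ⟨ceD_extZ ψ i m hm.1, ceAug_ceD_id m⟩
  have hac : (gradedCx H (ceD ψ) hH (ceD_ceD ψ)).Acyclic := by
    refine gradedCx_acyclic fun i m hm hd => ?_
    rcases zGrading_cases (i := i) with ⟨p, rfl⟩ | hi
    · obtain ⟨m', c, hc⟩ := ceExact_of_isNilpotent _ L rfl m hd
      have hm1 : m ∈ (⋀[k]^p L).baseChange S := by
        have := hm.1
        simp only [G, extZ, zGrading_neg] at this
        exact this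
      have hm2 : ceAug ε m = 0 := hm.2
      -- The augmentation kills `m` and all boundaries, so it kills `c • (1 ⊗ 1)`, whose value is
      -- `c`.
      have hc0 : c = 0 := by
        rw [hc, map_add, ceAug_ceD_id, map_smul, ceAug_tmul] at hm2
        simpa using hm2
      rw [hc0, zero_smul, add_zero] at hc
      refine ⟨ceProj (p + 1) m', ⟨?_, ceAug_of_mem _ p _ (ceProj_mem _ _)⟩, ?_⟩
      · have := ceProj_mem (p + 1) m'
        simp only [G, show (-(p : ℤ) - 1) = -((p + 1 : ℕ) : ℤ) by push_cast; ring, extZ,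
          zGrading_neg]
        exact this
      · rw [ceD_ceProj, ← hc, ceProj_of_mem _ _ hm1]
    · have h := hm.1
      simp only [G, extZ_pos L hi, Submodule.baseChange_bot] at h
      exact ⟨0, zero_mem _, by rw [h, map_zero]⟩
  let C := ceCochain ψ
  let T := (HomologicalComplex.single (ModuleCat.{u} S) (ComplexShape.up ℤ) 0).obj (trivMod k L)
  let aug : G 0 →ₗ[S] trivMod k L :=
    { toFun := fun m => (ceAug ε m.1 : k)
      map_add' := fun x y => map_add (ceAug ε) x.1 y.1
      map_smul' := fun b m => ceAug_smul ε b m.1 }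
  let augH : C.X 0 ⟶ trivMod k L := ModuleCat.ofHom (X := G 0) (Y := trivMod k L) aug
  let e := HomologicalComplex.singleObjXSelf (ComplexShape.up ℤ) 0 (trivMod k L)
  let f : gradedCx H (ceD ψ) hH (ceD_ceD ψ) ⟶ C :=
    gradedCxHom LinearMap.id (fun i m hm => hm.1) fun m => rfl
  let g : C ⟶ T := HomologicalComplex.mkHomToSingle augH fun i hi => by
    obtain rfl : i = -1 := by simp at hi; omega
    have : C.d (-1) 0 = ModuleCat.ofHom ((ceD ψ).restrict (ceD_extZ ψ (-1))) := gradedCx_d (-1)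
    rw [this]
    exact ModuleCat.hom_ext (LinearMap.ext fun x => ceAug_ceD_id x.1)
  have hg : ∀ x : G 0, e.hom (g.f 0 x) = aug x := fun x => by
    have : g.f 0 ≫ e.hom = augH := by
      simp only [g]
      rw [HomologicalComplex.mkHomToSingle_f, Category.assoc, Iso.inv_hom_id, Category.comp_id]
    exact congrArg (fun t => t.hom x) this
  have hinj : Function.Injective e.hom := (ModuleCat.mono_iff_injective _).1 inferInstance
  have hT : ∀ i, i ≠ 0 → Subsingleton (T.X i) := fun i hi =>
    ModuleCat.subsingleton_of_isZero (HomologicalComplex.isZero_single_obj_X _ _ _ _ hi)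
  have w : f ≫ g = 0 := by
    refine HomologicalComplex.hom_ext _ _ fun i => ?_
    rcases eq_or_ne i 0 with rfl | hi
    · refine ModuleCat.hom_ext (LinearMap.ext fun x => hinj ?_)
      change e.hom (g.f 0 (⟨x.1, x.2.1⟩ : G 0)) = e.hom 0
      rw [hg, map_zero]
      exact x.2.2
    · exact (HomologicalComplex.isZero_single_obj_X _ _ _ _ hi).eq_of_tgt _ _
  have hS : (ShortComplex.mk f g w).ShortExact := by
    refine shortExact_of_apply f g w ?_ ?_ ?_
    · intro i x y hxy
      have h : (⟨x.1, x.2.1⟩ : G i) = ⟨y.1, y.2.1⟩ := hxy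
      exact Subtype.ext (congrArg (fun t : G i => t.1) h)
    · intro i
      rcases eq_or_ne i 0 with rfl | hi
      · intro y
        obtain ⟨c, hc⟩ : ∃ c : k, c = e.hom y := ⟨_, rfl⟩
        have h1 : c • ((1 : S) ⊗ₜ[k] (1 : ExteriorAlgebra k L)) ∈ G 0 := by
          refine Submodule.smul_of_tower_mem _ c (Submodule.tmul_mem_baseChange_of_mem _ ?_)
          change (1 : ExteriorAlgebra k L) ∈ zGrading _ (-((0 : ℕ) : ℤ))
          rw [zGrading_neg, ExteriorAlgebra.exteriorPower, pow_zero]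
          exact Submodule.one_le.1 le_rfl
        refine ⟨(⟨_, h1⟩ : G 0), hinj ?_⟩
        rw [hg, ← hc]
        have : ceAug ε (c • ((1 : S) ⊗ₜ[k] (1 : ExteriorAlgebra k L))) = c := by
          rw [map_smul, ceAug_tmul]
          simp
        exact this
      · have := hT i hi
        exact fun y => ⟨0, Subsingleton.elim _ _⟩
    · intro i x hx
      refine ⟨⟨x.1, x.2, ?_⟩, rfl⟩
      rcases eq_or_ne i 0 with rfl | hi
      · have := hg x
        rw [hx, map_zero] at this
        exact this.symm
      · exact ceAug_of_mem_extZ ε hi _ x.2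
  have : QuasiIso g := quasiIso_g_of_acyclic hS hac
  have : IsIso (DerivedCategory.Q.map g) := (DerivedCategory.isIso_Q_map_iff_quasiIso _ g).2 this
  let i := asIso (DerivedCategory.Q.map g)
  exact ⟨i⟩

end Resolution

/-! ### The lower central series and finiteness of nilpotent Lie algebras. -/

section LowerCentralSeries

open LieModule

variable {k : Type u} [Field k] {L : Type u} [LieRing L] [LieAlgebra k L]

theorem lie_mem_lcs_succ (y : L) {w : L} {i : ℕ} (hw : w ∈ lowerCentralSeries k L L i) :
    ⁅y, w⁆ ∈ lowerCentralSeries k L L (i + 1) := by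
  rw [lowerCentralSeries_succ]
  exact LieSubmodule.lie_mem_lie (LieSubmodule.mem_top y) hw

theorem lie_mem_lcs_one (y z : L) : ⁅y, z⁆ ∈ lowerCentralSeries k L L 1 :=
  lie_mem_lcs_succ y (i := 0) (by simp)

theorem lcs_succ_induction {i : ℕ} {P : L → Prop} (zero : P 0) (add : ∀ x y, P x → P y → P (x + y))
    (smul : ∀ (c : k) x, P x → P (c • x))
    (lie : ∀ y : L, ∀ w ∈ lowerCentralSeries k L L i, P ⁅y, w⁆) :
    ∀ z ∈ lowerCentralSeries k L L (i + 1), P z := by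
  intro z hz
  rw [lowerCentralSeries_succ, ← LieSubmodule.mem_toSubmodule,
    LieSubmodule.lieIdeal_oper_eq_linear_span'] at hz
  induction hz using Submodule.span_induction with
  | mem x hx =>
    obtain ⟨y, -, w, hw, rfl⟩ := hx
    exact lie y w hw
  | zero => exact zero
  | add x y _ _ hx hy => exact add x y hx hy
  | smul c x _ hx => exact smul c x hx

/-- By Jacobi, bracketing with `[a, b]` amounts to bracketing twice. -/
theorem lie_lcs_one_mem (i : ℕ) : ∀ z ∈ lowerCentralSeries k L L 1,
    ∀ w ∈ lowerCentralSeries k L L i, ⁅z, w⁆ ∈ lowerCentralSeries k L L (i + 2) := by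
  refine lcs_succ_induction ?_ ?_ ?_ ?_
  · intro w _
    rw [zero_lie]
    exact zero_mem _
  · intro x y hx hy w hw
    rw [add_lie]
    exact add_mem (hx w hw) (hy w hw)
  · intro c x hx w hw
    rw [smul_lie]
    exact SMulMemClass.smul_mem c (hx w hw)
  · intro a b _ w hw
    rw [lie_lie]
    exact sub_mem (lie_mem_lcs_succ _ (lie_mem_lcs_succ _ hw))
      (lie_mem_lcs_succ _ (lie_mem_lcs_succ _ hw))

/-- A nilpotent Lie algebra with finite-dimensional abelianization is finite-dimensional. -/
theorem finite_of_isNilpotent [LieRing.IsNilpotent L] (V : Submodule k L) (hV : V.FG)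
    (h : V ⊔ (lowerCentralSeries k L L 1).toSubmodule = ⊤) : Module.Finite k L := by
  have h1 : ∀ y : L, ∃ v ∈ V, ∃ z ∈ lowerCentralSeries k L L 1, v + z = y := fun y =>
    Submodule.mem_sup.1 (h ▸ Submodule.mem_top (x := y))
  have h2 : ∀ i, ∃ W : Submodule k L, W.FG ∧ ∀ y ∈ lowerCentralSeries k L L i,
      y ∈ W ⊔ (lowerCentralSeries k L L (i + 1)).toSubmodule := by
    intro i
    induction i with
    | zero => exact ⟨V, hV, fun y _ => h ▸ Submodule.mem_top⟩
    | succ i ih =>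
      obtain ⟨W, hW, hi⟩ := ih
      -- Modulo the next term, `[y, w]` depends only on `y` modulo the first term and `w` modulo
      -- term `i + 1`, so brackets of `V` with `W` suffice.
      refine ⟨Submodule.map₂ (toEnd k L L : L →ₗ[k] L →ₗ[k] L) V W, hV.map₂ _ hW,
        lcs_succ_induction (zero_mem _) (fun x y hx hy => add_mem hx hy)
          (fun c x hx => Submodule.smul_mem _ c hx) fun y w hw => ?_⟩
      obtain ⟨v, hv, z, hz, rfl⟩ := h1 y
      obtain ⟨a, ha, b, hb, hab⟩ := Submodule.mem_sup.1 (hi w hw)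
      have e : ⁅v + z, w⁆ = ⁅v, a⁆ + (⁅v, b⁆ + ⁅z, w⁆) := by
        rw [add_lie, ← hab, lie_add]
        abel
      rw [e]
      exact Submodule.add_mem_sup (Submodule.apply_mem_map₂ _ hv ha)
        (add_mem (lie_mem_lcs_succ v hb) (lie_lcs_one_mem i z hz w hw))
  have h3 : ∀ i, ∃ W : Submodule k L, W.FG ∧
      W ⊔ (lowerCentralSeries k L L i).toSubmodule = ⊤ := by
    intro i
    induction i with
    | zero => exact ⟨⊥, Submodule.fg_bot, by simp⟩
    | succ i ih =>
      obtain ⟨W, hW, hi⟩ := ih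
      obtain ⟨W', hW', hi'⟩ := h2 i
      refine ⟨W ⊔ W', hW.sup hW', ?_⟩
      rw [eq_top_iff, ← hi, sup_assoc]
      exact sup_le_sup_left hi' _
  obtain ⟨i, hi⟩ := IsNilpotent.nilpotent k L L
  obtain ⟨W, hW, h4⟩ := h3 i
  rw [hi, LieSubmodule.bot_toSubmodule, sup_bot_eq] at h4
  exact ⟨h4 ▸ hW⟩

end LowerCentralSeries

/-! ### The free nilpotent Lie algebra: finiteness and abelianization. -/

section NilpotentFreeStructure

open LieModule

variable {k : Type u} [Field k] {n d : ℕ}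

/-- The generators of the free nilpotent Lie algebra. -/
def nilpGen (i : Fin n) : NilpFree k n d := LieSubmodule.Quotient.mk (FreeLieAlgebra.of k i)

/-- The quotient map from the free Lie algebra. -/
def nilpMk : FreeLieAlgebra k (Fin n) →ₗ⁅k⁆ NilpFree k n d :=
  { (LieSubmodule.Quotient.mk' (lowerCentralSeries k (FreeLieAlgebra k (Fin n))
      (FreeLieAlgebra k (Fin n)) d) : FreeLieAlgebra k (Fin n) →ₗ[k] NilpFree k n d) with
    map_lie' := fun {_ _} => rfl }

theorem nilpMk_surjective : Function.Surjective (nilpMk : _ → NilpFree k n d) :=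
  LieSubmodule.Quotient.surjective_mk' _

theorem nilpFree_lcs : lowerCentralSeries k (NilpFree k n d) (NilpFree k n d) d = ⊥ := by
  rw [← LieIdeal.lowerCentralSeries_map_eq d (f := (nilpMk : _ →ₗ⁅k⁆ NilpFree k n d)) nilpMk_surjective,
    eq_bot_iff,
    LieIdeal.map_le]
  rintro _ ⟨x, hx, rfl⟩
  exact (LieSubmodule.Quotient.mk_eq_zero' (N := lowerCentralSeries k _ _ d)).2 hx

instance : LieRing.IsNilpotent (NilpFree k n d) :=
  (LieModule.isNilpotent_iff k _ _).2 ⟨d, nilpFree_lcs⟩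

/-- The sum contains all brackets, so it is a Lie subalgebra; it contains the generators. -/
theorem nilpFree_span : Submodule.span k (Set.range (nilpGen : Fin n → NilpFree k n d)) ⊔
    (lowerCentralSeries k (NilpFree k n d) (NilpFree k n d) 1).toSubmodule = ⊤ := by
  let S : LieSubalgebra k (NilpFree k n d) :=
    { Submodule.span k (Set.range (nilpGen : Fin n → NilpFree k n d)) ⊔
      (lowerCentralSeries k (NilpFree k n d) (NilpFree k n d) 1).toSubmodule with
      lie_mem' := fun {y z} _ _ => Submodule.mem_sup_right (lie_mem_lcs_one y z) }
  let F : FreeLieAlgebra k (Fin n) →ₗ⁅k⁆ S := FreeLieAlgebra.lift k fun i =>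
    ⟨nilpGen i, Submodule.mem_sup_left (Submodule.subset_span ⟨i, rfl⟩)⟩
  have h : S.incl.comp F = nilpMk := FreeLieAlgebra.hom_ext fun i => by
    rw [LieHom.comp_apply, FreeLieAlgebra.lift_of_apply]
    rfl
  rw [eq_top_iff]
  intro y _
  obtain ⟨x, rfl⟩ := nilpMk_surjective y
  rw [← h]
  exact (F x).2

instance : Module.Finite k (NilpFree k n d) :=
  finite_of_isNilpotent _ (Submodule.fg_span (Set.finite_range _)) nilpFree_span

theorem lieHom_lcs_one {L : Type u} [LieRing L] [LieAlgebra k L] {A : Type u} [AddCommGroup A]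
    [Module k A] (g : L →ₗ[k] A) (hg : ∀ y z : L, g ⁅y, z⁆ = 0) :
    ∀ z ∈ lowerCentralSeries k L L 1, g z = 0 :=
  lcs_succ_induction (map_zero _) (fun x y hx hy => by rw [map_add, hx, hy, add_zero])
    (fun c x hx => by rw [map_smul, hx, smul_zero]) fun y w _ => hg y w

theorem nilpToLie_lie {A : Type u} [CommRing A] [Algebra k A] (f : Fin n → A) (hd : 1 ≤ d)
    (y z : NilpFree k n d) : nilpToLie f hd ⁅y, z⁆ = 0 := by
  rw [LieHom.map_lie, LieRing.of_associative_ring_bracket, mul_comm, sub_self]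

theorem nilpToLie_gen {A : Type u} [CommRing A] [Algebra k A] (f : Fin n → A) (hd : 1 ≤ d)
    (i : Fin n) : nilpToLie f hd (nilpGen (k := k) i) = f i :=
  FreeLieAlgebra.lift_of_apply f i

variable (k n) in
/-- The coordinates with respect to the generators, on the abelianization. -/
def nilpCoord (hd : 1 ≤ d) : NilpFree k n d →ₗ[k] (Fin n → k) :=
  -- The product ring `Fin n → k` serves only as a commutative algebra containing the standard
  -- basis.
  (nilpToLie (k := k) (fun i : Fin n => (Pi.single i 1 : Fin n → k)) hd).toLinearMap

theorem nilpCoord_lie (hd : 1 ≤ d) (y z : NilpFree k n d) : nilpCoord k n hd ⁅y, z⁆ = 0 :=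
  nilpToLie_lie (k := k) (fun i : Fin n => (Pi.single i 1 : Fin n → k)) hd y z

theorem nilpCoord_sum (hd : 1 ≤ d) (c : Fin n → k) :
    nilpCoord k n hd (∑ i, c i • nilpGen i) = c := by
  rw [map_sum]
  have : ∀ i, nilpCoord k n hd (c i • nilpGen i) = Pi.single i (c i) := fun i => by
    rw [map_smul]
    have : nilpCoord k n hd (nilpGen i) = Pi.single i 1 :=
      nilpToLie_gen (k := k) (fun i : Fin n => (Pi.single i 1 : Fin n → k)) hd i
    rw [this, ← Pi.single_smul, smul_eq_mul, mul_one]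
  simp only [this]
  exact Finset.univ_sum_single c

theorem exists_nilpFree_eq (y : NilpFree k n d) : ∃ c : Fin n → k,
    ∃ z ∈ lowerCentralSeries k (NilpFree k n d) (NilpFree k n d) 1,
      y = ∑ i, c i • nilpGen i + z := by
  obtain ⟨v, hv, z, hz, rfl⟩ := Submodule.mem_sup.1
    (nilpFree_span (k := k) (n := n) (d := d) ▸ Submodule.mem_top (x := y))
  obtain ⟨c, rfl⟩ := (Submodule.mem_span_range_iff_exists_fun k).1 hv
  exact ⟨c, z, hz, rfl⟩

theorem nilpCoord_ker (hd : 1 ≤ d) (y : NilpFree k n d) (hy : nilpCoord k n hd y = 0) :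
    y ∈ lowerCentralSeries k (NilpFree k n d) (NilpFree k n d) 1 := by
  obtain ⟨c, z, hz, rfl⟩ := exists_nilpFree_eq y
  rw [map_add, nilpCoord_sum, lieHom_lcs_one (nilpCoord k n hd) (nilpCoord_lie hd) z hz,
    add_zero] at hy
  simpa [hy] using hz

/-- As `A` is commutative, the map to `A` factors through the abelianization. -/
theorem envMap_nilpToAlg {A : Type u} [CommRing A] [Algebra k A] (f : Fin n → A) (hd : 1 ≤ d)
    (y : NilpFree k n d) : envMap (nilpToAlg f hd) y = ∑ i, nilpCoord k n hd y i • f i := by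
  obtain ⟨c, z, hz, rfl⟩ := exists_nilpFree_eq y
  rw [map_add, nilpCoord_sum, lieHom_lcs_one (nilpCoord k n hd) (nilpCoord_lie hd) z hz, add_zero, envMap,
    nilpToAlg, UniversalEnvelopingAlgebra.lift_ι_apply, map_add, map_sum]
  have : nilpToLie f hd z = 0 :=
    lieHom_lcs_one (nilpToLie (k := k) (d := d) f hd).toLinearMap (nilpToLie_lie f hd) z hz
  rw [this, add_zero]
  refine Finset.sum_congr rfl fun i _ => ?_
  rw [map_smul, nilpToLie_gen]

end NilpotentFreeStructure

/-! ### Abelian Lie algebras and Koszul complexes. -/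

section KoszulComparison

variable {k : Type u} [Field k] {L : Type u} [LieRing L] [LieAlgebra k L] {A : Type u} [CommRing A]
  [Algebra k A] {n : ℕ}

/-- The vector of `A^n` with given coordinates in `k`. -/
def coordVec (A : Type u) [CommRing A] [Algebra k A] (χ : L →ₗ[k] (Fin n → k)) :
    L →ₗ[k] (Fin n → A) :=
  LinearMap.compLeft (Algebra.linearMap k A) (Fin n) ∘ₗ χ

theorem coordVec_apply (χ : L →ₗ[k] (Fin n → k)) (y : L) (i : Fin n) :
    coordVec A χ y i = algebraMap k A (χ y i) := rfl

/-- The algebra map `A ⊗ Λ L → Λ A^n` given by coordinates on `L`. -/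
def ceToKoszul (χ : L →ₗ[k] (Fin n → k)) :
    A ⊗[k] ExteriorAlgebra k L →ₐ[A] ExteriorAlgebra A (Fin n → A) :=
  Algebra.TensorProduct.lift (Algebra.ofId A _)
    (ExteriorAlgebra.lift k
      ⟨(ExteriorAlgebra.ι A).restrictScalars k ∘ₗ coordVec A χ, fun _ =>
        ExteriorAlgebra.ι_sq_zero _⟩)
    (fun a _ => Algebra.commutes a _)

theorem ceToKoszul_ι (χ : L →ₗ[k] (Fin n → k)) (y : L) :
    ceToKoszul (A := A) χ (1 ⊗ₜ ExteriorAlgebra.ι k y) = ExteriorAlgebra.ι A (coordVec A χ y) := by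
  refine (Algebra.TensorProduct.lift_tmul _ _ _ _ _).trans ?_
  rw [map_one, one_mul]
  exact ExteriorAlgebra.lift_ι_apply _ _ _ _

theorem ceE_eq_mul (y : L) (m : A ⊗[k] ExteriorAlgebra k L) :
    ceE A y m = (1 ⊗ₜ ExteriorAlgebra.ι k y) * m := by
  induction m with
  | zero => simp
  | tmul b x => rw [ceE_tmul, Algebra.TensorProduct.tmul_mul_tmul, one_mul]
  | add x y hx hy => rw [map_add, mul_add, hx, hy]

theorem ceToKoszul_ceE (χ : L →ₗ[k] (Fin n → k)) (y : L) (m : A ⊗[k] ExteriorAlgebra k L) :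
    ceToKoszul χ (ceE A y m) = ExteriorAlgebra.ι A (coordVec A χ y) * ceToKoszul χ m := by
  rw [ceE_eq_mul, map_mul, ceToKoszul_ι]

theorem ceToKoszul_mem (χ : L →ₗ[k] (Fin n → k)) (p : ℕ) : ∀ m ∈ (⋀[k]^p L).baseChange A,
    ceToKoszul χ m ∈ ⋀[A]^p (Fin n → A) := by
  have h : ∀ p, ∀ x ∈ ⋀[k]^p L, ceToKoszul χ ((1 : A) ⊗ₜ x) ∈ ⋀[A]^p (Fin n → A) := by
    intro p
    induction p with
    | zero =>
      intro x hx
      obtain ⟨c, rfl⟩ := exists_algebraMap_eq_of_mem_exteriorPower_zero hx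
      rw [Algebra.algebraMap_eq_smul_one, tmul_smul, smul_tmul', ← mul_one (c • (1 : A)),
        ← smul_eq_mul, ← smul_tmul', map_smul, ← Algebra.TensorProduct.one_def, map_one,
        ExteriorAlgebra.exteriorPower, pow_zero]
      exact Submodule.smul_mem _ _ (Submodule.one_le.1 le_rfl)
    | succ p ih =>
      intro x hx
      rw [ExteriorAlgebra.exteriorPower, pow_succ'] at hx
      induction hx using Submodule.mul_induction_on' with
      | mem_mul_mem a ha b hb =>
        obtain ⟨v, rfl⟩ := ha
        rw [← ceE_tmul, ceToKoszul_ceE, ExteriorAlgebra.exteriorPower, pow_succ']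
        exact Submodule.mul_mem_mul ⟨_, rfl⟩ (ih b hb)
      | add x _ y _ hx hy => rw [tmul_add, map_add]; exact Submodule.add_mem _ hx hy
  refine baseChange_induction (by simp) (fun x y hx hy => by rw [map_add]; exact add_mem hx hy) ?_
  intro b x hx
  rw [← mul_one b, ← smul_eq_mul, ← smul_tmul', map_smul]
  exact Submodule.smul_mem _ _ (h p x hx)

/-- For abelian `L` the Lie derivative along `y` is multiplication by the image of `y`, and the
Chevalley–Eilenberg recursion becomes that of a contraction. -/
theorem koszulD_ceToKoszul (f : Fin n → A) (χ : L →ₗ[k] (Fin n → k))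
    (ψ : UniversalEnvelopingAlgebra k L →ₐ[k] A) (hψ : ∀ y, envMap ψ y = ∑ i, χ y i • f i)
    (hL : ∀ y z : L, ⁅y, z⁆ = 0) (m : A ⊗[k] ExteriorAlgebra k L) :
    ceToKoszul χ (ceD ψ m) = koszulD f (ceToKoszul χ m) := by
  have hlie : ∀ (y : L) (x : ExteriorAlgebra k L), lieAd y x = 0 := fun y x => by
    induction x using ext_induction with
    | one => exact lieAd_one y
    | smul c x h => rw [map_smul, h, smul_zero]
    | add x y hx hy => rw [map_add, hx, hy, add_zero]
    | mul z x h => rw [lieAd_ι_mul, h, hL, map_zero, zero_mul, mul_zero, add_zero]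
  have hT : ∀ (y : L) m, ceT ψ y m = envMap ψ y • m := fun y m => by
    induction m with
    | zero => simp
    | tmul b x => rw [ceT_tmul, hlie, tmul_zero, sub_zero, smul_tmul', smul_eq_mul, mul_comm]
    | add x y hx hy => rw [map_add, smul_add, hx, hy]
  induction m using ce_induction with
  | one =>
    rw [ceD_tmul, ceOne_one, smul_zero, map_zero, ← Algebra.TensorProduct.one_def, map_one]
    exact (CliffordAlgebra.contractLeft_one (Q := (0 : QuadraticForm A (Fin n → A))) _).symm
  | zero => simp
  | smul b m h => rw [map_smul, map_smul, map_smul, map_smul, h]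
  | add x y hx hy => rw [map_add, map_add, map_add, map_add, hx, hy]
  | mul z m h =>
    rw [ceD_ceE, map_sub, hT, map_smul, ceToKoszul_ceE, ceToKoszul_ceE, h, koszulD_ι_mul, hψ]
    congr 2
    refine Finset.sum_congr rfl fun i _ => ?_
    rw [coordVec_apply, Algebra.smul_def]

/-- The linear map `A^n → A ⊗ Λ L` given by vectors of `L`. -/
def koszulToCeAux (e : Fin n → L) : (Fin n → A) →ₗ[A] A ⊗[k] ExteriorAlgebra k L :=
  Fintype.linearCombination A fun i => 1 ⊗ₜ ExteriorAlgebra.ι k (e i)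

theorem koszulToCeAux_mul (e : Fin n → L) (v : Fin n → A) (m : A ⊗[k] ExteriorAlgebra k L) :
    koszulToCeAux e v * m = ∑ i, v i • ceE A (e i) m := by
  rw [koszulToCeAux, Fintype.linearCombination_apply, Finset.sum_mul]
  exact Finset.sum_congr rfl fun i _ => by rw [ceE_eq_mul, smul_mul_assoc]

/-- Squares of basis vectors vanish and cross terms cancel in pairs; adding one index at a time
avoids dividing by two. -/
theorem koszulToCeAux_sq (e : Fin n → L) (v : Fin n → A) :
    koszulToCeAux (k := k) e v * koszulToCeAux e v = 0 := by
  have h : ∀ s : Finset (Fin n), (∑ i ∈ s, v i • ((1 : A) ⊗ₜ[k] ExteriorAlgebra.ι k (e i))) *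
      (∑ i ∈ s, v i • ((1 : A) ⊗ₜ[k] ExteriorAlgebra.ι k (e i))) = 0 := by
    intro s
    induction s using Finset.induction_on with
    | empty => simp
    | insert a s ha ih =>
      rw [Finset.sum_insert ha, add_mul, mul_add, mul_add, ih, add_zero]
      have h1 : v a • ((1 : A) ⊗ₜ[k] ExteriorAlgebra.ι k (e a)) *
          v a • ((1 : A) ⊗ₜ[k] ExteriorAlgebra.ι k (e a)) = 0 := by
        rw [smul_mul_smul_comm, Algebra.TensorProduct.tmul_mul_tmul, ExteriorAlgebra.ι_sq_zero,
          tmul_zero, smul_zero]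
      rw [h1, zero_add, Finset.mul_sum, Finset.sum_mul, ← Finset.sum_add_distrib]
      refine Finset.sum_eq_zero fun i _ => ?_
      rw [smul_mul_smul_comm, smul_mul_smul_comm, mul_comm (v i), ← smul_add,
        Algebra.TensorProduct.tmul_mul_tmul, Algebra.TensorProduct.tmul_mul_tmul, ← tmul_add,
        ExteriorAlgebra.ι_add_mul_swap, tmul_zero, smul_zero]
  exact h Finset.univ

/-- The algebra map `Λ A^n → A ⊗ Λ L` given by vectors of `L`. -/
def koszulToCe (e : Fin n → L) : ExteriorAlgebra A (Fin n → A) →ₐ[A] A ⊗[k] ExteriorAlgebra k L :=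
  ExteriorAlgebra.lift A ⟨koszulToCeAux e, koszulToCeAux_sq e⟩

theorem koszulToCe_ι (e : Fin n → L) (v : Fin n → A) :
    koszulToCe (k := k) e (ExteriorAlgebra.ι A v) = koszulToCeAux e v :=
  ExteriorAlgebra.lift_ι_apply _ _ _ _

theorem koszulToCe_mem (e : Fin n → L) (p : ℕ) : ∀ x ∈ ⋀[A]^p (Fin n → A),
    koszulToCe e x ∈ (⋀[k]^p L).baseChange A := by
  induction p with
  | zero =>
    intro x hx
    obtain ⟨c, rfl⟩ := exists_algebraMap_eq_of_mem_exteriorPower_zero hx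
    rw [AlgHom.commutes, Algebra.TensorProduct.algebraMap_apply]
    refine Submodule.tmul_mem_baseChange_of_mem _ ?_
    rw [ExteriorAlgebra.exteriorPower, pow_zero]
    exact Submodule.one_le.1 le_rfl
  | succ p ih =>
    intro x hx
    rw [ExteriorAlgebra.exteriorPower, pow_succ'] at hx
    induction hx using Submodule.mul_induction_on' with
    | mem_mul_mem a ha b hb =>
      obtain ⟨v, rfl⟩ := ha
      rw [map_mul, koszulToCe_ι, koszulToCeAux_mul]
      exact Submodule.sum_mem _ fun i _ => Submodule.smul_mem _ _ (ceE_mem _ p _ (ih b hb))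
    | add x _ y _ hx hy => rw [map_add]; exact Submodule.add_mem _ hx hy

theorem coordVec_sum (χ : L →ₗ[k] (Fin n → k)) (y : L) (e : Fin n → L)
    (he : ∑ i, χ y i • e i = y) :
    koszulToCeAux e (coordVec A χ y) = (1 : A) ⊗ₜ[k] ExteriorAlgebra.ι k y := by
  conv_rhs => rw [← he, map_sum, tmul_sum]
  rw [koszulToCeAux, Fintype.linearCombination_apply]
  refine Finset.sum_congr rfl fun i _ => ?_
  rw [coordVec_apply, algebraMap_smul, map_smul, tmul_smul]

/-- For an abelian Lie algebra with basis `e`, the algebras `A ⊗ Λ L` and `Λ A^n` are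
isomorphic. -/
def ceKoszulEquiv (χ : L ≃ₗ[k] (Fin n → k)) :
    (A ⊗[k] ExteriorAlgebra k L) ≃ₐ[A] ExteriorAlgebra A (Fin n → A) :=
  AlgEquiv.ofAlgHom (ceToKoszul χ.toLinearMap) (koszulToCe fun i => χ.symm (Pi.single i 1))
    (ExteriorAlgebra.hom_ext (LinearMap.ext fun v => by
      change ceToKoszul χ.toLinearMap (koszulToCe _ (ExteriorAlgebra.ι A v)) =
        ExteriorAlgebra.ι A v
      rw [koszulToCe_ι, koszulToCeAux, Fintype.linearCombination_apply, map_sum]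
      simp only [map_smul, ceToKoszul_ι]
      simp only [← map_smul, ← map_sum]
      congr 1
      ext j
      rw [Finset.sum_apply]
      simp [coordVec_apply, Pi.single_apply]))
    (Algebra.TensorProduct.ext (by ext) (ExteriorAlgebra.hom_ext (LinearMap.ext fun y => by
      change koszulToCe _ (ceToKoszul χ.toLinearMap (1 ⊗ₜ ExteriorAlgebra.ι k y)) =
        1 ⊗ₜ ExteriorAlgebra.ι k y
      rw [ceToKoszul_ι, koszulToCe_ι, coordVec_sum]
      apply χ.injective
      rw [map_sum]
      simp only [map_smul, LinearEquiv.apply_symm_apply]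
      ext j
      simp [Pi.single_apply])))

theorem koszulD_zero (f : Fin n → A) : ∀ x ∈ ⋀[A]^0 (Fin n → A), koszulD f x = 0 := by
  intro x hx
  obtain ⟨c, rfl⟩ := exists_algebraMap_eq_of_mem_exteriorPower_zero hx
  exact CliffordAlgebra.contractLeft_algebraMap (Q := (0 : QuadraticForm A (Fin n → A))) _ c

/-- The Chevalley–Eilenberg complex of an abelian Lie algebra is a Koszul complex. -/
def ceKoszulIso (f : Fin n → A) (χ : L ≃ₗ[k] (Fin n → k))
    (ψ : UniversalEnvelopingAlgebra k L →ₐ[k] A) (hψ : ∀ y, envMap ψ y = ∑ i, χ y i • f i)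
    (hL : ∀ y z : L, ⁅y, z⁆ = 0) :
    DerivedCategory.Q.obj (ceCochain ψ) ≅ chainToD (koszulComplex f) :=
  DerivedCategory.Q.mapIso (gradedCxIso (ceKoszulEquiv χ).toLinearEquiv
      (fun i m hm => zGrading_map (F := ((ceKoszulEquiv χ).toLinearMap : _ →ₗ[A] _).toAddMonoidHom)
        (ceToKoszul_mem χ.toLinearMap) i m ((zGrading_baseChange L i).ge hm))
      (fun i m hm => (zGrading_baseChange L i).le (zGrading_map
        (F := ((ceKoszulEquiv χ).symm.toLinearMap : _ →ₗ[A] _).toAddMonoidHom)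
        (koszulToCe_mem _) i m hm))
      (koszulD_ceToKoszul f χ.toLinearMap ψ hψ hL) ≪≫
    (gradedChainExtendIso _ _ (koszulD_mem f) (koszulD_zero f) (koszulD_koszulD f)).symm)

end KoszulComparison

/-! ### Equality of the thick and of the localizing subcategories. -/

section ThickLocalizing

open LieModule Limits

variable {k : Type u} [Field k] {A : Type u} [CommRing A] [Algebra k A] {n : ℕ}

/-- The Lie algebra map to a commutative algebra with `y ↦ Σ χ(y)_i f_i`. -/
def coordLie {L : Type u} [LieRing L] [LieAlgebra k L] (χ : L →ₗ[k] (Fin n → k))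
    (hχ : ∀ y z : L, χ ⁅y, z⁆ = 0) (f : Fin n → A) : L →ₗ⁅k⁆ A :=
  { Fintype.linearCombination k f ∘ₗ χ with
    map_lie' := fun {y z} => by
      change Fintype.linearCombination k f (χ ⁅y, z⁆) = _
      rw [hχ, map_zero, LieRing.of_associative_ring_bracket, mul_comm, sub_self] }

/-- The ideal spanned by a central element. -/
def centralIdeal {L : Type u} [LieRing L] [LieAlgebra k L] (c : L) (hc : ∀ y : L, ⁅c, y⁆ = 0) :
    LieIdeal k L :=
  { Submodule.span k {c} with
    lie_mem := fun {y m} hm => by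
      obtain ⟨a, rfl⟩ := Submodule.mem_span_singleton.1 hm
      rw [lie_smul, ← lie_skew, hc, neg_zero, smul_zero]
      exact Submodule.zero_mem (Submodule.span k {c}) }

/-- The last nonzero term of the lower central series is central, and lies in `[L, L]` unless `L` is
abelian. -/
theorem exists_central_mem_lcs_one {L : Type u} [LieRing L] [LieAlgebra k L]
    [LieRing.IsNilpotent L] (h : ¬ ∀ y z : L, ⁅y, z⁆ = 0) :
    ∃ c : L, c ≠ 0 ∧ c ∈ lowerCentralSeries k L L 1 ∧ ∀ y : L, ⁅c, y⁆ = 0 := by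
  have hn : Nontrivial L := by
    by_contra hn
    rw [not_nontrivial_iff_subsingleton] at hn
    exact h fun _ _ => Subsingleton.elim _ _
  have h1 : lowerCentralSeriesLast k L L ≤ lowerCentralSeries k L L 1 :=
    lowerCentralSeriesLast_le_of_not_isTrivial k L L fun ht => h ht.trivial
  have h2 := lowerCentralSeriesLast_le_max_triv k L L
  have h3 := nontrivial_lowerCentralSeriesLast k L L
  obtain ⟨⟨c, hc⟩, hc0⟩ := exists_ne (0 : lowerCentralSeriesLast k L L)
  refine ⟨c, fun e => hc0 (Subtype.ext e), h1 hc, fun y => ?_⟩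
  rw [← lie_skew, (mem_maxTrivSubmodule k L L c).1 (h2 hc) y, neg_zero]

/-- The splitting of a Lie algebra over its quotient by a central line. -/
def LineSplitting.ofCentral {L : Type u} [LieRing L] [LieAlgebra k L] (c : L)
    (hc : ∀ y : L, ⁅c, y⁆ = 0) (φ : L →ₗ[k] k) (hφ : φ c = 1) :
    LineSplitting k L (L ⧸ centralIdeal (k := k) c hc) where
  s := Submodule.liftQ (centralIdeal (k := k) c hc).toSubmodule (LinearMap.id - φ.smulRight c) (by
    intro y hy
    obtain ⟨a, rfl⟩ := Submodule.mem_span_singleton.1 hy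
    simp [hφ])
  r := Submodule.mkQ (centralIdeal (k := k) c hc).toSubmodule
  φ := φ
  c := c
  r_s w := by
    obtain ⟨w, rfl⟩ := Submodule.mkQ_surjective _ w
    change Submodule.Quotient.mk (w - φ w • c) = Submodule.Quotient.mk w
    rw [Submodule.Quotient.eq, sub_sub_cancel_left]
    exact Submodule.neg_mem _ (Submodule.smul_mem _ _ (Submodule.mem_span_singleton_self c))
  φ_s w := by
    obtain ⟨w, rfl⟩ := Submodule.mkQ_surjective _ w
    change φ (w - φ w • c) = 0
    simp [hφ]
  r_c := (Submodule.Quotient.mk_eq_zero _).2 (Submodule.mem_span_singleton_self c)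
  φ_c := hφ
  decomp v := by
    exact sub_add_cancel v (φ v • c)

/-- Induction on the dimension, for all nilpotent `L` whose abelianization is identified with `kⁿ`
by `χ` and whose action on `A` is given by `f` through `χ`. These data survive the quotient by a
central line inside `[L, L]`, which does not change the abelianization. -/
theorem prop_ceCochain_iff_koszul (f : Fin n → A) (P : ObjectProperty (ModD A)) [P.IsTriangulated]
    [P.IsClosedUnderIsomorphisms]
    (hP : ∀ (E : CochainComplex (ModuleCat.{u} A) ℤ) (R : ModD A), E.IsKProjective →
      Retract R (DerivedCategory.Q.obj E) → P (DerivedCategory.Q.obj E) → P R) (N : ℕ) :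
    ∀ (L : Type u) [LieRing L] [LieAlgebra k L] [LieRing.IsNilpotent L] [Module.Finite k L]
      (χ : L →ₗ[k] (Fin n → k)) (ψ : UniversalEnvelopingAlgebra k L →ₐ[k] A),
      Module.finrank k L = N → Function.Surjective χ → (∀ y z : L, χ ⁅y, z⁆ = 0) →
      (∀ y, χ y = 0 → y ∈ lowerCentralSeries k L L 1) →
      (∀ y, envMap ψ y = ∑ i, χ y i • f i) →
      (P (DerivedCategory.Q.obj (ceCochain ψ)) ↔ P (chainToD (koszulComplex f))) := by
  induction N using Nat.strong_induction_on with
  | _ N ih =>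
  intro L _ _ _ _ χ ψ hN hsurj hχ hker hψ
  by_cases hL : ∀ y z : L, ⁅y, z⁆ = 0
  · have hinj : Function.Injective χ := (injective_iff_map_eq_zero χ).2 fun y hy =>
      lieHom_lcs_one (LinearMap.id : L →ₗ[k] L) hL y (hker y hy)
    exact P.prop_iff_of_iso (ceKoszulIso f (LinearEquiv.ofBijective χ ⟨hinj, hsurj⟩) ψ hψ hL)
  · obtain ⟨c, hc0, hc1, hc⟩ := exists_central_mem_lcs_one (k := k) hL
    obtain ⟨φ, hφ⟩ : ∃ φ : L →ₗ[k] k, φ c = 1 := by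
      obtain ⟨φ, hφ⟩ : ∃ φ : Module.Dual k L, φ c ≠ 0 := by
        by_contra! h
        exact hc0 ((Module.forall_dual_apply_eq_zero_iff k c).1 h)
      exact ⟨(φ c)⁻¹ • φ, by simp [hφ]⟩
    let I := centralIdeal (k := k) c hc
    let D := LineSplitting.ofCentral c hc φ hφ
    let mk : L →ₗ⁅k⁆ L ⧸ I := { Submodule.mkQ I.toSubmodule with map_lie' := fun {_ _} => rfl }
    have hmk : Function.Surjective mk := Submodule.mkQ_surjective I.toSubmodule
    have : LieRing.IsNilpotent (L ⧸ I) :=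
      Function.Surjective.lieAlgebra_isNilpotent (R := k) (f := mk) hmk
    have : Module.Finite k (L ⧸ I) := Module.Finite.of_surjective mk.toLinearMap hmk
    have hfin : Module.finrank k (L ⧸ I) < N := by
      have h1 := Submodule.finrank_quotient_add_finrank I.toSubmodule
      have h2 : Module.finrank k I.toSubmodule = 1 := finrank_span_singleton hc0
      rw [hN, h2] at h1
      change Module.finrank k (L ⧸ I.toSubmodule) < N
      omega
    have hχc : χ c = 0 := lieHom_lcs_one χ hχ c hc1
    let χ' : (L ⧸ I) →ₗ[k] (Fin n → k) := Submodule.liftQ I.toSubmodule χ (by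
      intro y hy
      obtain ⟨a, rfl⟩ := Submodule.mem_span_singleton.1 hy
      rw [LinearMap.mem_ker, map_smul, hχc, smul_zero])
    have hχ' : ∀ y, χ' (mk y) = χ y := fun _ => rfl
    have hlie : ∀ y z : L ⧸ I, χ' ⁅y, z⁆ = 0 := fun y z => by
      obtain ⟨y, rfl⟩ := hmk y
      obtain ⟨z, rfl⟩ := hmk z
      rw [← LieHom.map_lie, hχ', hχ]
    let ψ' : UniversalEnvelopingAlgebra k (L ⧸ I) →ₐ[k] A :=
      UniversalEnvelopingAlgebra.lift k (coordLie χ' hlie f)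
    have hψ' : ∀ y, envMap ψ' y = ∑ i, χ' y i • f i := fun y => by
      rw [envMap, UniversalEnvelopingAlgebra.lift_ι_apply]
      exact Fintype.linearCombination_apply k f _
    refine (D.prop_ceCochain_iff (ψ' := ψ') (fun y z => rfl) (fun y => ?_) hc P hP).trans
      (ih _ hfin (L ⧸ I) χ' ψ' rfl (fun v => ?_) hlie (fun y hy => ?_) hψ')
    · rw [hψ', hψ]
      rfl
    · obtain ⟨y, rfl⟩ := hsurj v
      exact ⟨mk y, rfl⟩
    · obtain ⟨y, rfl⟩ := hmk y
      rw [hχ'] at hy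
      exact lcs_succ_induction (P := fun y => mk y ∈ lowerCentralSeries k (L ⧸ I) (L ⧸ I) 1)
        (by rw [map_zero]; exact zero_mem _) (fun x y hx hy => by rw [map_add]; exact add_mem hx hy)
        (fun a x hx => by rw [map_smul]; exact SMulMemClass.smul_mem a hx)
        (fun a b _ => by rw [LieHom.map_lie]; exact lie_mem_lcs_one _ _) y (hker y hy)

variable {d : ℕ}

theorem prop_nilp_iff_koszul (f : Fin n → A) (hd : 1 ≤ d) (P : ObjectProperty (ModD A))
    [P.IsTriangulated] [P.IsClosedUnderIsomorphisms]
    (hP : ∀ (E : CochainComplex (ModuleCat.{u} A) ℤ) (R : ModD A), E.IsKProjective →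
      Retract R (DerivedCategory.Q.obj E) → P (DerivedCategory.Q.obj E) → P R) :
    P (DerivedCategory.Q.obj (ceCochain (nilpToAlg (k := k) f hd))) ↔
      P (chainToD (koszulComplex f)) :=
  prop_ceCochain_iff_koszul f P hP _ _ (nilpCoord k n hd) _ rfl
    (fun c => ⟨_, nilpCoord_sum hd c⟩) (nilpCoord_lie hd) (nilpCoord_ker hd) (envMap_nilpToAlg f hd)

instance (X : ModD A) : (thickSubcat X).IsTriangulated :=
  inferInstanceAs (ObjectProperty.triangEnvelope _).IsTriangulated

instance (X : ModD A) : (thickSubcat X).IsStableUnderRetracts :=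
  inferInstanceAs (ObjectProperty.triangEnvelope _).IsStableUnderRetracts

theorem thickSubcat_koszul_eq (f : Fin n → A) (hd : 1 ≤ d) :
    thickSubcat (chainToD (koszulComplex f)) =
      thickSubcat (DerivedCategory.Q.obj (ceCochain (nilpToAlg (k := k) f hd))) := by
  have h : ∀ X : ModD A, _ := fun X => prop_nilp_iff_koszul (k := k) f hd (thickSubcat X)
    fun E R _ r hE => ObjectProperty.prop_of_retract _ r hE
  have hself : ∀ X : ModD A, thickSubcat X X := fun X =>
    ObjectProperty.le_triangEnvelope _ _ (ObjectProperty.singleton_iff _ _ |>.2 rfl)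
  have hle : ∀ X Y : ModD A, thickSubcat Y X → thickSubcat X ≤ thickSubcat Y := fun X Y hX => by
    refine (ObjectProperty.triangEnvelope_le_iff _).2 ?_
    rintro _ ⟨⟩
    exact hX
  exact le_antisymm (hle _ _ ((h _).1 (hself _))) (hle _ _ ((h _).2 (hself _)))

theorem localizingSubcat_koszul_eq (f : Fin n → A) (hd : 1 ≤ d) :
    localizingSubcat (chainToD (koszulComplex f)) =
      localizingSubcat (DerivedCategory.Q.obj (ceCochain (nilpToAlg (k := k) f hd))) := by
  have h : ∀ P : ObjectProperty (ModD A), P.IsTriangulated → P.IsClosedUnderIsomorphisms →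
      (∀ J : Type u, P.IsClosedUnderColimitsOfShape (Discrete J)) → _ := fun P _ _ hJ =>
    prop_nilp_iff_koszul (k := k) f hd P fun E R _ r hE =>
      -- Closure under sums is assumed for index types in `Type u`, so `ℕ` is lifted there.
      prop_of_retract_of_isKProjective P (J := ULift.{u} ℕ) Equiv.ulift.symm E r hE
  funext Y
  refine propext ⟨fun H P h1 h2 h3 hX => H P h1 h2 h3 ((h P h1 h2 h3).1 hX),
    fun H P h1 h2 h3 hX => H P h1 h2 h3 ((h P h1 h2 h3).2 hX)⟩

end ThickLocalizing

/-! ### Lifting along nilpotent deformations, and the theorem. -/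

section Deformation

open LieModule

variable {k : Type u} [Field k] {A : Type u} [CommRing A] [Algebra k A] {n d : ℕ}

/-- A Lie algebra map from the free Lie algebra that kills the `d`-th term of the lower central
series factors through the free nilpotent Lie algebra. -/
def nilpLift {L : Type u} [LieRing L] [LieAlgebra k L] (g : FreeLieAlgebra k (Fin n) →ₗ⁅k⁆ L)
    (h : ∀ z ∈ lowerCentralSeries k (FreeLieAlgebra k (Fin n)) (FreeLieAlgebra k (Fin n)) d,
      g z = 0) : NilpFree k n d →ₗ⁅k⁆ L :=
  { Submodule.liftQ (lowerCentralSeries k (FreeLieAlgebra k (Fin n)) (FreeLieAlgebra k (Fin n))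
      d).toSubmodule g.toLinearMap h with
    map_lie' := fun {x y} => by
      obtain ⟨x, rfl⟩ := LieSubmodule.Quotient.surjective_mk' _ x
      obtain ⟨y, rfl⟩ := LieSubmodule.Quotient.surjective_mk' _ y
      exact g.map_lie x y }

section

variable {R : Type u} [CommRing R] {A' : Type u} [Ring A'] [Algebra R A'] [Algebra k A']
  (m : Ideal R) (π : A' →ₐ[k] A) (hπ : RingHom.ker π = m.map (algebraMap R A'))
include hπ

/-- Ideals of `A'` are left ideals, so a coefficient `a` of `t` must be absorbed into `u`: `u * a`
is again in the kernel, and scalars from `R` are central. -/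
theorem mul_mem_map_pow_succ (i : ℕ) : ∀ t ∈ (m ^ i).map (algebraMap R A'), ∀ u : A', π u = 0 →
    u * t ∈ (m ^ (i + 1)).map (algebraMap R A') := by
  intro t ht
  induction ht using Submodule.span_induction with
  | mem t ht =>
    obtain ⟨r, hr, rfl⟩ := ht
    intro u hu
    have hu' : u ∈ m.map (algebraMap R A') := by
      rw [← hπ]
      exact hu
    clear hu
    induction hu' using Submodule.span_induction with
    | mem u hu =>
      obtain ⟨s, hs, rfl⟩ := hu
      rw [← map_mul]
      refine Ideal.mem_map_of_mem _ ?_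
      rw [pow_succ']
      exact Ideal.mul_mem_mul hs hr
    | zero => rw [zero_mul]; exact zero_mem _
    | add x y _ _ hx hy => rw [add_mul]; exact add_mem hx hy
    | smul a x _ hx => rw [smul_eq_mul, mul_assoc]; exact Ideal.mul_mem_left _ a hx
  | zero => intro u _; rw [mul_zero]; exact zero_mem _
  | add x y _ _ hx hy => intro u hu; rw [mul_add]; exact add_mem (hx u hu) (hy u hu)
  | smul a x _ hx =>
    intro u hu
    rw [smul_eq_mul, ← mul_assoc]
    exact hx _ (by rw [map_mul, hu, zero_mul])

/-- By Leibniz, with `R` central, only brackets `[b, a]` of coefficients matter. They vanish in the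
commutative ring `A`, so they lie in `𝔪 A'` and gain one power of `𝔪`. -/
theorem lie_mem_map_pow_succ (i : ℕ) (b : A') : ∀ t ∈ (m ^ i).map (algebraMap R A'),
    ⁅b, t⁆ ∈ (m ^ (i + 1)).map (algebraMap R A') := by
  intro t ht
  have ht' := ht
  induction ht using Submodule.span_induction with
  | mem t ht =>
    obtain ⟨r, hr, rfl⟩ := ht
    rw [LieRing.of_associative_ring_bracket, Algebra.commutes, sub_self]
    exact zero_mem _
  | zero => rw [lie_zero]; exact zero_mem _
  | add x y hx' hy' hx hy => rw [lie_add]; exact add_mem (hx hx') (hy hy')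
  | smul a x hx' hx =>
    have e : ⁅b, a • x⁆ = ⁅b, a⁆ * x + a * ⁅b, x⁆ := by
      simp only [LieRing.of_associative_ring_bracket, smul_eq_mul]
      noncomm_ring
    rw [e]
    refine add_mem (mul_mem_map_pow_succ m π hπ i x hx' _ ?_) (Ideal.mul_mem_left _ a (hx hx'))
    rw [LieRing.of_associative_ring_bracket, map_sub, map_mul, map_mul, mul_comm, sub_self]

theorem map_lcs_mem {L : Type u} [LieRing L] [LieAlgebra k L] (g : L →ₗ⁅k⁆ A')
    (i : ℕ) :
    ∀ z ∈ lowerCentralSeries k L L i, g z ∈ (m ^ i).map (algebraMap R A') := by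
  induction i with
  | zero =>
    intro z _
    rw [pow_zero, Ideal.one_eq_top, Ideal.map_top]
    exact Submodule.mem_top
  | succ i ih =>
    refine lcs_succ_induction ?_ ?_ ?_ ?_
    · rw [map_zero]; exact zero_mem _
    · intro x y hx hy
      rw [map_add]; exact add_mem hx hy
    · intro c x hx
      rw [map_smul, ← smul_one_mul]
      exact Ideal.mul_mem_left _ _ hx
    · intro y w hw
      rw [LieHom.map_lie]
      exact lie_mem_map_pow_succ m π hπ i _ _ (ih w hw)

/-- The map `U → A` lifts along a surjection whose kernel is generated by a central nilpotent
ideal. -/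
theorem exists_lift_nilpToAlg (f : Fin n → A) (hd : 1 ≤ d) (hm : m ^ d = ⊥)
    (hsurj : Function.Surjective π) : ∃ ψ : NilpEnv k n d →ₐ[k] A', π.comp ψ = nilpToAlg f hd := by
  choose f' hf' using fun i => hsurj (f i)
  let g : FreeLieAlgebra k (Fin n) →ₗ⁅k⁆ A' := FreeLieAlgebra.lift k f'
  have hg : ∀ z ∈ lowerCentralSeries k (FreeLieAlgebra k (Fin n)) (FreeLieAlgebra k (Fin n)) d,
      g z = 0 := fun z hz => by
    have := map_lcs_mem m π hπ g d z hz
    rwa [hm, Ideal.map_bot] at this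
  refine ⟨UniversalEnvelopingAlgebra.lift k (nilpLift g hg), ?_⟩
  ext y
  obtain ⟨x, rfl⟩ := nilpMk_surjective y
  change π (UniversalEnvelopingAlgebra.lift k (nilpLift g hg)
    (UniversalEnvelopingAlgebra.ι k (nilpMk x))) =
      nilpToAlg f hd (UniversalEnvelopingAlgebra.ι k (nilpMk x))
  rw [nilpToAlg, UniversalEnvelopingAlgebra.lift_ι_apply, UniversalEnvelopingAlgebra.lift_ι_apply]
  have h : π.toLieHom.comp g = FreeLieAlgebra.lift k f := FreeLieAlgebra.hom_ext fun i => by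
    rw [LieHom.comp_apply, FreeLieAlgebra.lift_of_apply, FreeLieAlgebra.lift_of_apply]
    exact hf' i
  exact LieHom.congr_fun h x

end

theorem isDerivedExtScal_trivialObj (f : Fin n → A) (hd : 1 ≤ d) :
    IsDerivedExtScal (nilpToAlg (k := k) f hd).toRingHom (trivialObj k n d)
      (DerivedCategory.Q.obj (ceCochain (nilpToAlg (k := k) f hd))) := by
  have h := isDerivedExtScal_ceCochain (AlgHom.id k (NilpEnv k n d)) (nilpToAlg (k := k) f hd)
    (nonempty_ceCochain_iso_single (k := k) (L := NilpFree k n d))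
  rw [AlgHom.comp_id] at h
  exact h

end Deformation

theorem mainTheorem3 {k : Type u} [Field k] {A : Type u} [CommRing A] [Algebra k A]
    {n : ℕ} (f : Fin n → A) (d : ℕ) (hd : 1 ≤ d) :
    ∃ X : ModD A,
      Nonempty (X ≅ chainToD (ceComplex (nilpToAlg (k := k) f hd))) ∧
      IsDerivedExtScal (nilpToAlg (k := k) f hd).toRingHom (trivialObj k n d) X ∧
      IsPerfectObj X ∧
      thickSubcat (chainToD (koszulComplex f)) = thickSubcat X ∧
      localizingSubcat (chainToD (koszulComplex f)) = localizingSubcat X ∧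
      ∀ (R : Type u) [CommRing R] [IsLocalRing R] [Algebra k R] [Module.Finite k R],
        Function.Bijective (algebraMap k (R ⧸ IsLocalRing.maximalIdeal R)) →
        IsLocalRing.maximalIdeal R ^ d = ⊥ →
        ∀ (A' : Type u) [Ring A'] [Algebra R A'] [Algebra k A'] [IsScalarTower k R A']
          (π : A' →ₐ[k] A), Function.Surjective π →
          (RingHom.ker π : Ideal A') =
            (IsLocalRing.maximalIdeal R).map (algebraMap R A') →
          ∃ X' : ModD A', IsPerfectObj X' ∧ IsDerivedExtScal π.toRingHom X' X := by
  refine ⟨DerivedCategory.Q.obj (ceCochain (nilpToAlg (k := k) f hd)), ⟨(chainToDIso _).symm⟩,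
    isDerivedExtScal_trivialObj f hd, isPerfectObj_ceCochain _, thickSubcat_koszul_eq f hd,
    localizingSubcat_koszul_eq f hd, ?_⟩
  intro R _ _ _ _ _ hm A' _ _ _ _ π hsurj hπ
  obtain ⟨ψ, hψ⟩ := exists_lift_nilpToAlg (k := k) _ π hπ f hd hm hsurj
  have h := isDerivedExtScal_ceCochain ψ π ⟨Iso.refl _⟩
  rw [hψ] at h
  -- `X'` is the Chevalley–Eilenberg complex over `A'`; since `π ∘ ψ` is the given map `U → A`, base
  -- change along `π` returns `X`.
  exact ⟨_, isPerfectObj_ceCochain ψ, h⟩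

end
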